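/- **Theorem 1 (Consistency of the changepoint configuration).** *Model.* Let $T\ge 1$ and $p\ge 0$ be fixed integers. Let $\{Z_t\}_{t\in\mathbb Z}$ be iid with mean $0$ and variance $\sigma^2\in(0,\infty)$ (for instance Gaussian). Let $\{\epsilon_t\}$ be a causal AR($p$) process: $\epsilon_t=\sum_{j=1}^p\phi_j\epsilon_{t-j}+Z_t$ and $\epsilon_t=\sum_{j\ge 0}\psi_jZ_{t-j}$ almost surely for all $t$, for some $\psi$ with $\sum_j|\psi_j|<\infty$. A relative changepoint configuration is a vector $\boldsymbol\lambda=(\lambda_1,\dots,\lambda_m)$, $m\ge 0$, with $0=\lambda_0<\lambda_1<\dots<\lambda_m<\lambda_{m+1}=1$. For sample size $N$ its changepoint times are $\tau_r=\lfloor\lambda_rN\rfloor$ ($1\le r\le m$), and time $t\in\{1,\dots,N\}$ lies in regime $r(t)=1+\#\{r:\tau_r\le t\}$. The true configuration $\boldsymbol\lambda^0$ has $m^0$ changepoints and true regimes $r^0(t)$ (infill asymptotics: $\boldsymbol\lambda^0$ and all parameters are fixed). The data are $$X_t=s_{v(t)}+\mu_{r^0(t)}+\epsilon_t,\quad 1\le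 t\le N,\qquad v(t)=t-T\lfloor (t-1)/T\rfloor,$$ with seasonal means $s_1,\dots,s_T\in\mathbb R$ and regime means $\mu_1=0,\mu_2,\dots,\mu_{m^0+1}\in\mathbb R$, where $\mu_r\ne\mu_{r+1}$ for $1\le r\le m^0$. *Criterion.* Fix $\nu,a,b^{(1)},b^{(2)}>0$. For each $N$ let a deterministic set of documented times be given (metadata). Let $N^{(2)}$ and $N^{(1)}$ be the numbers of documented and of undocumented times in $\{p+1,\dots,N\}$. Assume, for each $k\in\{1,2\}$, that either $N^{(k)}=0$ for all large $N$ (for instance no metadata) or $N^{(k)}\ge\kappa N$ for all large $N$ and some $\kappa>0$. For a configuration $\boldsymbol\lambda$ with $m$ changepoints, let $m^{(2)}$ and $m^{(1)}$ be the numbers of its $\tau_r$ in $\{p+1,\dots,N\}$ that are documented and undocumented. Let $\mathbf A_{tv}=\mathbf 1(v(t)=v)$ ($N\times T$) and $\mathbf D_{t,r-1}=\mathbf 1(r(t)=r)$, $2\le r\le m+1$ ($N\times m$). Let $e$ be the residual of $\mathbf X=(X_1,\dots,X_N)'$ after orthogonal projection onto the column space of $[\mathbf A|\mathbf D]$, let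 $\hat\gamma(h)=N^{-1}\sum_{t=h+1}^Ne_te_{t-h}$, and let $\hat{\boldsymbol\phi}=(\hat\gamma(|i-j|))_{i,j\le p}^{-1}(\hat\gamma(1),\dots,\hat\gamma(p))'$ be the Yule–Walker estimator. Let $\widehat{\mathbf X},\widehat{\mathbf A},\widehat{\mathbf D}$, with rows $t=p+1,\dots,N$, be obtained from $\mathbf X,\mathbf A,\mathbf D$ by replacing each row $x_t$ by $x_t-\sum_{j=1}^p\hat\phi_jx_{t-j}$. Put $$\widehat{\mathbf B}=\mathbf I-\widehat{\mathbf D}\big(\widehat{\mathbf D}'\widehat{\mathbf D}+\tfrac1\nu\mathbf I_m\big)^{-1}\widehat{\mathbf D}',\qquad \hat\sigma^2=\tfrac1{N-p}\widehat{\mathbf X}'\big\{\widehat{\mathbf B}-\widehat{\mathbf B}\widehat{\mathbf A}(\widehat{\mathbf A}'\widehat{\mathbf B}\widehat{\mathbf A})^{-1}\widehat{\mathbf A}'\widehat{\mathbf B}\big\}\widehat{\mathbf X},$$ $$\mathrm{BMDL}(\boldsymbol\lambda)=\tfrac{N-p}2\log\hat\sigma^2+\tfrac m2\log\nu+\tfrac12\log\big|\widehat{\mathbf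 D}'\widehat{\mathbf D}+\tfrac1\nu\mathbf I_m\big|-\sum_{k=1}^2\log\big\{\Gamma(a+m^{(k)})\,\Gamma(b^{(k)}+N^{(k)}-m^{(k)})\big\}.$$ *Estimator.* Let $M$ be a fixed integer and $d>0$, with $m^0\le M$ and $d<\lambda^0_r-\lambda^0_{r-1}$ for $1\le r\le m^0+1$, and let $\boldsymbol\Lambda$ be the set of configurations with $m\le M$ and $\lambda_r-\lambda_{r-1}\ge d$ for $1\le r\le m+1$. For each $N$ let $\hat{\boldsymbol\lambda}_N$, with $\hat m_N$ changepoints, be any minimizer of $\mathrm{BMDL}$ over $\boldsymbol\Lambda$. *Conclusion.* As $N\to\infty$, $\hat m_N\to m^0$ in probability and $\hat{\boldsymbol\lambda}_N\to\boldsymbol\lambda^0$ in probability, that is, for each $\delta>0$ the probability that $\hat m_N=m^0$ and $\max_r|\hat\lambda_r-\lambda^0_r|\le\delta$ tends to $1$. Moreover, for each $r=1,\dots,m^0$, $$|\hat\lambda_r-\lambda_r^0|=O_P(1/N),$$ that is, for each $\delta>0$ there is a $C$ such that, for all large $N$, the event that $\hat m_N=m^0$ and $|\hat\lambda_r-\lambda^0_r|\le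 C/N$ fails with probability at most $\delta$. -/

import Mathlib

open MeasureTheory ProbabilityTheory Filter Topology
open scoped Matrix

noncomputable section

namespace BMDL

/-- A relative changepoint configuration `λ = (λ_1, …, λ_m)` on the rescaled time line `[0, 1]`. -/
structure RelConfig where
  /-- the number `m` of changepoints -/
  m : ℕ
  /-- the relative locations; the entry with index `r : Fin m` is `λ_{r+1}` -/
  loc : Fin m → ℝ

namespace RelConfig

/-- The locations with both edges attached: `λ_0 = 0`, `λ_1, …, λ_m`, `λ_{m+1} = 1`. -/
def ext (c : RelConfig) : Fin (c.m + 2) → ℝ :=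
  Fin.cons (0 : ℝ) (Fin.snoc c.loc (1 : ℝ) : Fin (c.m + 1) → ℝ)

/-- The changepoint time `τ_r = ⌊λ_r N⌋` for sample size `N`. -/
def tau (c : RelConfig) (N : ℕ) (r : Fin c.m) : ℕ := ⌊c.loc r * (N : ℝ)⌋₊

/-- The regime that time `t` lies in, numbered from `0` to `m`: the number of changepoint times
`τ_r ≤ t`.  For increasing `τ` it is the `r` with `τ_r ≤ t < τ_{r+1}`. -/
def regime (c : RelConfig) (N t : ℕ) : Fin (c.m + 1) :=
  ⟨(Finset.univ.filter fun r : Fin c.m => c.tau N r ≤ t).card, by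
    have h := Finset.card_filter_le (Finset.univ : Finset (Fin c.m)) fun r => c.tau N r ≤ t
    rw [Finset.card_univ, Fintype.card_fin] at h
    omega⟩

end RelConfig

/-- The set `Λ` of candidate configurations: at most `M` changepoints, and
`λ_r - λ_{r-1} ≥ d` for `r = 1, …, m + 1`. -/
def admissible (M : ℕ) (d : ℝ) : Set RelConfig :=
  {c | c.m ≤ M ∧ ∀ r : Fin (c.m + 1), d ≤ c.ext r.succ - c.ext r.castSucc}

/-- The season of time `t ≥ 1` for period `T`, numbered from `0` to `T - 1`. -/
def season (T t : ℕ) : ℕ := (t - 1) % T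

/-- The `v`-th column of the seasonal indicator matrix, as a function of time. -/
def seasonCol (T : ℕ) (v : Fin T) (t : ℕ) : ℝ := if season T t = (v : ℕ) then 1 else 0

/-- The columns of the regime indicator matrix, one for each regime except the first,
as functions of time. -/
def regimeCol (c : RelConfig) (N : ℕ) (r : Fin c.m) (t : ℕ) : ℝ :=
  if c.regime N t = r.succ then 1 else 0

/-- The vector `(x_1, …, x_N)` of a function of time. -/
def sample (N : ℕ) (x : ℕ → ℝ) : EuclideanSpace ℝ (Fin N) :=
  WithLp.toLp 2 fun i => x ((i : ℕ) + 1)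

/-- The column space of the block matrix `[A_{1:N} | D_{1:N}]`. -/
def designSpace (T N : ℕ) (c : RelConfig) : Submodule ℝ (EuclideanSpace ℝ (Fin N)) :=
  Submodule.span ℝ
    (Set.range (fun v : Fin T => sample N (seasonCol T v)) ∪
      Set.range (fun r : Fin c.m => sample N (regimeCol c N r)))

/-- The ordinary least squares residuals `(I_N - P_{[A|D]}) X_{1:N}`. -/
def olsResid (T N : ℕ) (c : RelConfig) (x : ℕ → ℝ) : EuclideanSpace ℝ (Fin N) :=
  sample N x - (designSpace T N c).starProjection (sample N x)

/-- The sample autocovariance of the residuals at lag `h`,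
`N⁻¹ ∑_{t = h+1}^N e_t e_{t-h}`. -/
def gammaHat (T N : ℕ) (c : RelConfig) (x : ℕ → ℝ) (h : ℕ) : ℝ :=
  (∑ i : Fin (N - h), olsResid T N c x ⟨(i : ℕ) + h, by omega⟩ *
    olsResid T N c x ⟨(i : ℕ), by omega⟩) / (N : ℝ)

/-- The Yule–Walker estimator of the autoregression coefficients. -/
def phiHat (T p N : ℕ) (c : RelConfig) (x : ℕ → ℝ) : Fin p → ℝ :=
  (Matrix.of fun i j : Fin p => gammaHat T N c x ((i : ℤ) - (j : ℤ)).natAbs)⁻¹ *ᵥ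
    fun i : Fin p => gammaHat T N c x ((i : ℕ) + 1)

/-- The autoregressive filter: the entry for time `t = p + 1, …, N` is
`x_t - ∑_{j=1}^p φ_j x_{t-j}`; the index `i : Fin (N - p)` stands for `t = p + 1 + i`, the index
`j : Fin p` for the lag `j + 1`. -/
def arFilter (p N : ℕ) (phi : Fin p → ℝ) (x : ℕ → ℝ) (i : Fin (N - p)) : ℝ :=
  x (p + 1 + (i : ℕ)) - ∑ j : Fin p, phi j * x (p + 1 + (i : ℕ) - ((j : ℕ) + 1))

/-- The filtered data. -/
def Xhat (T p N : ℕ) (c : RelConfig) (x : ℕ → ℝ) : Fin (N - p) → ℝ :=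
  arFilter p N (phiHat T p N c x) x

/-- The filtered seasonal indicator matrix. -/
def Ahat (T p N : ℕ) (c : RelConfig) (x : ℕ → ℝ) : Matrix (Fin (N - p)) (Fin T) ℝ :=
  Matrix.of fun i v => arFilter p N (phiHat T p N c x) (seasonCol T v) i

/-- The filtered regime indicator matrix. -/
def Dhat (T p N : ℕ) (c : RelConfig) (x : ℕ → ℝ) : Matrix (Fin (N - p)) (Fin c.m) ℝ :=
  Matrix.of fun i r => arFilter p N (phiHat T p N c x) (regimeCol c N r) i

/-- `D̂'D̂ + I_m / ν`. -/
def ridge (T p N : ℕ) (nu : ℝ) (c : RelConfig) (x : ℕ → ℝ) : Matrix (Fin c.m) (Fin c.m) ℝ :=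
  (Dhat T p N c x)ᵀ * Dhat T p N c x + (1 / nu) • (1 : Matrix (Fin c.m) (Fin c.m) ℝ)

/-- `B̂ = I_{N-p} - D̂ (D̂'D̂ + I_m / ν)⁻¹ D̂'`. -/
def Bhat (T p N : ℕ) (nu : ℝ) (c : RelConfig) (x : ℕ → ℝ) :
    Matrix (Fin (N - p)) (Fin (N - p)) ℝ :=
  1 - Dhat T p N c x * (ridge T p N nu c x)⁻¹ * (Dhat T p N c x)ᵀ

/-- The estimator `σ̂² = (N-p)⁻¹ X̂' {B̂ - B̂ Â (Â' B̂ Â)⁻¹ Â' B̂} X̂`. -/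
def sigmaSqHat (T p N : ℕ) (nu : ℝ) (c : RelConfig) (x : ℕ → ℝ) : ℝ :=
  (1 / ((N : ℝ) - (p : ℝ))) *
    (Xhat T p N c x ⬝ᵥ
      ((Bhat T p N nu c x -
          Bhat T p N nu c x * Ahat T p N c x *
            ((Ahat T p N c x)ᵀ * Bhat T p N nu c x * Ahat T p N c x)⁻¹ *
            (Ahat T p N c x)ᵀ * Bhat T p N nu c x) *ᵥ Xhat T p N c x))

/-- The undocumented (`k = 0`) and the documented (`k = 1`) times among `p + 1, …, N`, where
`doc` is the set of times listed in the metadata. -/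
def timeClass (p N : ℕ) (doc : Finset ℕ) (k : Fin 2) : Finset ℕ :=
  if k = 0 then Finset.Icc (p + 1) N \ doc else Finset.Icc (p + 1) N ∩ doc

/-- The number of changepoints of a configuration among the times of class `k`. -/
def numChanges (p N : ℕ) (doc : Finset ℕ) (c : RelConfig) (k : Fin 2) : ℕ :=
  (Finset.univ.filter fun r : Fin c.m => c.tau N r ∈ timeClass p N doc k).card

/-- The Bayesian minimum description length of the configuration `c` for the data
`x 1, …, x N`. -/
def bmdl (T p : ℕ) (nu a : ℝ) (b : Fin 2 → ℝ) (doc : Finset ℕ) (N : ℕ) (x : ℕ → ℝ)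
    (c : RelConfig) : ℝ :=
  ((N : ℝ) - (p : ℝ)) / 2 * Real.log (sigmaSqHat T p N nu c x)
    + (c.m : ℝ) / 2 * Real.log nu
    + 1 / 2 * Real.log (ridge T p N nu c x).det
    - ∑ k : Fin 2, Real.log
        (Real.Gamma (a + (numChanges p N doc c k : ℝ)) *
          Real.Gamma (b k + ((timeClass p N doc k).card : ℝ) - (numChanges p N doc c k : ℝ)))

/-- `Z` is a sequence of independent, identically distributed, square integrable random variables
with mean zero and variance `sigmaSq`. -/
structure IsIIDNoise {Ω : Type*} [MeasurableSpace Ω] (P : Measure Ω) (Z : ℤ → Ω → ℝ)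
    (sigmaSq : ℝ) : Prop where
  indep : iIndepFun Z P
  ident : ∀ t, IdentDistrib (Z t) (Z 0) P P
  memLp : MemLp (Z 0) 2 P
  mean_zero : ∫ ω, Z 0 ω ∂P = 0
  variance_eq : variance (Z 0) P = sigmaSq

/-- `e` is a causal autoregressive process of order `p` with coefficients `φ_1, …, φ_p`
(`phi j` is `φ_{j+1}`), driven by `Z`. -/
structure IsCausalAR {Ω : Type*} [MeasurableSpace Ω] (P : Measure Ω) {p : ℕ} (phi : Fin p → ℝ)
    (Z e : ℤ → Ω → ℝ) : Prop where
  recursion : ∀ t : ℤ, ∀ᵐ ω ∂P,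
    e t ω = ∑ j : Fin p, phi j * e (t - (((j : ℕ) : ℤ) + 1)) ω + Z t ω
  causal : ∃ psi : ℕ → ℝ, Summable (fun j => |psi j|) ∧
    ∀ t : ℤ, ∀ᵐ ω ∂P, HasSum (fun j : ℕ => psi j * Z (t - (j : ℤ)) ω) (e t ω)

/-- The observation `X_t = s_{v(t)} + μ_{r(t)} + e_t` at time `t` for sample size `N`, when the
true relative configuration is `c`. -/
def obs {Ω : Type*} {T : ℕ} [NeZero T] (s : Fin T → ℝ) (c : RelConfig) (mu : Fin (c.m + 1) → ℝ)
    (e : ℤ → Ω → ℝ) (N : ℕ) (ω : Ω) (t : ℕ) : ℝ :=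
  s (Fin.ofNat T (t - 1)) + mu (c.regime N t) + e (t : ℤ) ω

/-- `c'` has as many changepoints as `c`, and its `r`-th location is within `δ` of that of `c`. -/
def LocWithin (c c' : RelConfig) (r : Fin c.m) (δ : ℝ) : Prop :=
  ∃ h : c.m = c'.m, |c'.loc (Fin.cast h r) - c.loc r| ≤ δ

/-- `c'` has as many changepoints as `c`, and all its locations are within `δ` of those of `c`. -/
def ConfigWithin (c c' : RelConfig) (δ : ℝ) : Prop :=
  ∃ h : c.m = c'.m, ∀ r : Fin c.m, |c'.loc (Fin.cast h r) - c.loc r| ≤ δ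

end BMDL

end

namespace BMDL

/-! Fix a configuration, fitted means and any coefficients `φ'`. With `u` the fitted minus the true
mean, the filtered residual equals `z - w`, where `w` is `∑ (φ' j - φ j) e (t - j - 1)` plus `u`
filtered by `φ'`. Hence the residual sum of squares is `‖z‖² - 2⟨z, w⟩ + ‖w‖²`
(`GoodPath.energy_residual_eq`), and everything rests on bounding `‖w‖²` from below and `⟨z, w⟩`
from above, uniformly in `φ'`. The behaviour of the Yule–Walker estimator at a wrong configuration
is therefore never needed.

For `‖w‖²`, filtering once more with the true `φ` turns lagged errors into lagged noise, which is
nearly orthonormal after scaling and nearly orthogonal to piecewise periodic functions; the filter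
itself is bounded below because its inverse `ψ` is summable. This gives `‖w‖² ≥ c (N |φ' - φ|² +
‖filtered u‖²)` and `⟨z, w⟩² ≤ δ N ‖w‖²` (`exists_regressor_bounds`). Near the true changepoints a
sharper bound on `⟨z, w⟩` is used: between a true changepoint and a fitted one at distance `k`, the
noise sum is at most `ε k + A` (`exists_abs_sum_noise_lag_le`).

The outcome (`exists_candidate_lower_bound`) is a dichotomy. Either the residual sum of squares
exceeds `‖z‖²` by a multiple of `N`; or every true changepoint is matched with a nearby fitted one,
the matching is strictly increasing, and the excess is at least `c₁ ∑ |τ - τ⁰| - O(1)`. At the true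
configuration the Yule–Walker estimator has error of order `1 / √N`, and the residual sum of squares
is at most `‖z‖² + O(1)` (`exists_sigmaSqHat_true_le`).

The Gamma terms cost `log N` for each changepoint, up to `O(1)`, and the ridge determinant half as
much. In the first alternative the likelihood loses order `N`, more than any gain of order `log N`.
In the second a minimizer satisfies `c ∑ |τ - τ⁰| + (3/2) (m - m⁰) log N ≤ O(1)` with `m⁰ ≤ m`; so
`m = m⁰` for large `N`, and the times are off by `O(1)`, which is the rate `1 / N`
(`exists_loc_near_of_bmdl_le`).

All this is deterministic on paths satisfying `GoodPath` and `SmallFit`. These conditions hold with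
probability near one (`negligible_not_goodPath`) by Kolmogorov's maximal inequality, the strong law
and second moment bounds; only second moments of the noise are used. -/

/-- The autoregressive filter with coefficients `φ`, at time `t`. -/
def arf {p : ℕ} (φ : Fin p → ℝ) (x : ℕ → ℝ) (t : ℕ) : ℝ :=
  x t - ∑ j : Fin p, φ j * x (t - ((j : ℕ) + 1))

/-! ### Energies of sequences under lags and filters -/

/-- The sum of squares of `x` over `[a, b)`. -/
def energy (a b : ℕ) (x : ℕ → ℝ) : ℝ := ∑ t ∈ Finset.Ico a b, x t ^ 2

lemma energy_nonneg (a b : ℕ) (x : ℕ → ℝ) : 0 ≤ energy a b x :=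
  Finset.sum_nonneg fun _ _ => sq_nonneg _

lemma energy_mono {a b a' b' : ℕ} (x : ℕ → ℝ) (ha : a' ≤ a) (hb : b ≤ b') :
    energy a b x ≤ energy a' b' x :=
  Finset.sum_le_sum_of_subset_of_nonneg (Finset.Ico_subset_Ico ha hb) fun _ _ _ => sq_nonneg _

lemma energy_congr {a b : ℕ} {x y : ℕ → ℝ} (h : ∀ t, a ≤ t → t < b → x t = y t) :
    energy a b x = energy a b y :=
  Finset.sum_congr rfl fun t ht => by
    rw [Finset.mem_Ico] at ht; rw [h t ht.1 ht.2]

lemma energy_le_two {a b : ℕ} {x y z : ℕ → ℝ} (h : ∀ t, a ≤ t → t < b → x t = y t + z t) :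
    energy a b x ≤ 2 * energy a b y + 2 * energy a b z := by
  unfold energy
  rw [Finset.mul_sum, Finset.mul_sum, ← Finset.sum_add_distrib]
  refine Finset.sum_le_sum fun t ht => ?_
  rw [Finset.mem_Ico] at ht
  rw [h t ht.1 ht.2]
  nlinarith [sq_nonneg (y t - z t)]

lemma energy_shift_le {a b c k : ℕ} (x : ℕ → ℝ) (h : a + k ≤ c) :
    ∑ t ∈ Finset.Ico c b, x (t - k) ^ 2 ≤ energy a b x := by
  have hinj : Set.InjOn (fun t : ℕ => t - k) (Finset.Ico c b : Finset ℕ) := by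
    intro s hs t ht hst
    simp only [Finset.coe_Ico, Set.mem_Ico] at hs ht hst
    omega
  rw [← Finset.sum_image (f := fun t => x t ^ 2) hinj]
  refine Finset.sum_le_sum_of_subset_of_nonneg ?_ fun _ _ _ => sq_nonneg _
  intro s hs
  simp only [Finset.mem_image, Finset.mem_Ico] at hs ⊢
  omega

lemma energy_lag_le {p : ℕ} (η : Fin p → ℝ) (a b : ℕ) (x : ℕ → ℝ) :
    energy (a + p) b (fun t => ∑ j : Fin p, η j * x (t - ((j : ℕ) + 1))) ≤
      p * (∑ j, η j ^ 2) * energy a b x := by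
  calc energy (a + p) b (fun t => ∑ j : Fin p, η j * x (t - ((j : ℕ) + 1)))
      ≤ ∑ t ∈ Finset.Ico (a + p) b, (∑ j, η j ^ 2) * ∑ j : Fin p, x (t - ((j : ℕ) + 1)) ^ 2 :=
        Finset.sum_le_sum fun t _ => Finset.sum_mul_sq_le_sq_mul_sq _ _ _
    _ = (∑ j, η j ^ 2) * ∑ j : Fin p, ∑ t ∈ Finset.Ico (a + p) b, x (t - ((j : ℕ) + 1)) ^ 2 := by
        rw [← Finset.mul_sum, Finset.sum_comm]
    _ ≤ (∑ j, η j ^ 2) * ∑ j : Fin p, energy a b x := by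
        refine mul_le_mul_of_nonneg_left (Finset.sum_le_sum fun j _ => ?_)
          (Finset.sum_nonneg fun _ _ => sq_nonneg _)
        exact energy_shift_le x (by omega)
    _ = _ := by rw [Finset.sum_const, Finset.card_univ, Fintype.card_fin, nsmul_eq_mul]; ring

lemma energy_arf_le {p : ℕ} (φ : Fin p → ℝ) (a b : ℕ) (x : ℕ → ℝ) :
    energy (a + p) b (arf φ x) ≤ (2 + 2 * (p * ∑ j, φ j ^ 2)) * energy a b x := by
  have h := energy_le_two (a := a + p) (b := b) (x := arf φ x) (y := x)
    (z := fun t => - ∑ j : Fin p, φ j * x (t - ((j : ℕ) + 1))) fun t _ _ => by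
      simp only [arf]; ring
  have h1 := energy_lag_le φ a b x
  have h2 : energy (a + p) b (fun t => - ∑ j : Fin p, φ j * x (t - ((j : ℕ) + 1))) =
      energy (a + p) b (fun t => ∑ j : Fin p, φ j * x (t - ((j : ℕ) + 1))) := by
    simp [energy]
  have h3 := energy_mono x (Nat.le_add_right a p) (le_refl b)
  rw [h2] at h
  linarith

/-! ### Inverting the autoregressive filter -/

/-- The lag polynomial `1 - ∑ φ_j X^{j+1}` as a power series. -/
noncomputable def lagSeries {p : ℕ} (φ : Fin p → ℝ) : PowerSeries ℝ :=
  1 - ∑ j : Fin p, PowerSeries.C (φ j) * PowerSeries.X ^ ((j : ℕ) + 1)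

lemma coeff_lagSeries_mul {p : ℕ} (φ : Fin p → ℝ) (y : PowerSeries ℝ) (n : ℕ) :
    PowerSeries.coeff n (lagSeries φ * y) = PowerSeries.coeff n y -
      ∑ j : Fin p, φ j * if (j : ℕ) + 1 ≤ n then PowerSeries.coeff (n - ((j : ℕ) + 1)) y else 0 := by
  rw [lagSeries, sub_mul, one_mul, map_sub, Finset.sum_mul, map_sum]
  congr 1
  refine Finset.sum_congr rfl fun j _ => ?_
  rw [mul_assoc, PowerSeries.coeff_C_mul, PowerSeries.coeff_X_pow_mul']

/-- Young's inequality for finite stretches of a causal convolution. -/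
lemma sum_sq_convolution_le (ψ g : ℕ → ℝ) (Ψ : ℝ) (hΨ : ∀ n, ∑ k ∈ Finset.range n, |ψ k| ≤ Ψ)
    (L : ℕ) :
    ∑ n ∈ Finset.range L, (∑ k ∈ Finset.range (n + 1), ψ k * g (n - k)) ^ 2 ≤
      Ψ ^ 2 * ∑ n ∈ Finset.range L, g n ^ 2 := by
  have hΨ0 : 0 ≤ Ψ := by simpa using hΨ 0
  have hpt : ∀ n, (∑ k ∈ Finset.range (n + 1), ψ k * g (n - k)) ^ 2 ≤
      Ψ * ∑ k ∈ Finset.range (n + 1), |ψ k| * g (n - k) ^ 2 := by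
    intro n
    have h := Finset.sum_sq_le_sum_mul_sum_of_sq_le_mul (Finset.range (n + 1))
      (r := fun k => ψ k * g (n - k)) (f := fun k => |ψ k|) (g := fun k => |ψ k| * g (n - k) ^ 2)
      (fun _ _ => abs_nonneg _) (fun _ _ => by positivity)
      (fun k _ => le_of_eq (by rw [mul_pow, ← sq_abs (ψ k)]; ring))
    refine h.trans (mul_le_mul_of_nonneg_right (hΨ _) (Finset.sum_nonneg fun _ _ => by positivity))
  calc _ ≤ ∑ n ∈ Finset.range L, Ψ * ∑ k ∈ Finset.range (n + 1), |ψ k| * g (n - k) ^ 2 :=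
        Finset.sum_le_sum fun n _ => hpt n
    _ = Ψ * ∑ k ∈ Finset.range L, ∑ n ∈ Finset.Ico k L, |ψ k| * g (n - k) ^ 2 := by
        rw [← Finset.mul_sum]
        congr 1
        refine Finset.sum_comm' fun n k => ?_
        simp only [Finset.mem_range, Finset.mem_Ico]
        omega
    _ ≤ Ψ * ∑ k ∈ Finset.range L, |ψ k| * ∑ n ∈ Finset.range L, g n ^ 2 := by
        refine mul_le_mul_of_nonneg_left (Finset.sum_le_sum fun k _ => ?_) hΨ0
        rw [← Finset.mul_sum]
        refine mul_le_mul_of_nonneg_left ?_ (abs_nonneg _)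
        have := energy_shift_le (a := 0) (b := L) (c := k) (k := k) g (by omega)
        simpa [energy] using this
    _ ≤ Ψ * (Ψ * ∑ n ∈ Finset.range L, g n ^ 2) := by
        rw [← Finset.sum_mul]
        exact mul_le_mul_of_nonneg_left (mul_le_mul_of_nonneg_right (hΨ _)
          (Finset.sum_nonneg fun _ _ => sq_nonneg _)) hΨ0
    _ = _ := by ring

/-- A block of `T * p` times is a whole number of periods and contains the first `p` times, so the
first `p` values recur in each of `q` consecutive blocks. -/
lemma energy_le_of_periodic_start {T : ℕ} (hT : 0 < T) (p q : ℕ) (y : ℕ → ℝ) (L : ℕ)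
    (hL : T * p * q ≤ L) (hper : ∀ n, T ≤ n → n < T * p * q → y n = y (n - T)) :
    q * energy 0 p y ≤ energy 0 L y := by
  have hblock : ∀ s, s < q → ∀ n, n < T * p → y (T * p * s + n) = y n := by
    have hmul : ∀ k n, n + T * k < T * p * q → y (n + T * k) = y n := by
      intro k
      induction k with
      | zero => intro n _; simp
      | succ k ih =>
        intro n hn
        rw [hper _ (by rw [Nat.mul_succ]; omega) hn, ← ih n (by rw [Nat.mul_succ] at hn; omega)]
        congr 1
        rw [Nat.mul_succ]; omega
    intro s hs n hn
    have h1 : T * p * s + T * p ≤ T * p * q := by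
      rw [← Nat.mul_succ]; exact Nat.mul_le_mul_left _ hs
    have := hmul (p * s) n (by rw [← mul_assoc]; omega)
    rw [← this]; congr 1; rw [← mul_assoc]; omega
  have hsum : ∀ s, s ≤ q → (s : ℝ) * energy 0 (T * p) y ≤ energy 0 (T * p * s) y := by
    intro s
    induction s with
    | zero => intro _; simp [energy_nonneg]
    | succ s ih =>
      intro hs
      have h1 := ih (by omega)
      have h2 : energy 0 (T * p * (s + 1)) y = energy 0 (T * p * s) y + energy 0 (T * p) y := by
        unfold energy
        rw [← Finset.sum_Ico_consecutive _ (Nat.zero_le (T * p * s))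
          (Nat.mul_le_mul_left (T * p) (Nat.le_succ s)), Finset.sum_Ico_eq_sum_range _ (T * p * s)]
        congr 1
        rw [show T * p * s.succ - T * p * s = T * p by rw [Nat.mul_succ]; omega,
          ← Finset.range_eq_Ico]
        exact Finset.sum_congr rfl fun n hn => by
          rw [hblock s (by omega) n (Finset.mem_range.1 hn)]
      push_cast
      linarith
  have h1 := hsum q le_rfl
  have h2 := energy_mono y (le_refl 0) hL
  have h3 := energy_mono y (le_refl 0) (Nat.le_mul_of_pos_left p hT)
  have h4 : (q : ℝ) * energy 0 p y ≤ q * energy 0 (T * p) y :=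
    mul_le_mul_of_nonneg_left h3 (Nat.cast_nonneg _)
  linarith

/-- A filter with summable causal inverse is bounded below on sequences that begin with a
long periodic stretch. -/
lemma exists_energy_le_energy_arf {T p : ℕ} (hT : 0 < T) (φ : Fin p → ℝ) (ψ : ℕ → ℝ) (Ψ : ℝ)
    (hΨ : ∀ n, ∑ k ∈ Finset.range n, |ψ k| ≤ Ψ)
    (hinv : PowerSeries.mk ψ * lagSeries φ = 1) :
    ∃ C : ℝ, 0 < C ∧ ∃ L : ℕ, ∀ (a b : ℕ) (x : ℕ → ℝ), a + L ≤ b →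
      (∀ t, a + T ≤ t → t < a + L → x t = x (t - T)) →
      energy a b x ≤ C * energy (a + p) b (arf φ x) := by
  set D : ℝ := p * (2 + 2 * ∑ j, φ j ^ 2) with hD
  have hD0 : 0 ≤ D := by positivity
  -- Started at time `a` with zeros before it, the filter produces a spurious transient `g` on the
  -- first `p` times, of energy at most `D` times that of the first `p` values. With `q` repetitions
  -- of these values inside the periodic stretch, the transient, amplified by `Ψ ^ 2`, takes at most
  -- half of the total energy and is absorbed.
  obtain ⟨q, hq⟩ := exists_nat_gt (2 * Ψ ^ 2 * D)
  refine ⟨2 * Ψ ^ 2 + 1, by positivity, T * p * q + p, fun a b x hab hper => ?_⟩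
  set y : ℕ → ℝ := fun n => x (a + n) with hy
  set g : ℕ → ℝ := fun n => PowerSeries.coeff n (lagSeries φ * PowerSeries.mk y) with hg
  have hgn : ∀ n, g n = y n - ∑ j : Fin p, φ j * if (j : ℕ) + 1 ≤ n then y (n - ((j : ℕ) + 1)) else 0 := by
    intro n
    simp only [hg, coeff_lagSeries_mul, PowerSeries.coeff_mk]
  -- Since `ψ` inverts the lag polynomial as a power series, convolving the filtered sequence,
  -- transient included, with `ψ` recovers `y`.
  have hyn : ∀ n, y n = ∑ k ∈ Finset.range (n + 1), ψ k * g (n - k) := by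
    intro n
    have h1 : PowerSeries.mk ψ * (lagSeries φ * PowerSeries.mk y) = PowerSeries.mk y := by
      rw [← mul_assoc, hinv, one_mul]
    have h2 := congrArg (PowerSeries.coeff n) h1
    rw [PowerSeries.coeff_mul, PowerSeries.coeff_mk,
      Finset.Nat.sum_antidiagonal_eq_sum_range_succ
        (fun k l => PowerSeries.coeff k (PowerSeries.mk ψ) *
          PowerSeries.coeff l (lagSeries φ * PowerSeries.mk y))] at h2
    rw [← h2]
    exact Finset.sum_congr rfl fun k _ => by rw [PowerSeries.coeff_mk]
  have hEx : energy a b x = energy 0 (b - a) y := by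
    unfold energy
    rw [Finset.sum_Ico_eq_sum_range, ← Finset.range_eq_Ico]
  have hEg : energy p (b - a) g = energy (a + p) b (arf φ x) := by
    unfold energy
    rw [Finset.sum_Ico_eq_sum_range, Finset.sum_Ico_eq_sum_range]
    rw [show b - a - p = b - (a + p) by omega]
    refine Finset.sum_congr rfl fun n _ => ?_
    rw [hgn, arf]
    congr 2
    · simp only [hy]; congr 1; omega
    · refine Finset.sum_congr rfl fun j _ => ?_
      rw [if_pos (by omega)]
      simp only [hy]
      congr 2
      omega
  have hstart : energy 0 p g ≤ D * energy 0 p y := by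
    have : ∀ n ∈ Finset.Ico 0 p, g n ^ 2 ≤ (2 + 2 * ∑ j, φ j ^ 2) * energy 0 p y := by
      intro n hn
      rw [Finset.mem_Ico] at hn
      have h1 : (∑ j : Fin p, φ j * if (j : ℕ) + 1 ≤ n then y (n - ((j : ℕ) + 1)) else 0) ^ 2 ≤
          (∑ j, φ j ^ 2) * energy 0 p y := by
        refine (Finset.sum_mul_sq_le_sq_mul_sq _ _ _).trans
          (mul_le_mul_of_nonneg_left ?_ (Finset.sum_nonneg fun _ _ => sq_nonneg _))
        have h2 : ∀ j : Fin p, (if (j : ℕ) + 1 ≤ n then y (n - ((j : ℕ) + 1)) else 0) ^ 2 =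
            (fun i : ℕ => (if i + 1 ≤ n then y (n - (i + 1)) else 0) ^ 2) (j : ℕ) := fun j => rfl
        rw [Finset.sum_congr rfl fun j _ => h2 j,
          Fin.sum_univ_eq_sum_range (fun i : ℕ => (if i + 1 ≤ n then y (n - (i + 1)) else 0) ^ 2) p]
        have h3 : ∑ i ∈ Finset.range p, (if i + 1 ≤ n then y (n - (i + 1)) else 0) ^ 2 =
            ∑ i ∈ Finset.range n, y (n - 1 - i) ^ 2 := by
          symm
          rw [← Finset.sum_subset (Finset.range_mono hn.2.le)]
          · refine Finset.sum_congr rfl fun i hi => ?_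
            rw [Finset.mem_range] at hi
            rw [if_pos (by omega)]; congr 2; omega
          · intro i _ hi
            rw [Finset.mem_range] at hi
            rw [if_neg (by omega)]; simp
        rw [h3, Finset.sum_range_reflect (fun i => y i ^ 2), Finset.range_eq_Ico]
        exact energy_mono y le_rfl hn.2.le
      have h4 : y n ^ 2 ≤ energy 0 p y :=
        Finset.single_le_sum (f := fun t => y t ^ 2) (fun _ _ => sq_nonneg _)
          (Finset.mem_Ico.2 hn)
      rw [hgn]
      nlinarith [sq_nonneg (y n + ∑ j : Fin p, φ j * if (j : ℕ) + 1 ≤ n then y (n - ((j : ℕ) + 1)) else 0)]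
    have h := Finset.sum_le_sum this
    rw [Finset.sum_const, Nat.card_Ico, Nat.sub_zero, nsmul_eq_mul] at h
    calc energy 0 p g ≤ _ := h
      _ = _ := by rw [hD]; ring
  have hconv : energy 0 (b - a) y ≤ Ψ ^ 2 * energy 0 (b - a) g := by
    have h := sum_sq_convolution_le ψ g Ψ hΨ (b - a)
    unfold energy
    rw [← Finset.range_eq_Ico]
    simpa only [← hyn] using h
  have hsplit : energy 0 (b - a) g = energy 0 p g + energy p (b - a) g :=
    (Finset.sum_Ico_consecutive _ (Nat.zero_le p) (by omega)).symm
  have hstretch := energy_le_of_periodic_start hT p q y (b - a) (by omega) (by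
    intro n hn hn'
    simp only [hy]
    rw [hper (a + n) (by omega) (by omega)]
    congr 1; omega)
  have hyE := energy_nonneg 0 p y
  have hgE := energy_nonneg p (b - a) g
  rw [hEx, ← hEg]
  have h5 : Ψ ^ 2 * energy 0 p g ≤ Ψ ^ 2 * (D * energy 0 p y) :=
    mul_le_mul_of_nonneg_left hstart (sq_nonneg _)
  have h6 : 2 * Ψ ^ 2 * D * energy 0 p y ≤ q * energy 0 p y :=
    mul_le_mul_of_nonneg_right hq.le hyE
  rw [hsplit] at hconv
  nlinarith

/-! ### Inner products with piecewise constant and piecewise periodic functions -/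

lemma sq_sum_mul_le_of_const (y h : ℕ → ℝ) {B : ℝ} {i n : ℕ} (hin : i < n)
    (hc : ∀ k, i ≤ k → k < n → h k = h i)
    (hB : h i ≠ 0 → (∑ k ∈ Finset.Ico i n, y k) ^ 2 ≤ ((n : ℝ) - i) * B) :
    (∑ k ∈ Finset.Ico i n, y k * h k) ^ 2 ≤ B * ∑ k ∈ Finset.Ico i n, h k ^ 2 := by
  have e1 : ∑ k ∈ Finset.Ico i n, y k * h k = h i * ∑ k ∈ Finset.Ico i n, y k := by
    rw [Finset.mul_sum]
    refine Finset.sum_congr rfl fun k hk => ?_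
    rw [Finset.mem_Ico] at hk; rw [hc k hk.1 hk.2]; ring
  have e2 : ∑ k ∈ Finset.Ico i n, h k ^ 2 = ((n : ℝ) - i) * h i ^ 2 := by
    rw [Finset.sum_congr rfl fun k hk => show h k ^ 2 = h i ^ 2 by
      rw [Finset.mem_Ico] at hk; rw [hc k hk.1 hk.2]]
    rw [Finset.sum_const, Nat.card_Ico, nsmul_eq_mul, Nat.cast_sub hin.le]
  rw [e1, e2]
  by_cases h0 : h i = 0
  · simp [h0]
  · nlinarith [mul_le_mul_of_nonneg_left (hB h0) (sq_nonneg (h i))]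

/-- On a single run the inner product is a constant times a partial sum of `y`. Splitting off the
run after the last jump and inducting on the number of jumps glues at most `K + 1` runs by
Cauchy–Schwarz. Partial sums are controlled only on maximal runs with nonzero value, because runs of
zeros will come from padding. -/
lemma sq_sum_mul_le_of_runs (y h : ℕ → ℝ) {B : ℝ} (hB : 0 ≤ B) (K n : ℕ)
    (hK : ((Finset.range n).filter fun k => 1 ≤ k ∧ h k ≠ h (k - 1)).card ≤ K)
    (hrun : ∀ i j, i < j → j ≤ n → h i ≠ 0 → (i = 0 ∨ h i ≠ h (i - 1)) →
      (j = n ∨ h j ≠ h (j - 1)) → (∀ k, i ≤ k → k < j → h k = h i) →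
      (∑ k ∈ Finset.Ico i j, y k) ^ 2 ≤ ((j : ℝ) - i) * B) :
    (∑ k ∈ Finset.range n, y k * h k) ^ 2 ≤ (K + 1) * B * ∑ k ∈ Finset.range n, h k ^ 2 := by
  -- the contribution of a single run
  have hone : ∀ i, i < n → (i = 0 ∨ h i ≠ h (i - 1)) → (∀ k, i ≤ k → k < n → h k = h i) →
      (∑ k ∈ Finset.Ico i n, y k * h k) ^ 2 ≤ B * ∑ k ∈ Finset.Ico i n, h k ^ 2 := by
    intro i hin hi hc
    exact sq_sum_mul_le_of_const y h hin hc fun h0 => hrun i n hin le_rfl h0 hi (Or.inl rfl) hc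
  induction K generalizing n with
  | zero =>
    rcases Nat.eq_zero_or_pos n with rfl | hn
    · simp
    have hempty : ((Finset.range n).filter fun k => 1 ≤ k ∧ h k ≠ h (k - 1)) = ∅ :=
      Finset.card_eq_zero.1 (Nat.le_zero.1 hK)
    have hc : ∀ k, k < n → h k = h 0 := by
      intro k
      induction k with
      | zero => intro _; rfl
      | succ k ih =>
        intro hk
        by_contra hne
        have : k + 1 ∈ ((Finset.range n).filter fun k => 1 ≤ k ∧ h k ≠ h (k - 1)) := by
          rw [Finset.mem_filter, Finset.mem_range]
          refine ⟨hk, by omega, ?_⟩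
          rw [Nat.add_sub_cancel, ih (by omega)]
          exact hne
        rw [hempty] at this
        exact absurd this (Finset.notMem_empty _)
    have := hone 0 hn (Or.inl rfl) fun k _ hk => hc k hk
    rw [← Finset.range_eq_Ico] at this
    simpa using this
  | succ K ih =>
    rcases Finset.eq_empty_or_nonempty
      ((Finset.range n).filter fun k => 1 ≤ k ∧ h k ≠ h (k - 1)) with hempty | hne
    · have h1 := ih n (by rw [hempty]; simp) hrun hone
      refine h1.trans ?_
      have h2 : 0 ≤ B * ∑ k ∈ Finset.range n, h k ^ 2 :=
        mul_nonneg hB (Finset.sum_nonneg fun _ _ => sq_nonneg _)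
      push_cast
      nlinarith
    · set S := (Finset.range n).filter fun k => 1 ≤ k ∧ h k ≠ h (k - 1) with hS
      set j := S.max' hne with hj
      have hjS : j ∈ S := Finset.max'_mem _ _
      have hjS' := hjS
      rw [hS, Finset.mem_filter, Finset.mem_range] at hjS'
      obtain ⟨hjn, hj1, hjne⟩ := hjS'
      have hc : ∀ k, j ≤ k → k < n → h k = h j := by
        intro k hk
        induction k, hk using Nat.le_induction with
        | base => intro _; rfl
        | succ k hk ih' =>
          intro hkn
          by_contra hne'
          have : k + 1 ∈ S := by
            rw [hS, Finset.mem_filter, Finset.mem_range]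
            refine ⟨hkn, by omega, ?_⟩
            rw [Nat.add_sub_cancel, ih' (by omega)]
            exact hne'
          have := Finset.le_max' S _ this
          omega
      have hlast := hone j hjn (Or.inr hjne) hc
      have hcard : ((Finset.range j).filter fun k => 1 ≤ k ∧ h k ≠ h (k - 1)).card ≤ K := by
        have hss : ((Finset.range j).filter fun k => 1 ≤ k ∧ h k ≠ h (k - 1)) ⊂ S := by
          rw [Finset.ssubset_iff_of_subset]
          · exact ⟨j, hjS, by simp⟩
          · intro k hk
            rw [Finset.mem_filter, Finset.mem_range] at hk
            rw [hS, Finset.mem_filter, Finset.mem_range]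
            exact ⟨by omega, hk.2⟩
        have := Finset.card_lt_card hss
        omega
      have hfirst := ih j hcard (fun i j' hij hj' h0 hi hj'' hc' =>
        hrun i j' hij (by omega) h0 hi (hj''.elim (fun e => Or.inr (by rw [e]; exact hjne)) Or.inr)
          hc') (fun i hij hi hc' => sq_sum_mul_le_of_const y h hij hc' fun h0 =>
          hrun i j hij hjn.le h0 hi (Or.inr hjne) hc')
      rw [← Finset.sum_range_add_sum_Ico _ hjn.le, ← Finset.sum_range_add_sum_Ico _ hjn.le]
      set P := ∑ k ∈ Finset.range j, y k * h k
      set Q := ∑ k ∈ Finset.Ico j n, y k * h k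
      set HP := ∑ k ∈ Finset.range j, h k ^ 2
      set HQ := ∑ k ∈ Finset.Ico j n, h k ^ 2
      push_cast
      have hk : (0 : ℝ) < K + 1 := by positivity
      -- The weights `1 / (K + 1)` and `1` are the ones for which the constants of the first `K + 1`
      -- runs and of the last run add up to `K + 2`.
      have key : (P + Q) ^ 2 ≤ ((K : ℝ) + 2) * (P ^ 2 / (K + 1) + Q ^ 2) := by
        have : ((K : ℝ) + 2) * (P ^ 2 / (K + 1) + Q ^ 2) - (P + Q) ^ 2 =
            (P - (K + 1) * Q) ^ 2 / (K + 1) := by field_simp; ring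
        have h2 : 0 ≤ (P - (K + 1) * Q) ^ 2 / ((K : ℝ) + 1) := by positivity
        linarith
      have h3 : P ^ 2 / (K + 1) ≤ B * HP := by
        rw [div_le_iff₀ hk]; linarith
      calc (P + Q) ^ 2 ≤ _ := key
        _ ≤ ((K : ℝ) + 2) * (B * HP + B * HQ) := by gcongr
        _ = _ := by ring

lemma sum_range_mul_residues (T n : ℕ) (f : ℕ → ℝ) :
    ∑ t ∈ Finset.range (T * n), f t =
      ∑ s ∈ Finset.range T, ∑ k ∈ Finset.range n, f (s + T * k) := by
  induction n with
  | zero => simp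
  | succ n ih =>
    rw [Nat.mul_succ, Finset.sum_range_add, ih, ← Finset.sum_add_distrib]
    refine Finset.sum_congr rfl fun s _ => ?_
    rw [Finset.sum_range_succ, add_comm (T * n) s]

/-- Steps of length `T` turn periodicity into constancy along each residue class. The classes are
padded by zero to the common length `b - a`, which is more than enough. -/
lemma sum_Ico_eq_sum_residues {T : ℕ} (hT : 0 < T) (a b : ℕ) (f : ℕ → ℝ) :
    ∑ t ∈ Finset.Ico a b, f t = ∑ s ∈ Finset.range T, ∑ k ∈ Finset.range (b - a),
      if a + s + T * k < b then f (a + s + T * k) else 0 := by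
  rw [Finset.sum_Ico_eq_sum_range]
  have h1 := sum_range_mul_residues T (b - a) (fun t => if a + t < b then f (a + t) else 0)
  have h2 : ∑ t ∈ Finset.range (b - a), f (a + t) =
      ∑ t ∈ Finset.range (T * (b - a)), if a + t < b then f (a + t) else 0 := by
    rw [← Finset.sum_subset (Finset.range_mono (Nat.le_mul_of_pos_left (b - a) hT))]
    · refine Finset.sum_congr rfl fun t ht => ?_
      rw [Finset.mem_range] at ht; rw [if_pos (by omega)]
    · intro t _ ht
      rw [Finset.mem_range] at ht; rw [if_neg (by omega)]
  rw [h2, h1]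
  simp only [add_assoc]

/-- An inner product with a function that is `T`-periodic off few times, in terms of sums along
the maximal stretches on which that function is `T`-periodic. -/
lemma sq_sum_mul_le_of_stepRuns {T : ℕ} (hT : 0 < T) (a b : ℕ) (y g : ℕ → ℝ) {B : ℝ} (hB : 0 ≤ B)
    (J : ℕ) (hJ : ((Finset.Ico (a + T) b).filter fun t => g t ≠ g (t - T)).card ≤ J)
    (hrun : ∀ t n, a ≤ t → t < b → 1 ≤ n → t + T * n < b + T → (t < a + T ∨ g t ≠ g (t - T)) →
      (b ≤ t + T * n ∨ g (t + T * n) ≠ g (t + T * n - T)) →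
      (∀ k < n, g (t + T * k) = g t) →
      (∑ k ∈ Finset.range n, y (t + T * k)) ^ 2 ≤ n * B) :
    (∑ t ∈ Finset.Ico a b, y t * g t) ^ 2 ≤ T * ((J + T : ℕ) + 1) * B * energy a b g := by
  rw [energy, sum_Ico_eq_sum_residues hT a b fun t => y t * g t,
    sum_Ico_eq_sum_residues hT a b fun t => g t ^ 2]
  set h : ℕ → ℕ → ℝ := fun s k => if a + s + T * k < b then g (a + s + T * k) else 0 with hh
  have hres : ∀ s ∈ Finset.range T,
      (∑ k ∈ Finset.range (b - a), if a + s + T * k < b then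
        y (a + s + T * k) * g (a + s + T * k) else 0) ^ 2 ≤
      ((J + T : ℕ) + 1) * B * ∑ k ∈ Finset.range (b - a),
        if a + s + T * k < b then g (a + s + T * k) ^ 2 else 0 := by
    intro s hs
    rw [Finset.mem_range] at hs
    have e1 : ∀ k, (if a + s + T * k < b then y (a + s + T * k) * g (a + s + T * k) else 0) =
        (fun k => y (a + s + T * k)) k * h s k := by
      intro k; simp only [hh]; split_ifs <;> simp
    have e2 : ∀ k, (if a + s + T * k < b then g (a + s + T * k) ^ 2 else 0) = h s k ^ 2 := by
      intro k; simp only [hh]; split_ifs <;> simp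
    simp only [e1, e2]
    -- A jump along a residue class is either a jump of `g` or the switch to the padding; the latter
    -- occurs at the first time past the end, which lies in `[b, b + T)`. Hence at most `J + T`
    -- jumps.
    refine sq_sum_mul_le_of_runs _ _ hB (J + T) (b - a) ?_ ?_
    · have hinj : Set.InjOn (fun k => a + s + T * k)
          (((Finset.range (b - a)).filter fun k => 1 ≤ k ∧ h s k ≠ h s (k - 1) : Finset ℕ) :
            Set ℕ) := by
        intro k _ k' _ hkk
        simp only at hkk
        exact Nat.eq_of_mul_eq_mul_left hT (by omega)
      rw [← Finset.card_image_of_injOn hinj]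
      calc _ ≤ (((Finset.Ico (a + T) b).filter fun t => g t ≠ g (t - T)) ∪
            Finset.Ico b (b + T)).card := by
            refine Finset.card_le_card fun t ht => ?_
            rw [Finset.mem_image] at ht
            obtain ⟨k, hk, rfl⟩ := ht
            rw [Finset.mem_filter] at hk
            obtain ⟨-, hk1, hne⟩ := hk
            obtain ⟨k, rfl⟩ : ∃ k', k = k' + 1 := ⟨k - 1, by omega⟩
            rw [Nat.add_sub_cancel] at hne
            simp only [hh, Nat.mul_succ] at hne ⊢
            rw [Finset.mem_union, Finset.mem_filter, Finset.mem_Ico, Finset.mem_Ico]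
            by_cases hlt : a + s + (T * k + T) < b
            · left
              refine ⟨by omega, ?_⟩
              rw [if_pos hlt, if_pos (by omega)] at hne
              rwa [show a + s + (T * k + T) - T = a + s + T * k by omega]
            · right
              rw [if_neg hlt] at hne
              by_cases hlt' : a + s + T * k < b
              · omega
              · rw [if_neg hlt'] at hne; exact absurd rfl hne
        _ ≤ _ := (Finset.card_union_le _ _).trans (by rw [Nat.card_Ico]; omega)
    · intro i j hij hjn h0 hi hj hc
      have hlt : ∀ k, i ≤ k → k < j → a + s + T * k < b := by
        intro k hk hkj
        by_contra hcon
        have := hc k hk hkj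
        simp only [hh, if_neg hcon] at this
        exact h0 (by simp only [hh]; exact this.symm)
      have hib := hlt i le_rfl hij
      obtain ⟨n, rfl⟩ : ∃ n, j = i + n := ⟨j - i, by omega⟩
      obtain ⟨n, rfl⟩ : ∃ n', n = n' + 1 := ⟨n - 1, by omega⟩
      have hlast := hlt (i + n) (by omega) (by omega)
      have hge : T * (b - a) ≥ b - a := Nat.le_mul_of_pos_left _ hT
      have := hrun (a + s + T * i) (n + 1) (by omega) hib (by omega)
        (by rw [mul_add] at hlast; rw [Nat.mul_succ]; omega)
        (by
          rcases hi with rfl | hi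
          · left; simp only [mul_zero]; omega
          · by_cases hi0 : i = 0
            · left; subst hi0; simp only [mul_zero]; omega
            · right
              obtain ⟨i, rfl⟩ : ∃ i', i = i' + 1 := ⟨i - 1, by omega⟩
              simp only [hh, Nat.add_sub_cancel] at hi
              rw [Nat.mul_succ] at hib hi ⊢
              rw [if_pos hib, if_pos (by omega)] at hi
              rwa [show a + s + (T * i + T) - T = a + s + T * i by omega])
        (by
          rcases hj with hj | hj
          · left
            have : T * i + T * (n + 1) = T * (b - a) := by rw [← mul_add, hj]
            omega
          · by_cases hcon : b ≤ a + s + T * i + T * (n + 1)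
            · exact Or.inl hcon
            · right
              have e : a + s + T * (i + (n + 1)) = a + s + T * i + T * (n + 1) := by ring
              have e' : i + (n + 1) - 1 = i + n := by omega
              simp only [hh, e', e] at hj
              rw [if_pos (by omega), if_pos hlast] at hj
              rwa [show a + s + T * i + T * (n + 1) - T = a + s + T * (i + n) by
                rw [show T * (n + 1) = T * n + T by ring, mul_add]; omega])
        (by
          intro k hk
          have h1 := hc (i + k) (by omega) (by omega)
          have h2 := hlt (i + k) (by omega) (by omega)
          simp only [hh] at h1
          rw [if_pos h2, if_pos hib] at h1
          rw [← h1]; congr 1; ring)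
      rw [Finset.sum_Ico_eq_sum_range, Nat.add_sub_cancel_left]
      have e : ∀ k, y (a + s + T * (i + k)) = y (a + s + T * i + T * k) := by
        intro k; congr 1; ring
      simp only [e]
      calc _ ≤ _ := this
        _ = _ := by push_cast; ring
  calc _ ≤ (T : ℝ) * ∑ s ∈ Finset.range T, (∑ k ∈ Finset.range (b - a), if a + s + T * k < b then
        y (a + s + T * k) * g (a + s + T * k) else 0) ^ 2 := by
        have := sq_sum_le_card_mul_sum_sq (s := Finset.range T)
          (f := fun s => ∑ k ∈ Finset.range (b - a), if a + s + T * k < b then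
            y (a + s + T * k) * g (a + s + T * k) else 0)
        rwa [Finset.card_range] at this
    _ ≤ (T : ℝ) * ∑ s ∈ Finset.range T, ((J + T : ℕ) + 1) * B * ∑ k ∈ Finset.range (b - a),
        if a + s + T * k < b then g (a + s + T * k) ^ 2 else 0 := by
        gcongr with s hs
        exact hres s hs
    _ = _ := by rw [← Finset.mul_sum]; ring

/-- On `[a, N]` the function `g` is `T`-periodic except within `w` time steps after a point
of `B`. -/
def JumpsIn (T w a N : ℕ) (B : Finset ℕ) (g : ℕ → ℝ) : Prop :=
  ∀ t, a + T ≤ t → t ≤ N → g t ≠ g (t - T) → ∃ b ∈ B, b ≤ t ∧ t < b + w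

lemma JumpsIn.arf {T w a N p : ℕ} {B : Finset ℕ} {g : ℕ → ℝ} (h : JumpsIn T w a N B g)
    (φ : Fin p → ℝ) : JumpsIn T (w + p) (a + p) N B (arf φ g) := by
  intro t ht htN hne
  by_contra hcon
  push Not at hcon
  apply hne
  have hlag : ∀ l, l ≤ p → g (t - l) = g (t - l - T) := by
    intro l hl
    by_contra hg
    obtain ⟨b, hb, hbt, htb⟩ := h (t - l) (by omega) (by omega) hg
    have := hcon b hb (by omega)
    omega
  simp only [BMDL.arf]
  have h0 := hlag 0 (Nat.zero_le p)
  rw [Nat.sub_zero] at h0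
  rw [h0]
  congr 1
  refine Finset.sum_congr rfl fun j _ => ?_
  rw [hlag ((j : ℕ) + 1) (by omega), Nat.sub_right_comm]

lemma JumpsIn.card_le {T w a N : ℕ} {B : Finset ℕ} {g : ℕ → ℝ} (h : JumpsIn T w a N B g) :
    ((Finset.Ico (a + T) (N + 1)).filter fun t => g t ≠ g (t - T)).card ≤ B.card * w := by
  calc _ ≤ (B.biUnion fun b => Finset.Ico b (b + w)).card := by
        refine Finset.card_le_card fun t ht => ?_
        rw [Finset.mem_filter, Finset.mem_Ico] at ht
        obtain ⟨b, hb, h1, h2⟩ := h t ht.1.1 (by omega) ht.2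
        exact Finset.mem_biUnion.2 ⟨b, hb, Finset.mem_Ico.2 ⟨h1, h2⟩⟩
    _ ≤ B.card * w := Finset.card_biUnion_le_card_mul _ _ _ fun b _ => by simp

/-! ### Good paths, and coarse bounds for the regressors -/

/-- The properties of a noise path `z` and the corresponding autoregressive path `e` on which
the deterministic part of the argument rests. -/
structure GoodPath (T : ℕ) {p : ℕ} (φ : Fin p → ℝ) (σ2 ε A : ℝ) (N : ℕ) (qs : Finset ℕ)
    (z e : ℕ → ℝ) : Prop where
  filter_eq : ∀ t, p + 1 ≤ t → t ≤ N → arf φ e t = z t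
  abs_sum_le : ∀ a, 1 ≤ a → a ≤ 2 * p + 1 + T → ∀ n ≤ N,
    |∑ i ∈ Finset.range n, z (a + T * i)| ≤ A * √N
  abs_sum_sq_step_le : ∀ a, 1 ≤ a → a ≤ 2 * p + 1 + T → ∀ n ≤ N,
    |∑ i ∈ Finset.range n, z (a + T * i) ^ 2 - n * σ2| ≤ ε * N
  abs_sum_sq_le : ∀ a, 1 ≤ a → a ≤ 2 * p + 1 + T → ∀ n ≤ N,
    |∑ i ∈ Finset.range n, z (a + i) ^ 2 - n * σ2| ≤ ε * N
  near_right : ∀ q ∈ qs, ∀ k ≤ N, |∑ t ∈ Finset.Ico q (q + k), z t| ≤ ε * k + A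
  near_left : ∀ q ∈ qs, ∀ k < q, |∑ t ∈ Finset.Ico (q - k) q, z t| ≤ ε * k + A
  cross_error : ∀ j : Fin p,
    |∑ t ∈ Finset.Ico (p + 1) (N + 1), z t * e (t - ((j : ℕ) + 1))| ≤ A * √N
  cross_noise : ∀ i j : Fin p, i ≠ j →
    |∑ t ∈ Finset.Ico (2 * p + 1) (N + 1), z (t - ((i : ℕ) + 1)) * z (t - ((j : ℕ) + 1))| ≤ A * √N

section Coarse

/-- Short and long stretches need different reasons. If `2 * σ2 * n ≤ δ * N`, the squares in the
stretch sum to at most `δ * N` and Cauchy–Schwarz suffices. Otherwise the maximal bound `A * √N`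
gives a square of at most `4 * A ^ 2 * N`, which the large factor `n` outweighs. -/
lemma sum_range_add_sq_le {f : ℕ → ℝ} {σ2 ε A δ : ℝ} {N : ℕ} (hσ : 0 < σ2) (hδ : 0 < δ)
    (hε : ε ≤ δ / 4) (hN : 8 * A ^ 2 * σ2 ≤ δ ^ 2 * N)
    (h1 : ∀ n ≤ N, |∑ i ∈ Finset.range n, f i| ≤ A * √N)
    (h2 : ∀ n ≤ N, |∑ i ∈ Finset.range n, f i ^ 2 - n * σ2| ≤ ε * N)
    (k n : ℕ) (hkn : k + n ≤ N) :
    (∑ i ∈ Finset.range n, f (k + i)) ^ 2 ≤ n * (δ * N) := by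
  have hs : √(N : ℝ) ^ 2 = N := Real.sq_sqrt (Nat.cast_nonneg N)
  rcases le_or_gt (2 * σ2 * n) (δ * N) with hn | hn
  · have e := Finset.sum_range_add (fun i => f i ^ 2) k n
    have a1 := abs_le.1 (h2 k (by omega))
    have a2 := abs_le.1 (h2 (k + n) hkn)
    push_cast at a2
    have h3 : ∑ i ∈ Finset.range n, f (k + i) ^ 2 ≤ δ * N := by
      have : ε * N ≤ δ / 4 * N := mul_le_mul_of_nonneg_right hε (Nat.cast_nonneg N)
      linarith [a1.1, a2.2]
    have h4 := sq_sum_le_card_mul_sum_sq (s := Finset.range n) (f := fun i => f (k + i))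
    rw [Finset.card_range] at h4
    exact h4.trans (mul_le_mul_of_nonneg_left h3 (Nat.cast_nonneg n))
  · have e := Finset.sum_range_add f k n
    have a1 := abs_le.1 (h1 k (by omega))
    have a2 := abs_le.1 (h1 (k + n) hkn)
    have h3 : |∑ i ∈ Finset.range n, f (k + i)| ≤ 2 * (A * √N) := by
      rw [abs_le]; constructor <;> linarith [a1.1, a1.2, a2.1, a2.2]
    have h4 := sq_le_sq' (abs_le.1 h3).1 (abs_le.1 h3).2
    have h5 : (2 * (A * √N)) ^ 2 = 4 * A ^ 2 * N := by rw [mul_pow, mul_pow, hs]; ring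
    rw [h5] at h4
    refine h4.trans ?_
    have h6 : 4 * A ^ 2 * (2 * σ2) ≤ n * δ * (2 * σ2) := by
      have : δ * (δ * N) ≤ δ * (2 * σ2 * n) := mul_le_mul_of_nonneg_left hn.le hδ.le
      nlinarith
    have h7 : 4 * A ^ 2 ≤ n * δ := le_of_mul_le_mul_right h6 (by linarith)
    calc 4 * A ^ 2 * N ≤ n * δ * N := mul_le_mul_of_nonneg_right h7 (Nat.cast_nonneg N)
      _ = _ := by ring

variable {T p : ℕ} {φ : Fin p → ℝ} {σ2 ε A : ℝ} {N : ℕ} {qs : Finset ℕ} {z e : ℕ → ℝ}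

/-- Along each run of `g` in steps of `T` the noise sums obey `sum_range_add_sq_le`, so lagged noise
is nearly orthogonal to every `g` with few jumps, wherever these lie. The condition `l < a` keeps
the lagged times positive. -/
lemma GoodPath.sq_sum_lag_mul_le (hG : GoodPath T φ σ2 ε A N qs z e) (hT : 0 < T) {δ : ℝ}
    (hσ : 0 < σ2) (hδ : 0 < δ) (hε : ε ≤ δ / 4) (hN : 8 * A ^ 2 * σ2 ≤ δ ^ 2 * N) {l a : ℕ}
    (hl : l < a) (ha : a ≤ 2 * p + 1) (g : ℕ → ℝ) (J : ℕ)
    (hJ : ((Finset.Ico (a + T) (N + 1)).filter fun t => g t ≠ g (t - T)).card ≤ J) :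
    (∑ t ∈ Finset.Ico a (N + 1), z (t - l) * g t) ^ 2 ≤
      T * ((J + T : ℕ) + 1) * (δ * N) * energy a (N + 1) g := by
  refine sq_sum_mul_le_of_stepRuns hT a (N + 1) (fun t => z (t - l)) g (by positivity) J hJ ?_
  intro t n hat htN hn htn _ _ _
  obtain ⟨k, s, hs, hk⟩ : ∃ k s, s < T ∧ t = a + s + T * k :=
    ⟨(t - a) / T, (t - a) % T, Nat.mod_lt _ hT, by
      have := Nat.mod_add_div (t - a) T; omega⟩
  have e : ∀ i, z (t + T * i - l) = z ((a - l + s) + T * (k + i)) := by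
    intro i; congr 1; rw [hk, mul_add]; omega
  simp only [e]
  refine sum_range_add_sq_le hσ hδ hε hN (hG.abs_sum_le (a - l + s) (by omega) (by omega))
    (hG.abs_sum_sq_step_le (a - l + s) (by omega) (by omega)) k n ?_
  have h1 : T * (k + n) < N + 1 + T - a := by rw [mul_add]; omega
  by_contra hcon
  have h2 : T * (N + 1) ≤ T * (k + n) := Nat.mul_le_mul_left T (by omega)
  have h3 : N ≤ T * N := Nat.le_mul_of_pos_left N hT
  rw [Nat.mul_succ] at h2
  omega

/-- The true filter commutes with lags and whitens the errors, which replaces lagged errors by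
lagged noise. From `2 * p + 1` on, both the lag and the filter stay within the observed times. -/
lemma GoodPath.arf_error_add (hG : GoodPath T φ σ2 ε A N qs z e) (η : Fin p → ℝ) (g : ℕ → ℝ)
    {t : ℕ} (ht : 2 * p + 1 ≤ t) (htN : t ≤ N) :
    BMDL.arf φ (fun t => ∑ j : Fin p, η j * e (t - ((j : ℕ) + 1)) + g t) t =
      ∑ j : Fin p, η j * z (t - ((j : ℕ) + 1)) + BMDL.arf φ g t := by
  have h1 : ∀ j : Fin p, z (t - ((j : ℕ) + 1)) =
      e (t - ((j : ℕ) + 1)) - ∑ i : Fin p, φ i * e (t - ((i : ℕ) + 1) - ((j : ℕ) + 1)) := by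
    intro j
    rw [← hG.filter_eq (t - ((j : ℕ) + 1)) (by omega) (by omega), BMDL.arf]
    simp only [Nat.sub_right_comm]
  simp only [h1, BMDL.arf, mul_sub, mul_add, Finset.sum_sub_distrib, Finset.sum_add_distrib,
    Finset.mul_sum]
  rw [Finset.sum_comm]
  have : ∀ i j : Fin p, η i * (φ j * e (t - ((j : ℕ) + 1) - ((i : ℕ) + 1))) =
      φ j * (η i * e (t - ((j : ℕ) + 1) - ((i : ℕ) + 1))) := fun i j => by ring
  simp only [this]
  ring

/-- The Gram matrix of the lagged noise is close to `N * σ2` times the identity: the diagonal by the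
law of large numbers, the other entries being of order `√N`. -/
lemma GoodPath.le_energy_lag_noise (hG : GoodPath T φ σ2 ε A N qs z e) (hA : 0 ≤ A)
    (hN2 : 2 * p ≤ N) (η : Fin p → ℝ) :
    (∑ j, η j ^ 2) * ((N - 2 * p) * σ2 - ε * N - p * (A * √N)) ≤
      energy (2 * p + 1) (N + 1) (fun t => ∑ j : Fin p, η j * z (t - ((j : ℕ) + 1))) := by
  have hexp : energy (2 * p + 1) (N + 1) (fun t => ∑ j : Fin p, η j * z (t - ((j : ℕ) + 1))) =
      ∑ i : Fin p, ∑ j : Fin p, η i * η j * ∑ t ∈ Finset.Ico (2 * p + 1) (N + 1),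
        z (t - ((i : ℕ) + 1)) * z (t - ((j : ℕ) + 1)) := by
    unfold energy
    simp only [sq, Finset.sum_mul_sum]
    rw [Finset.sum_comm]
    refine Finset.sum_congr rfl fun i _ => ?_
    rw [Finset.sum_comm]
    refine Finset.sum_congr rfl fun j _ => ?_
    rw [Finset.mul_sum]
    exact Finset.sum_congr rfl fun t _ => by ring
  have hterm : ∀ i j : Fin p, (if i = j then η i ^ 2 * ((N - 2 * p) * σ2 - ε * N) else 0) -
      |η i| * |η j| * (A * √N) ≤ η i * η j * ∑ t ∈ Finset.Ico (2 * p + 1) (N + 1),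
        z (t - ((i : ℕ) + 1)) * z (t - ((j : ℕ) + 1)) := by
    intro i j
    split_ifs with hij
    · subst hij
      have h1 := (abs_le.1 (hG.abs_sum_sq_le (2 * p - i) (by omega) (by omega) (N - 2 * p)
        (by omega))).1
      have h2 : ∑ t ∈ Finset.Ico (2 * p + 1) (N + 1), z (t - ((i : ℕ) + 1)) * z (t - ((i : ℕ) + 1)) =
          ∑ k ∈ Finset.range (N - 2 * p), z (2 * p - i + k) ^ 2 := by
        rw [Finset.sum_Ico_eq_sum_range, show N + 1 - (2 * p + 1) = N - 2 * p by omega]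
        refine Finset.sum_congr rfl fun k _ => ?_
        rw [sq, show 2 * p + 1 + k - ((i : ℕ) + 1) = 2 * p - i + k by omega]
      rw [h2]
      rw [Nat.cast_sub hN2] at h1
      push_cast at h1
      have h3 : 0 ≤ |η i| * |η i| * (A * √N) := by positivity
      have h4 : (N - 2 * p) * σ2 - ε * N ≤ ∑ k ∈ Finset.range (N - 2 * p), z (2 * p - i + k) ^ 2 := by
        linarith
      have h5 := mul_le_mul_of_nonneg_left h4 (sq_nonneg (η i))
      rw [← sq (η i)]
      linarith
    · have h1 := hG.cross_noise i j hij
      have h2 := neg_abs_le (η i * η j * ∑ t ∈ Finset.Ico (2 * p + 1) (N + 1),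
        z (t - ((i : ℕ) + 1)) * z (t - ((j : ℕ) + 1)))
      rw [abs_mul, abs_mul] at h2
      have h3 := mul_le_mul_of_nonneg_left h1 (mul_nonneg (abs_nonneg (η i)) (abs_nonneg (η j)))
      linarith
  rw [hexp]
  refine le_trans ?_ (Finset.sum_le_sum fun i _ => Finset.sum_le_sum fun j _ => hterm i j)
  simp only [Finset.sum_sub_distrib, Finset.sum_ite_eq, Finset.mem_univ, if_true]
  simp only [← Finset.sum_mul, ← Finset.mul_sum]
  have h6 := sq_sum_le_card_mul_sum_sq (s := (Finset.univ : Finset (Fin p))) (f := fun i => |η i|)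
  simp only [sq_abs, Finset.card_univ, Fintype.card_fin] at h6
  have h7 : 0 ≤ A * √N := by positivity
  rw [sq] at h6
  have h8 := mul_le_mul_of_nonneg_right h6 h7
  linarith

lemma two_mul_abs_le_of_sq_le {x κ a b : ℝ} (hκ : 0 ≤ κ) (ha : 0 ≤ a) (hb : 0 ≤ b)
    (h : x ^ 2 ≤ κ ^ 2 * (a * b)) : 2 * |x| ≤ κ * (a + b) := by
  have h1 : (2 * |x|) ^ 2 ≤ (κ * (a + b)) ^ 2 := by
    rw [mul_pow, sq_abs, mul_pow]
    nlinarith [mul_nonneg (sq_nonneg κ) (sq_nonneg (a - b))]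
  exact (abs_le_of_sq_le_sq' h1 (by positivity)).2

lemma GoodPath.sq_sum_noise_lag_error_le (hG : GoodPath T φ σ2 ε A N qs z e) (η : Fin p → ℝ) :
    (∑ t ∈ Finset.Ico (p + 1) (N + 1), z t * ∑ j : Fin p, η j * e (t - ((j : ℕ) + 1))) ^ 2 ≤
      p * A ^ 2 * (N * ∑ j, η j ^ 2) := by
  have h1 : ∑ t ∈ Finset.Ico (p + 1) (N + 1), z t * ∑ j : Fin p, η j * e (t - ((j : ℕ) + 1)) =
      ∑ j : Fin p, η j * ∑ t ∈ Finset.Ico (p + 1) (N + 1), z t * e (t - ((j : ℕ) + 1)) := by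
    simp only [Finset.mul_sum]
    rw [Finset.sum_comm]
    exact Finset.sum_congr rfl fun j _ => Finset.sum_congr rfl fun t _ => by ring
  rw [h1]
  refine (Finset.sum_mul_sq_le_sq_mul_sq _ _ _).trans ?_
  have h2 : ∑ j : Fin p, (∑ t ∈ Finset.Ico (p + 1) (N + 1), z t * e (t - ((j : ℕ) + 1))) ^ 2 ≤
      ∑ _j : Fin p, A ^ 2 * N := by
    refine Finset.sum_le_sum fun j _ => ?_
    have h3 := abs_le.1 (hG.cross_error j)
    have h4 := sq_le_sq' h3.1 h3.2
    rwa [mul_pow, Real.sq_sqrt (Nat.cast_nonneg N)] at h4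
  rw [Finset.sum_const, Finset.card_univ, Fintype.card_fin, nsmul_eq_mul] at h2
  calc _ ≤ (∑ j, η j ^ 2) * (p * (A ^ 2 * N)) :=
        mul_le_mul_of_nonneg_left h2 (Finset.sum_nonneg fun _ _ => sq_nonneg _)
    _ = _ := by ring

set_option maxHeartbeats 400000 in
/-- The regressors consisting of lagged errors and piecewise periodic functions are
well conditioned, and nearly uncorrelated with the noise. -/
theorem exists_regressor_bounds {T p : ℕ} (hT : 0 < T) (φ : Fin p → ℝ) (ψ : ℕ → ℝ) (Ψ : ℝ)
    (hΨ : ∀ n, ∑ k ∈ Finset.range n, |ψ k| ≤ Ψ)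
    (hinv : PowerSeries.mk ψ * lagSeries φ = 1) {σ2 : ℝ} (hσ : 0 < σ2) :
    ∃ c : ℝ, 0 < c ∧ ∃ L : ℕ, ∀ (K : ℕ) (δ : ℝ), 0 < δ → ∃ ε₀ : ℝ, 0 < ε₀ ∧ ∀ A : ℝ, 0 ≤ A →
      ∃ N₀ : ℕ, ∀ N ≥ N₀, ∀ (ε : ℝ) (qs : Finset ℕ) (z e : ℕ → ℝ), ε ≤ ε₀ →
        GoodPath T φ σ2 ε A N qs z e →
        ∀ (η : Fin p → ℝ) (g : ℕ → ℝ) (B : Finset ℕ), B.card ≤ K → (∀ b ∈ B, L ≤ b) →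
          JumpsIn T (T + p) (p + 1) N B g →
          c * (N * ∑ j, η j ^ 2 + energy (p + 1) (N + 1) g) ≤ energy (p + 1) (N + 1)
            (fun t => ∑ j : Fin p, η j * e (t - ((j : ℕ) + 1)) + g t) ∧
          (∑ t ∈ Finset.Ico (p + 1) (N + 1),
            z t * (∑ j : Fin p, η j * e (t - ((j : ℕ) + 1)) + g t)) ^ 2 ≤
            δ * N * energy (p + 1) (N + 1)
              (fun t => ∑ j : Fin p, η j * e (t - ((j : ℕ) + 1)) + g t) := by
  obtain ⟨C₂, hC₂, L, hL⟩ := exists_energy_le_energy_arf hT φ ψ Ψ hΨ hinv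
  obtain ⟨C₁, hC₁⟩ : ∃ x : ℝ, x = 2 + 2 * (p * ∑ j, φ j ^ 2) := ⟨_, rfl⟩
  have hC₁0 : 0 < C₁ := by rw [hC₁]; positivity
  -- After whitening, the energy is at least `σ2 / 2 * N * ∑ η ^ 2`, plus the energy of the filtered
  -- `g`, minus a cross term that is `m` times the two sizes; these bounds on `m` leave the same
  -- multiple `m` of both.
  obtain ⟨m, hm⟩ : ∃ x : ℝ, x = min (σ2 / 4) (1 / 2) := ⟨_, rfl⟩
  have hm0 : 0 < m := by rw [hm]; positivity
  obtain ⟨c, hc⟩ : ∃ x : ℝ, x = m * min 1 (1 / C₂) / C₁ := ⟨_, rfl⟩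
  have hc0 : 0 < c := by rw [hc]; positivity
  refine ⟨c, hc0, p + 1 + L, fun K δ hδ => ?_⟩
  -- the tolerances for the two uses of the coarse bound
  obtain ⟨F₁, hF₁⟩ : ∃ x : ℝ, x = (p + 1) * (T * ((K * (T + p + p) + T : ℕ) + 1)) := ⟨_, rfl⟩
  obtain ⟨F₂, hF₂⟩ : ∃ x : ℝ, x = T * ((K * (T + p) + T : ℕ) + 1) := ⟨_, rfl⟩
  have hF₁0 : 0 < F₁ := by rw [hF₁]; positivity
  have hF₂0 : 0 < F₂ := by rw [hF₂]; positivity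
  obtain ⟨δ₁, hδ₁⟩ : ∃ x : ℝ, x = m ^ 2 / F₁ := ⟨_, rfl⟩
  obtain ⟨δ₂, hδ₂⟩ : ∃ x : ℝ, x = c * δ / (4 * F₂) := ⟨_, rfl⟩
  have hδ₁0 : 0 < δ₁ := by rw [hδ₁]; positivity
  have hδ₂0 : 0 < δ₂ := by rw [hδ₂]; positivity
  refine ⟨min (σ2 / 8) (min (δ₁ / 4) (δ₂ / 4)), by positivity, fun A hA => ?_⟩
  have hev : ∀ᶠ N : ℕ in atTop, 8 * A ^ 2 * σ2 / δ₁ ^ 2 ≤ N ∧ 8 * A ^ 2 * σ2 / δ₂ ^ 2 ≤ N ∧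
      4 * p * A ^ 2 / (c * δ) ≤ N ∧ 2 * p + L ≤ N ∧ (16 * p : ℝ) ≤ N ∧
      (8 * p * A / σ2) ^ 2 ≤ (N : ℝ) := by
    refine (tendsto_natCast_atTop_atTop.eventually_ge_atTop _).and <|
      (tendsto_natCast_atTop_atTop.eventually_ge_atTop _).and <|
      (tendsto_natCast_atTop_atTop.eventually_ge_atTop _).and <|
      (eventually_ge_atTop _).and <| (tendsto_natCast_atTop_atTop.eventually_ge_atTop _).and
      (tendsto_natCast_atTop_atTop.eventually_ge_atTop _)
  obtain ⟨N₀, hN₀⟩ := eventually_atTop.1 hev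
  refine ⟨N₀, fun N hN ε qs z e hε hG η g B hBK hBL hg => ?_⟩
  obtain ⟨n1, n2, n3, n4, n5, n6⟩ := hN₀ N hN
  rw [div_le_iff₀ (by positivity)] at n1 n2 n3
  have hε1 : ε ≤ σ2 / 8 := hε.trans (min_le_left _ _)
  have hε2 : ε ≤ δ₁ / 4 := hε.trans ((min_le_right _ _).trans (min_le_left _ _))
  have hε3 : ε ≤ δ₂ / 4 := hε.trans ((min_le_right _ _).trans (min_le_right _ _))
  set w : ℕ → ℝ := fun t => ∑ j : Fin p, η j * e (t - ((j : ℕ) + 1)) + g t with hw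
  set S : ℝ := ∑ j, η j ^ 2 with hS
  have hS0 : 0 ≤ S := Finset.sum_nonneg fun _ _ => sq_nonneg _
  set G : ℕ → ℝ := arf φ g with hGdef
  set ζ : ℕ → ℝ := fun t => ∑ j : Fin p, η j * z (t - ((j : ℕ) + 1)) with hζ
  set EG := energy (2 * p + 1) (N + 1) G with hEG
  set Eg := energy (p + 1) (N + 1) g with hEg
  set Ew := energy (p + 1) (N + 1) w with hEw
  have hEG0 : 0 ≤ EG := energy_nonneg _ _ _
  have hEg0 : 0 ≤ Eg := energy_nonneg _ _ _
  have hEw0 : 0 ≤ Ew := energy_nonneg _ _ _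
  have hN0 : (0 : ℝ) ≤ N := Nat.cast_nonneg N
  have hcardG : ((Finset.Ico (2 * p + 1 + T) (N + 1)).filter fun t => G t ≠ G (t - T)).card ≤
      K * (T + p + p) := by
    have := (hg.arf φ).card_le
    rw [show p + 1 + p + T = 2 * p + 1 + T by ring] at this
    exact this.trans (Nat.mul_le_mul_right _ hBK)
  have hcardg : ((Finset.Ico (p + 1 + T) (N + 1)).filter fun t => g t ≠ g (t - T)).card ≤
      K * (T + p) := hg.card_le.trans (Nat.mul_le_mul_right _ hBK)
  -- energy of the doubly filtered regressors
  have hfilt : energy (2 * p + 1) (N + 1) (fun t => ζ t + G t) ≤ C₁ * Ew := by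
    have h1 := energy_arf_le φ (p + 1) (N + 1) w
    rw [show p + 1 + p = 2 * p + 1 by ring] at h1
    rw [energy_congr fun t h1 h2 => hG.arf_error_add η g h1 (by omega)] at h1
    rw [hC₁]
    exact h1
  have hcrossζ : 2 * |∑ t ∈ Finset.Ico (2 * p + 1) (N + 1), ζ t * G t| ≤ m * (N * S + EG) := by
    refine two_mul_abs_le_of_sq_le hm0.le (by positivity) hEG0 ?_
    have h1 : ∑ t ∈ Finset.Ico (2 * p + 1) (N + 1), ζ t * G t =
        ∑ j : Fin p, η j * ∑ t ∈ Finset.Ico (2 * p + 1) (N + 1), z (t - ((j : ℕ) + 1)) * G t := by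
      simp only [hζ, Finset.sum_mul, Finset.mul_sum]
      rw [Finset.sum_comm]
      exact Finset.sum_congr rfl fun j _ => Finset.sum_congr rfl fun t _ => by ring
    rw [h1]
    have h2 : ∑ j : Fin p, (∑ t ∈ Finset.Ico (2 * p + 1) (N + 1),
        z (t - ((j : ℕ) + 1)) * G t) ^ 2 ≤ ∑ _j : Fin p,
          T * ((K * (T + p + p) + T : ℕ) + 1) * (δ₁ * N) * EG :=
      Finset.sum_le_sum fun j _ => hG.sq_sum_lag_mul_le hT hσ hδ₁0 hε2 (by linarith)
        (by omega) le_rfl G _ hcardG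
    rw [Finset.sum_const, Finset.card_univ, Fintype.card_fin, nsmul_eq_mul] at h2
    calc _ ≤ S * _ := Finset.sum_mul_sq_le_sq_mul_sq _ _ _
      _ ≤ S * (p * (T * ((K * (T + p + p) + T : ℕ) + 1) * (δ₁ * N) * EG)) :=
          mul_le_mul_of_nonneg_left h2 hS0
      _ ≤ S * ((p + 1) * (T * ((K * (T + p + p) + T : ℕ) + 1) * (δ₁ * N) * EG)) := by
          refine mul_le_mul_of_nonneg_left (mul_le_mul_of_nonneg_right (by linarith) ?_) hS0
          exact mul_nonneg (mul_nonneg (by positivity) (by positivity)) hEG0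
      _ = (F₁ * δ₁) * (N * S * EG) := by rw [hF₁]; ring
      _ = m ^ 2 * (N * S * EG) := by rw [hδ₁]; field_simp
  have hsqrt : p * (A * √N) ≤ σ2 / 8 * N := by
    have h1 : 8 * p * A / σ2 ≤ √N := Real.le_sqrt_of_sq_le n6
    rw [div_le_iff₀ hσ] at h1
    have h2 : √(N : ℝ) * √N = N := Real.mul_self_sqrt hN0
    have h3 := mul_le_mul_of_nonneg_right h1 (Real.sqrt_nonneg (N : ℝ))
    have h4 : √(N : ℝ) * σ2 * √N = σ2 * N := by
      rw [mul_right_comm, h2, mul_comm]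
    linarith
  have hζE : S * (σ2 / 2 * N) ≤ energy (2 * p + 1) (N + 1) ζ := by
    refine le_trans (mul_le_mul_of_nonneg_left ?_ hS0) (hG.le_energy_lag_noise hA (by omega) η)
    have : ε * N ≤ σ2 / 8 * N := mul_le_mul_of_nonneg_right hε1 hN0
    have h5 := mul_le_mul_of_nonneg_left n5 hσ.le
    have h6 := mul_nonneg hσ.le hN0
    linarith
  have hsum : m * (N * S + EG) ≤ C₁ * Ew := by
    have h1 : energy (2 * p + 1) (N + 1) (fun t => ζ t + G t) = energy (2 * p + 1) (N + 1) ζ +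
        2 * ∑ t ∈ Finset.Ico (2 * p + 1) (N + 1), ζ t * G t + EG := by
      rw [hEG]
      unfold energy
      rw [Finset.mul_sum, ← Finset.sum_add_distrib, ← Finset.sum_add_distrib]
      exact Finset.sum_congr rfl fun t _ => by ring
    have h2 := neg_abs_le (∑ t ∈ Finset.Ico (2 * p + 1) (N + 1), ζ t * G t)
    have h3 : m * (N * S) ≤ σ2 / 4 * (N * S) :=
      mul_le_mul_of_nonneg_right (hm ▸ min_le_left _ _) (by positivity)
    have h4 : m * EG ≤ 1 / 2 * EG := mul_le_mul_of_nonneg_right (hm ▸ min_le_right _ _) hEG0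
    linarith
  -- No point of `B` lies before `p + 1 + L`, so `g` begins with the long periodic stretch that
  -- makes the filter bounded below.
  have hEgG : Eg ≤ C₂ * EG := by
    have h1 := hL (p + 1) (N + 1) g (by omega) (fun t ht htL => by
      by_contra hne
      obtain ⟨b, hb, hbt, -⟩ := hg t ht (by omega) hne
      have := hBL b hb
      omega)
    rwa [show p + 1 + p = 2 * p + 1 by ring] at h1
  have hmain : c * (N * S + Eg) ≤ Ew := by
    have h1 : min 1 (1 / C₂) * (N * S + Eg) ≤ N * S + EG := by
      have h2 : min 1 (1 / C₂) * (N * S) ≤ 1 * (N * S) :=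
        mul_le_mul_of_nonneg_right (min_le_left _ _) (by positivity)
      have h3 : min 1 (1 / C₂) * Eg ≤ 1 / C₂ * Eg :=
        mul_le_mul_of_nonneg_right (min_le_right _ _) hEg0
      have h4 : 1 / C₂ * Eg ≤ EG := by
        rw [one_div, inv_mul_le_iff₀ hC₂]; exact hEgG
      linarith
    rw [hc, div_mul_eq_mul_div, div_le_iff₀ hC₁0]
    calc _ = m * (min 1 (1 / C₂) * (N * S + Eg)) := by ring
      _ ≤ m * (N * S + EG) := mul_le_mul_of_nonneg_left h1 hm0.le
      _ ≤ _ := by linarith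
  refine ⟨hmain, ?_⟩
  have hz1 := hG.sq_sum_noise_lag_error_le η
  have hz2 := hG.sq_sum_lag_mul_le hT hσ hδ₂0 hε3 (by linarith) (l := 0) (a := p + 1) (by omega)
    (by omega) g _ hcardg
  simp only [Nat.sub_zero] at hz2
  have hsplit : ∑ t ∈ Finset.Ico (p + 1) (N + 1), z t * w t =
      ∑ t ∈ Finset.Ico (p + 1) (N + 1), z t * ∑ j : Fin p, η j * e (t - ((j : ℕ) + 1)) +
      ∑ t ∈ Finset.Ico (p + 1) (N + 1), z t * g t := by
    rw [← Finset.sum_add_distrib]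
    exact Finset.sum_congr rfl fun t _ => by simp only [hw]; ring
  rw [hsplit]
  set X := ∑ t ∈ Finset.Ico (p + 1) (N + 1), z t * ∑ j : Fin p, η j * e (t - ((j : ℕ) + 1))
  set Y := ∑ t ∈ Finset.Ico (p + 1) (N + 1), z t * g t
  have hNS : c * (N * S) ≤ Ew := by linarith [mul_nonneg hc0.le hEg0]
  have hEgw : c * Eg ≤ Ew := by linarith [mul_nonneg hc0.le (mul_nonneg hN0 hS0)]
  have hX : 2 * X ^ 2 ≤ δ / 2 * N * Ew := by
    have h1 : 4 * p * A ^ 2 * (N * S) ≤ N * (c * δ) * (N * S) :=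
      mul_le_mul_of_nonneg_right n3 (by positivity)
    have h2 : N * δ * (c * (N * S)) ≤ N * δ * Ew :=
      mul_le_mul_of_nonneg_left hNS (by positivity)
    linarith
  have hY : 2 * Y ^ 2 ≤ δ / 2 * N * Ew := by
    have h1 : T * ((K * (T + p) + T : ℕ) + 1) * (δ₂ * N) * Eg = δ / 4 * N * (c * Eg) := by
      have : (T : ℝ) * ((K * (T + p) + T : ℕ) + 1) * (δ₂ * N) * Eg = F₂ * δ₂ * N * Eg := by
        rw [hF₂]; ring
      rw [this, hδ₂]; field_simp
    have h2 : δ / 4 * N * (c * Eg) ≤ δ / 4 * N * Ew :=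
      mul_le_mul_of_nonneg_left hEgw (by positivity)
    linarith [hz2.trans_eq h1]
  linarith [sq_nonneg (X - Y), add_sq X Y, sub_sq X Y]

end Coarse

/-! ### Fine bounds near the true changepoints -/

/-- The difference of the indicators of `[b, ∞)` and `[b', ∞)` at time `t`. -/
def stepDiff (b b' t : ℕ) : ℝ := (if b ≤ t then 1 else 0) - (if b' ≤ t then 1 else 0)

lemma energy_stepDiff_le (a N b b' : ℕ) : energy a N (stepDiff b b') ≤ |(b : ℝ) - b'| := by
  have key : ∀ b b' : ℕ, b ≤ b' → energy a N (stepDiff b b') ≤ |(b : ℝ) - b'| := by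
    intro b b' h
    calc energy a N (stepDiff b b')
        = ∑ t ∈ Finset.Ico a N, if t ∈ Finset.Ico b b' then (1 : ℝ) else 0 := by
          refine Finset.sum_congr rfl fun t _ => ?_
          simp only [stepDiff, Finset.mem_Ico]
          split_ifs <;> first | omega | norm_num
      _ = ((Finset.Ico a N ∩ Finset.Ico b b').card : ℝ) := by
          rw [Finset.sum_ite_mem, Finset.sum_const, nsmul_eq_mul, mul_one]
      _ ≤ ((Finset.Ico b b').card : ℝ) := by
          exact_mod_cast Finset.card_le_card Finset.inter_subset_right
      _ = |(b : ℝ) - b'| := by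
          rw [Nat.card_Ico, Nat.cast_sub h, abs_sub_comm, abs_of_nonneg]
          have : (b : ℝ) ≤ b' := by exact_mod_cast h
          linarith
  rcases le_total b b' with h | h
  · exact key b b' h
  · rw [abs_sub_comm]
    refine le_trans (le_of_eq ?_) (key b' b h)
    refine Finset.sum_congr rfl fun t _ => ?_
    simp only [stepDiff]; ring

section Fine

variable {T p : ℕ} {φ : Fin p → ℝ} {σ2 ε A : ℝ} {N : ℕ} {qs : Finset ℕ} {z e : ℕ → ℝ}

/-- The sum runs over the times between the two changepoints only. It is bounded by a line of small
slope in their distance, which is what produces the rate `1 / N`. Only `b'`, the true time, has to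
be among the prescribed times; `b` may depend on the path. -/
lemma GoodPath.abs_sum_stepDiff_le (hG : GoodPath T φ σ2 ε A N qs z e) {b b' l : ℕ}
    (hl : l ≤ p) (hb : p + 1 ≤ b) (hb' : p + 1 ≤ b') (hbN : b + p ≤ N) (hbN' : b' + p ≤ N)
    (hq : b' + l ∈ qs) :
    |∑ t ∈ Finset.Ico (p + 1) (N + 1), z t * stepDiff b b' (t - l)| ≤
      ε * |(b : ℝ) - b'| + A := by
  have h1 : ∀ b : ℕ, p + 1 ≤ b → b + p ≤ N →
      ∑ t ∈ Finset.Ico (p + 1) (N + 1), z t * (if b ≤ t - l then 1 else 0) =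
        ∑ t ∈ Finset.Ico (b + l) (N + 1), z t := by
    intro b hb hbN
    rw [← Finset.sum_Ico_consecutive _ (show p + 1 ≤ b + l by omega) (show b + l ≤ N + 1 by omega)]
    rw [Finset.sum_eq_zero, zero_add]
    · refine Finset.sum_congr rfl fun t ht => ?_
      rw [Finset.mem_Ico] at ht
      rw [if_pos (by omega), mul_one]
    · intro t ht
      rw [Finset.mem_Ico] at ht
      rw [if_neg (by omega), mul_zero]
  simp only [stepDiff, mul_sub, Finset.sum_sub_distrib]
  rw [h1 b hb hbN, h1 b' hb' hbN']
  rcases le_total b b' with h | h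
  · rw [← Finset.sum_Ico_consecutive _ (show b + l ≤ b' + l by omega)
      (show b' + l ≤ N + 1 by omega), add_sub_cancel_right]
    have := hG.near_left (b' + l) hq (b' - b) (by omega)
    rw [show b' + l - (b' - b) = b + l by omega] at this
    rwa [Nat.cast_sub h, ← abs_of_nonneg (show (0 : ℝ) ≤ (b' : ℝ) - b by
      have : (b : ℝ) ≤ b' := by exact_mod_cast h
      linarith), abs_sub_comm (b' : ℝ)] at this
  · rw [← Finset.sum_Ico_consecutive _ (show b' + l ≤ b + l by omega)
      (show b + l ≤ N + 1 by omega), sub_add_cancel_right, abs_neg]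
    have := hG.near_right (b' + l) hq (b - b') (by omega)
    rw [show b' + l + (b - b') = b + l by omega] at this
    rwa [Nat.cast_sub h, ← abs_of_nonneg (show (0 : ℝ) ≤ (b : ℝ) - b' by
      have : (b' : ℝ) ≤ b := by exact_mod_cast h
      linarith)] at this

/-- When the jumps are a positive fraction of `N` apart, every run is long, so the bound `A * √N`
for noise sums is of the order of the square root of the run length. In contrast with the coarse
bound, no factor `N` remains. -/
lemma GoodPath.sq_sum_mul_lag_le (hG : GoodPath T φ σ2 ε A N qs z e) (hT : 0 < T)
    {κ : ℝ} (hκ : 0 < κ) (hκ1 : κ ≤ 1) (hN : 2 * (T + p + 1 : ℕ) ≤ κ * N) {B : Finset ℕ} {K : ℕ}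
    (hBK : B.card ≤ K) (hB1 : ∀ b ∈ B, κ * N ≤ b) (hB2 : ∀ b ∈ B, b + κ * N ≤ N)
    (hB3 : ∀ b ∈ B, ∀ b' ∈ B, b < b' → b + κ * N ≤ b') {u : ℕ → ℝ} (hu : JumpsIn T T 1 N B u)
    {l : ℕ} (hl : l ≤ p) :
    (∑ t ∈ Finset.Ico (p + 1) (N + 1), z t * u (t - l)) ^ 2 ≤
      T * ((K * (T + p) + T : ℕ) + 1) * (8 * T * A ^ 2 / κ) * energy 1 (N + 1) u := by
  have hT' : (0 : ℝ) < T := by exact_mod_cast hT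
  have hj : ∀ t, p + 1 + T ≤ t → t ≤ N → u (t - l) ≠ u (t - T - l) →
      ∃ b ∈ B, b + l ≤ t ∧ t < b + l + T := by
    intro t ht htN hne
    obtain ⟨b, hb, h1, h2⟩ := hu (t - l) (by omega) (by omega)
      (by rwa [Nat.sub_right_comm] at hne)
    exact ⟨b, hb, by omega, by omega⟩
  have hJ : JumpsIn T (T + p) (p + 1) N B (fun t => u (t - l)) := by
    intro t ht htN hne
    obtain ⟨b, hb, h1, h2⟩ := hj t ht htN hne
    exact ⟨b, hb, by omega, by omega⟩
  have h := sq_sum_mul_le_of_stepRuns hT (p + 1) (N + 1) z (fun t => u (t - l))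
    (B := 8 * T * A ^ 2 / κ) (by positivity) (K * (T + p))
    (hJ.card_le.trans (Nat.mul_le_mul_right _ hBK)) ?_
  · refine h.trans (mul_le_mul_of_nonneg_left ?_ (by positivity))
    exact energy_shift_le u (by omega)
  intro t n hat htN hn htn hstart hend _
  -- the run is long
  have hlen : κ * N ≤ (T * n : ℕ) + (T + p + 1 : ℕ) := by
    have hend' : N + 1 ≤ t + T * n ∨ ∃ b ∈ B, b + l ≤ t + T * n ∧ t + T * n < b + l + T := by
      by_cases hNt : N + 1 ≤ t + T * n
      · exact Or.inl hNt
      · rcases hend with h | h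
        · exact Or.inl h
        · have h1 : T ≤ T * n := Nat.le_mul_of_pos_right T hn
          exact Or.inr (hj _ (by omega) (by omega) h)
    have hstart' : t < p + 1 + T ∨ ∃ b ∈ B, b + l ≤ t ∧ t < b + l + T := by
      by_cases ht : t < p + 1 + T
      · exact Or.inl ht
      · rcases hstart with h | h
        · exact Or.inl h
        · exact Or.inr (hj _ (by omega) (by omega) h)
    have h1 : T ≤ T * n := Nat.le_mul_of_pos_right T hn
    rcases hstart' with hs | ⟨b, hb, hbt, htb⟩ <;> rcases hend' with he | ⟨b', hb', hbt', htb'⟩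
    · have h2 : N ≤ T * n + (T + p + 1) := by omega
      have h3 : (N : ℝ) ≤ (T * n : ℕ) + (T + p + 1 : ℕ) := by exact_mod_cast h2
      have h4 : κ * N ≤ 1 * N := mul_le_mul_of_nonneg_right hκ1 (Nat.cast_nonneg N)
      linarith
    · have h2 : b' ≤ T * n + (T + p + 1) := by omega
      have h3 : (b' : ℝ) ≤ (T * n : ℕ) + (T + p + 1 : ℕ) := by exact_mod_cast h2
      linarith [hB1 b' hb']
    · have h2 : N ≤ b + (T * n + (T + p + 1)) := by omega
      have h3 : (N : ℝ) ≤ b + ((T * n : ℕ) + (T + p + 1 : ℕ)) := by exact_mod_cast h2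
      linarith [hB2 b hb]
    · have h2 : b' ≤ b + (T * n + (T + p + 1)) := by omega
      have h3 : (b' : ℝ) ≤ b + ((T * n : ℕ) + (T + p + 1 : ℕ)) := by exact_mod_cast h2
      have h4 : b < b' := by omega
      linarith [hB3 b hb b' hb' h4]
  obtain ⟨k, s, hs, hk⟩ : ∃ k s, s < T ∧ t = p + 1 + s + T * k :=
    ⟨(t - (p + 1)) / T, (t - (p + 1)) % T, Nat.mod_lt _ hT, by
      have := Nat.mod_add_div (t - (p + 1)) T; omega⟩
  have e : ∀ i, z (t + T * i) = z ((p + 1 + s) + T * (k + i)) := by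
    intro i; congr 1; rw [hk, mul_add]; omega
  have hkn : k + n ≤ N := by
    have h1 : T * (k + n) < N + 1 + T - (p + 1) := by rw [mul_add]; omega
    by_contra hcon
    have h2 : T * (N + 1) ≤ T * (k + n) := Nat.mul_le_mul_left T (by omega)
    have h3 : N ≤ T * N := Nat.le_mul_of_pos_left N hT
    rw [Nat.mul_succ] at h2
    omega
  simp only [e]
  have a1 := abs_le.1 (hG.abs_sum_le (p + 1 + s) (by omega) (by omega) k (by omega))
  have a2 := abs_le.1 (hG.abs_sum_le (p + 1 + s) (by omega) (by omega) (k + n) hkn)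
  have e' := Finset.sum_range_add (fun i => z ((p + 1 + s) + T * i)) k n
  have h3 : |∑ i ∈ Finset.range n, z ((p + 1 + s) + T * (k + i))| ≤ 2 * (A * √N) := by
    rw [abs_le]; constructor <;> linarith [a1.1, a1.2, a2.1, a2.2]
  have h4 := sq_le_sq' (abs_le.1 h3).1 (abs_le.1 h3).2
  have h5 : (2 * (A * √N)) ^ 2 = 4 * A ^ 2 * N := by
    rw [mul_pow, mul_pow, Real.sq_sqrt (Nat.cast_nonneg N)]; ring
  rw [h5] at h4
  refine h4.trans ?_
  have h6 : κ * N ≤ 2 * (T * n) := by push_cast at hlen hN ⊢; linarith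
  have h7 : (n : ℝ) * (8 * T * A ^ 2 / κ) = 4 * A ^ 2 * (2 * (T * n)) / κ := by ring
  rw [h7, le_div_iff₀ hκ]
  calc 4 * A ^ 2 * N * κ = 4 * A ^ 2 * (κ * N) := by ring
    _ ≤ _ := mul_le_mul_of_nonneg_left h6 (by positivity)

lemma energy_sum_stepDiff_le {m : ℕ} (Δ : Fin m → ℝ) (D : ℝ) (hD : ∀ r, |Δ r| ≤ D)
    (τ τ0 : Fin m → ℕ) (a N : ℕ) :
    energy a N (fun t => ∑ r, Δ r * stepDiff (τ r) (τ0 r) t) ≤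
      m * D ^ 2 * ∑ r, |(τ r : ℝ) - τ0 r| := by
  calc energy a N (fun t => ∑ r, Δ r * stepDiff (τ r) (τ0 r) t)
      ≤ ∑ t ∈ Finset.Ico a N, (∑ r, Δ r ^ 2) * ∑ r, stepDiff (τ r) (τ0 r) t ^ 2 :=
        Finset.sum_le_sum fun t _ => Finset.sum_mul_sq_le_sq_mul_sq _ _ _
    _ = (∑ r, Δ r ^ 2) * ∑ r, energy a N (stepDiff (τ r) (τ0 r)) := by
        rw [← Finset.mul_sum, Finset.sum_comm]; rfl
    _ ≤ (∑ _r : Fin m, D ^ 2) * ∑ r, |(τ r : ℝ) - τ0 r| := by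
        refine mul_le_mul (Finset.sum_le_sum fun r _ => ?_)
          (Finset.sum_le_sum fun r _ => energy_stepDiff_le _ _ _ _)
          (Finset.sum_nonneg fun _ _ => energy_nonneg _ _ _)
          (Finset.sum_nonneg fun _ _ => sq_nonneg _)
        exact sq_le_sq' (abs_le.1 (hD r)).1 (abs_le.1 (hD r)).2
    _ = _ := by rw [Finset.sum_const, Finset.card_univ, Fintype.card_fin, nsmul_eq_mul]

/-- `u` is the difference between a fitted and the true mean function, where the fitted one has
well separated changepoints, which include points `τ r` close to the true changepoints `τ0 r`. -/
structure FineDecomp (T p K m : ℕ) (κ D : ℝ) (N : ℕ) (qs : Finset ℕ) (u : ℕ → ℝ)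
    (τ τ0 : Fin m → ℕ) : Prop where
  exists_decomp : ∃ (B : Finset ℕ) (v : ℕ → ℝ) (Δ : Fin m → ℝ), B.card ≤ K ∧
    (∀ b ∈ B, κ * N ≤ b) ∧ (∀ b ∈ B, b + κ * N ≤ N) ∧
    (∀ b ∈ B, ∀ b' ∈ B, b < b' → b + κ * N ≤ b') ∧ JumpsIn T T 1 N B v ∧ (∀ r, |Δ r| ≤ D) ∧
    ∀ t, u t = v t + ∑ r, Δ r * stepDiff (τ r) (τ0 r) t
  tau_ge : ∀ r, p + 1 ≤ τ r
  tau0_ge : ∀ r, p + 1 ≤ τ0 r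
  tau_le : ∀ r, τ r + p ≤ N
  tau0_le : ∀ r, τ0 r + p ≤ N
  mem_qs : ∀ r, ∀ l ≤ p, τ0 r + l ∈ qs

/-- The part with separated jumps is treated by the bound without `N` and a weighted inequality of
means, the explicit steps by the line bound. It matters that `C` is fixed before `ε` and `A`: the
coefficient `C * ε` can then be made small, while `A` affects only the additive constant. -/
lemma exists_abs_sum_noise_lag_le {T p : ℕ} (hT : 0 < T) (K m : ℕ) {κ D : ℝ}
    (hκ : 0 < κ) (hκ1 : κ ≤ 1) (hD0 : 0 ≤ D) :
    ∃ C : ℝ, 0 < C ∧ ∀ ε A : ℝ, 0 < ε → 0 ≤ A → ∃ A' : ℝ, 0 ≤ A' ∧ ∃ N₀ : ℕ, ∀ N ≥ N₀,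
      ∀ (φ : Fin p → ℝ) (σ2 : ℝ) (qs : Finset ℕ) (z e : ℕ → ℝ), GoodPath T φ σ2 ε A N qs z e →
      ∀ (u : ℕ → ℝ) (τ τ0 : Fin m → ℕ), FineDecomp T p K m κ D N qs u τ τ0 →
      ∀ l ≤ p, |∑ t ∈ Finset.Ico (p + 1) (N + 1), z t * u (t - l)| ≤
        C * ε * (energy 1 (N + 1) u + ∑ r, |(τ r : ℝ) - τ0 r|) + A' := by
  obtain ⟨F, hF⟩ : ∃ x : ℝ, x = T * ((K * (T + p) + T : ℕ) + 1) * (8 * T / κ) := ⟨_, rfl⟩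
  have hF0 : 0 ≤ F := by rw [hF]; positivity
  refine ⟨1 + m * D ^ 2 + D, by positivity, fun ε A hε hA =>
    ⟨F * A ^ 2 / ε + m * (D * A), by positivity, ?_⟩⟩
  obtain ⟨N₀, hN₀⟩ := eventually_atTop.1
    (tendsto_natCast_atTop_atTop.eventually_ge_atTop (2 * (T + p + 1 : ℕ) / κ : ℝ))
  refine ⟨N₀, fun N hN φ σ2 qs z e hG u τ τ0 hu l hl => ?_⟩
  obtain ⟨B, v, Δ, hBK, hB1, hB2, hB3, hv, hΔ, huv⟩ := hu.exists_decomp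
  have hN1 := hN₀ N hN
  rw [div_le_iff₀ hκ, mul_comm (N : ℝ)] at hN1
  set E := energy 1 (N + 1) u
  set k := ∑ r, |(τ r : ℝ) - τ0 r| with hk
  have hk0 : 0 ≤ k := Finset.sum_nonneg fun _ _ => abs_nonneg _
  have hE0 : 0 ≤ E := energy_nonneg _ _ _
  have hEv : energy 1 (N + 1) v ≤ 2 * E + 2 * (m * D ^ 2 * k) := by
    have h1 := energy_le_two (a := 1) (b := N + 1) (x := v) (y := u)
      (z := fun t => ∑ r, (-Δ r) * stepDiff (τ r) (τ0 r) t) fun t _ _ => by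
        rw [huv t]; simp only [neg_mul, Finset.sum_neg_distrib]; ring
    have h2 := energy_sum_stepDiff_le (fun r => -Δ r) D (fun r => by rw [abs_neg]; exact hΔ r)
      τ τ0 1 (N + 1)
    linarith
  have hx := hG.sq_sum_mul_lag_le hT hκ hκ1 hN1 hBK hB1 hB2 hB3 hv hl
  have hy : |∑ t ∈ Finset.Ico (p + 1) (N + 1), z t * ∑ r, Δ r * stepDiff (τ r) (τ0 r) (t - l)| ≤
      D * (ε * k + m * A) := by
    have h1 : ∑ t ∈ Finset.Ico (p + 1) (N + 1), z t * ∑ r, Δ r * stepDiff (τ r) (τ0 r) (t - l) =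
        ∑ r, Δ r * ∑ t ∈ Finset.Ico (p + 1) (N + 1), z t * stepDiff (τ r) (τ0 r) (t - l) := by
      simp only [Finset.mul_sum]
      rw [Finset.sum_comm]
      exact Finset.sum_congr rfl fun j _ => Finset.sum_congr rfl fun t _ => by ring
    rw [h1]
    refine (Finset.abs_sum_le_sum_abs _ _).trans ?_
    calc _ ≤ ∑ r, D * (ε * |(τ r : ℝ) - τ0 r| + A) := by
          refine Finset.sum_le_sum fun r _ => ?_
          rw [abs_mul]
          exact mul_le_mul (hΔ r) (hG.abs_sum_stepDiff_le hl (hu.tau_ge r) (hu.tau0_ge r)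
            (hu.tau_le r) (hu.tau0_le r) (hu.mem_qs r l hl)) (abs_nonneg _) hD0
      _ = _ := by
          rw [← Finset.mul_sum, Finset.sum_add_distrib, ← Finset.mul_sum, Finset.sum_const,
            Finset.card_univ, Fintype.card_fin, nsmul_eq_mul]
  have hsplit : ∑ t ∈ Finset.Ico (p + 1) (N + 1), z t * u (t - l) =
      ∑ t ∈ Finset.Ico (p + 1) (N + 1), z t * v (t - l) +
      ∑ t ∈ Finset.Ico (p + 1) (N + 1), z t * ∑ r, Δ r * stepDiff (τ r) (τ0 r) (t - l) := by
    rw [← Finset.sum_add_distrib]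
    exact Finset.sum_congr rfl fun t _ => by rw [huv (t - l)]; ring
  set x := ∑ t ∈ Finset.Ico (p + 1) (N + 1), z t * v (t - l)
  -- The weight `ε` makes the energy term small, at the price of `F * A ^ 2 / ε`, which goes into
  -- `A'`.
  have hx2 : 2 * |x| ≤ ε * ((E + m * D ^ 2 * k) + 2 * F * A ^ 2 / ε ^ 2) := by
    refine two_mul_abs_le_of_sq_le hε.le (by positivity) (by positivity) ?_
    have h1 : ε ^ 2 * ((E + m * D ^ 2 * k) * (2 * F * A ^ 2 / ε ^ 2)) =
        F * A ^ 2 * (2 * E + 2 * (m * D ^ 2 * k)) := by field_simp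
    rw [h1]
    calc x ^ 2 ≤ _ := hx
      _ = F * A ^ 2 * energy 1 (N + 1) v := by rw [hF]; ring
      _ ≤ _ := mul_le_mul_of_nonneg_left hEv (by positivity)
  have h2 : ε * (2 * F * A ^ 2 / ε ^ 2) = 2 * (F * A ^ 2 / ε) := by field_simp
  rw [hsplit]
  have h3 := abs_add_le x
    (∑ t ∈ Finset.Ico (p + 1) (N + 1), z t * ∑ r, Δ r * stepDiff (τ r) (τ0 r) (t - l))
  have h4 : 0 ≤ ε * E := by positivity
  have h5 : 0 ≤ ε * k := by positivity
  have h6 : 0 ≤ D * (ε * E) := by positivity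
  have h7 : 0 ≤ m * D ^ 2 * (ε * E) := by positivity
  have h8 : 0 ≤ m * D ^ 2 * (ε * k) := by positivity
  nlinarith

end Fine

/-! ### Lower bounds for residual sums of squares -/

lemma arf_sub (p : ℕ) (φ : Fin p → ℝ) (x y : ℕ → ℝ) (t : ℕ) :
    arf φ (fun t => x t - y t) t = arf φ x t - arf φ y t := by
  simp only [arf, mul_sub, Finset.sum_sub_distrib]; ring

lemma arf_eq_sub (p : ℕ) (φ φ' : Fin p → ℝ) (x : ℕ → ℝ) (t : ℕ) :
    arf φ' x t = arf φ x t - ∑ j : Fin p, (φ' j - φ j) * x (t - ((j : ℕ) + 1)) := by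
  simp only [arf, sub_mul, Finset.sum_sub_distrib]; ring

/-- Filters with coefficients close to those of an invertible filter are bounded below,
uniformly, on sequences that begin with a long periodic stretch. -/
lemma exists_energy_le_energy_arf_of_near {T p : ℕ} (hT : 0 < T) (φ : Fin p → ℝ) (ψ : ℕ → ℝ)
    (Ψ : ℝ) (hΨ : ∀ n, ∑ k ∈ Finset.range n, |ψ k| ≤ Ψ)
    (hinv : PowerSeries.mk ψ * lagSeries φ = 1) :
    ∃ C : ℝ, 0 < C ∧ ∃ η₀ : ℝ, 0 < η₀ ∧ ∃ L : ℕ, ∀ (a b : ℕ) (x : ℕ → ℝ) (φ' : Fin p → ℝ),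
      ∑ j, (φ' j - φ j) ^ 2 ≤ η₀ → a + L ≤ b →
      (∀ t, a + T ≤ t → t < a + L → x t = x (t - T)) →
      energy a b x ≤ C * energy (a + p) b (arf φ' x) := by
  obtain ⟨C, hC, L, hL⟩ := exists_energy_le_energy_arf hT φ ψ Ψ hΨ hinv
  -- With this radius, replacing `φ` by `φ'` costs at most half of the energy of `x`, which is moved
  -- to the left side.
  refine ⟨4 * C, by positivity, 1 / (4 * C * (p + 1)), by positivity, L,
    fun a b x φ' hφ' hab hper => ?_⟩
  have h1 := hL a b x hab hper
  have h2 := energy_le_two (a := a + p) (b := b) (x := arf φ x) (y := arf φ' x)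
    (z := fun t => ∑ j : Fin p, (φ' j - φ j) * x (t - ((j : ℕ) + 1))) fun t _ _ => by
      rw [arf_eq_sub p φ φ']; ring
  have h3 := energy_lag_le (fun j => φ' j - φ j) a b x
  have hE := energy_nonneg a b x
  have h4 : C * (p * (∑ j, (φ' j - φ j) ^ 2)) ≤ 1 / 4 := by
    have hp : (0 : ℝ) ≤ p := Nat.cast_nonneg p
    calc C * (p * (∑ j, (φ' j - φ j) ^ 2)) ≤ C * ((p + 1) * (1 / (4 * C * (p + 1)))) := by
          refine mul_le_mul_of_nonneg_left (mul_le_mul (by linarith) hφ' ?_ (by positivity)) hC.le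
          exact Finset.sum_nonneg fun _ _ => sq_nonneg _
      _ = 1 / 4 := by field_simp
  have h5 := mul_le_mul_of_nonneg_right h4 hE
  nlinarith [mul_le_mul_of_nonneg_left h2 hC.le, mul_le_mul_of_nonneg_left h3 hC.le]

/-- Filtering `e` with `φ'` gives `z` minus lagged errors weighted by `φ' - φ`; expanding the square
separates the noise from the deterministic and estimation errors. -/
lemma GoodPath.energy_residual_eq {T p : ℕ} {φ : Fin p → ℝ} {σ2 ε A : ℝ} {N : ℕ} {qs : Finset ℕ}
    {z e : ℕ → ℝ} (hG : GoodPath T φ σ2 ε A N qs z e) (φ' : Fin p → ℝ) (u : ℕ → ℝ) :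
    energy (p + 1) (N + 1) (arf φ' (fun t => e t - u t)) = energy (p + 1) (N + 1) z -
      2 * ∑ t ∈ Finset.Ico (p + 1) (N + 1), z t *
        (∑ j : Fin p, (φ' j - φ j) * e (t - ((j : ℕ) + 1)) + arf φ' u t) +
      energy (p + 1) (N + 1)
        (fun t => ∑ j : Fin p, (φ' j - φ j) * e (t - ((j : ℕ) + 1)) + arf φ' u t) := by
  unfold energy
  rw [Finset.mul_sum, ← Finset.sum_sub_distrib, ← Finset.sum_add_distrib]
  refine Finset.sum_congr rfl fun t ht => ?_
  rw [Finset.mem_Ico] at ht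
  rw [arf_sub, arf_eq_sub p φ φ' e, hG.filter_eq t ht.1 (by omega)]
  ring

lemma abs_sum_mul_arf_le {p N : ℕ} (φ' : Fin p → ℝ) (z u : ℕ → ℝ) (Q : ℝ)
    (hQ : ∀ l ≤ p, |∑ t ∈ Finset.Ico (p + 1) (N + 1), z t * u (t - l)| ≤ Q) :
    |∑ t ∈ Finset.Ico (p + 1) (N + 1), z t * arf φ' u t| ≤ (1 + ∑ j, |φ' j|) * Q := by
  have h1 : ∑ t ∈ Finset.Ico (p + 1) (N + 1), z t * arf φ' u t =
      ∑ t ∈ Finset.Ico (p + 1) (N + 1), z t * u (t - 0) -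
      ∑ j : Fin p, φ' j * ∑ t ∈ Finset.Ico (p + 1) (N + 1), z t * u (t - ((j : ℕ) + 1)) := by
    simp only [arf, mul_sub, Finset.sum_sub_distrib, Finset.mul_sum, Nat.sub_zero]
    rw [Finset.sum_comm]
    congr 1
    exact Finset.sum_congr rfl fun j _ => Finset.sum_congr rfl fun t _ => by ring
  rw [h1]
  refine (abs_sub _ _).trans ?_
  have h2 : |∑ j : Fin p, φ' j * ∑ t ∈ Finset.Ico (p + 1) (N + 1), z t * u (t - ((j : ℕ) + 1))| ≤
      ∑ j, |φ' j| * Q := by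
    refine (Finset.abs_sum_le_sum_abs _ _).trans (Finset.sum_le_sum fun j _ => ?_)
    rw [abs_mul]
    exact mul_le_mul_of_nonneg_left (hQ _ (by omega)) (abs_nonneg _)
  rw [← Finset.sum_mul] at h2
  have h3 := hQ 0 (Nat.zero_le p)
  linarith

/-- A lower bound for the residual sum of squares of every mean function with few changepoints
and every autoregression, in terms of the energy of the error in the mean function. -/
theorem exists_residual_lower_bound {T p : ℕ} (hT : 0 < T) (φ : Fin p → ℝ) (ψ : ℕ → ℝ) (Ψ : ℝ)
    (hΨ : ∀ n, ∑ k ∈ Finset.range n, |ψ k| ≤ Ψ)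
    (hinv : PowerSeries.mk ψ * lagSeries φ = 1) {σ2 : ℝ} (hσ : 0 < σ2) (K m : ℕ)
    {κ D κ₁ Ck η₁ : ℝ} (hκ : 0 < κ) (hκ1 : κ ≤ 1) (hD : 0 ≤ D) (hκ₁ : 0 < κ₁) (hCk : 0 < Ck)
    (hη₁ : 0 < η₁) :
    ∃ η₀ : ℝ, 0 < η₀ ∧ η₀ ≤ η₁ ∧ ∃ c : ℝ, 0 < c ∧ ∃ ε₀ : ℝ, 0 < ε₀ ∧ ∀ A : ℝ, 0 ≤ A →
      ∃ A' : ℝ, 0 ≤ A' ∧ ∃ N₀ : ℕ, ∀ N ≥ N₀, ∀ (qs : Finset ℕ) (z e : ℕ → ℝ),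
        GoodPath T φ σ2 ε₀ A N qs z e →
        ∀ (φ' : Fin p → ℝ) (u : ℕ → ℝ) (B : Finset ℕ), B.card ≤ K → (∀ b ∈ B, κ * N ≤ b) →
          JumpsIn T T 1 N B u →
          (η₀ < ∑ j, (φ' j - φ j) ^ 2 ∨ κ₁ * N ≤ energy 1 (N + 1) u →
            energy (p + 1) (N + 1) z + c * N ≤
              energy (p + 1) (N + 1) (arf φ' (fun t => e t - u t))) ∧
          (∑ j, (φ' j - φ j) ^ 2 ≤ η₀ → ∀ τ τ0 : Fin m → ℕ,
            FineDecomp T p K m κ D N qs u τ τ0 →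
            ∑ r, |(τ r : ℝ) - τ0 r| ≤ Ck * (energy 1 (N + 1) u + 1) →
            energy (p + 1) (N + 1) z + c * ∑ r, |(τ r : ℝ) - τ0 r| - A' ≤
              energy (p + 1) (N + 1) (arf φ' (fun t => e t - u t))) := by
  obtain ⟨c₀, hc₀, L, hL⟩ := exists_regressor_bounds hT φ ψ Ψ hΨ hinv hσ
  obtain ⟨CE, hCE, η₂, hη₂, L', hL'⟩ := exists_energy_le_energy_arf_of_near hT φ ψ Ψ hΨ hinv
  obtain ⟨C, hC, hfine⟩ := exists_abs_sum_noise_lag_le (p := p) hT K m hκ hκ1 hD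
  obtain ⟨η₀, hη₀⟩ : ∃ x : ℝ, x = min η₁ η₂ := ⟨_, rfl⟩
  have hη₀0 : 0 < η₀ := by rw [hη₀]; positivity
  -- In the coarse case the regressor energy is at least `c₄ * N`: either from the error in the
  -- coefficients, or, when these are close, from the mean error, which loses at most the factor
  -- `CE` under the filter.
  obtain ⟨c₄, hc₄⟩ : ∃ x : ℝ, x = c₀ * min η₀ (κ₁ / CE) := ⟨_, rfl⟩
  have hc₄0 : 0 < c₄ := by rw [hc₄]; positivity
  -- A bound for `1 + ∑ |φ' j|` over the coefficients within `η₀`, from `|x| ≤ 1 + x ^ 2`.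
  obtain ⟨M, hM⟩ : ∃ x : ℝ, x = 1 + ∑ j, |φ j| + (p + η₀) := ⟨_, rfl⟩
  have hM0 : 0 < M := by rw [hM]; positivity
  obtain ⟨ε₁, hε₁, hreg⟩ := hL K (c₄ / 16) (by positivity)
  -- The second bound makes the cross term with the mean error take at most half of its energy; the
  -- other half pays for the distances of the changepoints.
  obtain ⟨ε₀, hε₀⟩ : ∃ x : ℝ, x = min ε₁ (c₀ / (4 * CE * M * C * (1 + Ck))) := ⟨_, rfl⟩
  have hε₀0 : 0 < ε₀ := by rw [hε₀]; positivity
  obtain ⟨c, hc⟩ : ∃ x : ℝ, x = min (c₄ / 2) (c₀ / (2 * CE * Ck)) := ⟨_, rfl⟩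
  have hc0 : 0 < c := by rw [hc]; positivity
  refine ⟨η₀, hη₀0, hη₀ ▸ min_le_left _ _, c, hc0, ε₀, hε₀0, fun A hA => ?_⟩
  obtain ⟨A₁, hA₁, N₁, hN₁⟩ := hfine ε₀ A hε₀0 hA
  obtain ⟨N₂, hN₂⟩ := hreg A hA
  obtain ⟨A', hA'⟩ : ∃ x : ℝ, x = 2 * (p * A ^ 2) / c₀ + 2 * M * A₁ + 2 * M * C * ε₀ * Ck +
    c₀ / (2 * CE) := ⟨_, rfl⟩
  have hA'0 : 0 ≤ A' := by rw [hA']; positivity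
  obtain ⟨N₃, hN₃⟩ := eventually_atTop.1 ((tendsto_natCast_atTop_atTop.eventually_ge_atTop
    ((L + L' + 1 : ℕ) / κ : ℝ)).and (eventually_ge_atTop (L' + 1)))
  refine ⟨A', hA'0, max N₁ (max N₂ N₃), fun N hN qs z e hG φ' u B hBK hB hu => ?_⟩
  simp only [ge_iff_le, max_le_iff] at hN
  obtain ⟨hκN, hL'N⟩ := hN₃ N hN.2.2
  rw [div_le_iff₀ hκ, mul_comm (N : ℝ)] at hκN
  have hBL : ∀ b ∈ B, L + L' + 1 ≤ b := fun b hb => by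
    exact_mod_cast hκN.trans (hB b hb)
  obtain ⟨hw, hzw⟩ := hN₂ N hN.2.1 ε₀ qs z e (hε₀ ▸ min_le_left _ _) hG (fun j => φ' j - φ j)
    (arf φ' u) B hBK (fun b hb => by have := hBL b hb; omega)
    (by have := hu.arf φ'; rwa [add_comm 1 p] at this)
  rw [hG.energy_residual_eq φ' u]
  set w : ℕ → ℝ := fun t => ∑ j : Fin p, (φ' j - φ j) * e (t - ((j : ℕ) + 1)) + arf φ' u t with hwdef
  set S : ℝ := ∑ j, (φ' j - φ j) ^ 2 with hS
  set Eg := energy (p + 1) (N + 1) (arf φ' u)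
  set Eu := energy 1 (N + 1) u
  set Ew := energy (p + 1) (N + 1) w
  set X := ∑ t ∈ Finset.Ico (p + 1) (N + 1), z t * w t with hX
  have hS0 : 0 ≤ S := Finset.sum_nonneg fun _ _ => sq_nonneg _
  have hEg0 : 0 ≤ Eg := energy_nonneg _ _ _
  have hEu0 : 0 ≤ Eu := energy_nonneg _ _ _
  have hEw0 : 0 ≤ Ew := energy_nonneg _ _ _
  have hN0 : (0 : ℝ) ≤ N := Nat.cast_nonneg N
  have hnear : S ≤ η₀ → Eu ≤ CE * Eg := by
    intro hS
    have := hL' 1 (N + 1) u φ' (hS.trans (hη₀ ▸ min_le_right _ _)) (by omega)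
      (fun t ht htL => by
        by_contra hne
        obtain ⟨b, hb, hbt, -⟩ := hu t ht (by omega) hne
        have := hBL b hb
        omega)
    rwa [add_comm 1 p] at this
  constructor
  · intro hfar
    have hEw : c₄ * N ≤ Ew := by
      refine le_trans ?_ hw
      rw [hc₄, mul_assoc]
      refine mul_le_mul_of_nonneg_left ?_ hc₀.le
      rcases lt_or_ge η₀ S with h | h
      · have h1 : min η₀ (κ₁ / CE) * N ≤ η₀ * N := mul_le_mul_of_nonneg_right (min_le_left _ _) hN0
        have h2 : η₀ * N ≤ S * N := mul_le_mul_of_nonneg_right h.le hN0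
        linarith
      · have h1 : min η₀ (κ₁ / CE) * N ≤ κ₁ / CE * N :=
          mul_le_mul_of_nonneg_right (min_le_right _ _) hN0
        have h2 := hnear h
        have h3 : κ₁ * N ≤ Eu := hfar.resolve_left (not_lt.2 h)
        have h4 : κ₁ / CE * N ≤ Eg := by
          rw [div_mul_eq_mul_div, div_le_iff₀ hCE]; linarith
        linarith [mul_nonneg hN0 hS0]
    -- The cross term `2 * X` is then at most half of `Ew`, and the other half exceeds `c * N`.
    have h1 : X ^ 2 ≤ (Ew / 4) ^ 2 := by
      refine hzw.trans ?_
      calc c₄ / 16 * N * Ew = (c₄ * N) * Ew / 16 := by ring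
        _ ≤ Ew * Ew / 16 := by gcongr
        _ = _ := by ring
    have h2 := (abs_le_of_sq_le_sq' h1 (by positivity)).2
    have h3 : c * N ≤ c₄ / 2 * N := mul_le_mul_of_nonneg_right (hc ▸ min_le_left _ _) hN0
    linarith
  · intro hS' τ τ0 hdec hk
    set k := ∑ r, |(τ r : ℝ) - τ0 r| with hkdef
    have hk0 : 0 ≤ k := Finset.sum_nonneg fun _ _ => abs_nonneg _
    have hEu := hnear hS'
    have hY : |∑ t ∈ Finset.Ico (p + 1) (N + 1), z t * arf φ' u t| ≤
        M * (C * ε₀ * (Eu + k) + A₁) := by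
      refine (abs_sum_mul_arf_le φ' z u _ (hN₁ N hN.1 φ σ2 qs z e hG u τ τ0 hdec)).trans ?_
      refine mul_le_mul_of_nonneg_right ?_ (by positivity)
      have h1 : ∑ j, |φ' j| ≤ ∑ j, (|φ j| + (1 + (φ' j - φ j) ^ 2)) := by
        refine Finset.sum_le_sum fun j _ => ?_
        have h2 : |φ' j| ≤ |φ j| + |φ' j - φ j| := by
          have := abs_add_le (φ j) (φ' j - φ j)
          rwa [add_sub_cancel] at this
        have h3 : |φ' j - φ j| ≤ 1 + (φ' j - φ j) ^ 2 := by
          rw [← sq_abs (φ' j - φ j)]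
          nlinarith [sq_nonneg (|φ' j - φ j| - 1), abs_nonneg (φ' j - φ j)]
        linarith
      rw [Finset.sum_add_distrib, Finset.sum_add_distrib, Finset.sum_const, Finset.card_univ,
        Fintype.card_fin, nsmul_eq_mul, mul_one] at h1
      rw [hM]
      linarith
    have hX1 := hG.sq_sum_noise_lag_error_le (fun j => φ' j - φ j)
    set X₁ := ∑ t ∈ Finset.Ico (p + 1) (N + 1),
      z t * ∑ j : Fin p, (φ' j - φ j) * e (t - ((j : ℕ) + 1)) with hX₁
    set Y := ∑ t ∈ Finset.Ico (p + 1) (N + 1), z t * arf φ' u t with hYdef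
    have hsplit : X = X₁ + Y := by
      rw [hX, hX₁, hYdef, ← Finset.sum_add_distrib]
      exact Finset.sum_congr rfl fun t _ => by simp only [hwdef]; ring
    -- The lagged errors are correlated with the noise at order `√N` only, so half of `c₀ * N * S`
    -- absorbs this term up to a constant.
    have hX2 : 2 * |X₁| ≤ c₀ / 2 * (N * S + p * A ^ 2 / (c₀ / 2) ^ 2) := by
      refine two_mul_abs_le_of_sq_le (by positivity) (by positivity) (by positivity) ?_
      refine hX1.trans (le_of_eq ?_)
      simp only [hS]
      field_simp
    have hX3 : c₀ / 2 * (p * A ^ 2 / (c₀ / 2) ^ 2) = 2 * (p * A ^ 2) / c₀ := by field_simp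
    have hEg : c₀ / CE * Eu ≤ c₀ * Eg := by
      rw [div_mul_eq_mul_div, div_le_iff₀ hCE]
      linarith [mul_le_mul_of_nonneg_left hEu hc₀.le]
    have hεle : 4 * CE * M * C * (1 + Ck) * ε₀ ≤ c₀ := by
      have h1 : ε₀ ≤ c₀ / (4 * CE * M * C * (1 + Ck)) := hε₀ ▸ min_le_right _ _
      rw [le_div_iff₀ (by positivity)] at h1
      linarith
    have h5 : 2 * M * C * ε₀ * (1 + Ck) * Eu ≤ c₀ / (2 * CE) * Eu := by
      refine mul_le_mul_of_nonneg_right ?_ hEu0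
      rw [le_div_iff₀ (by positivity)]
      linarith
    have h6 : 2 * M * C * ε₀ * k ≤ 2 * M * C * ε₀ * (Ck * (Eu + 1)) :=
      mul_le_mul_of_nonneg_left hk (by positivity)
    have h7 : c * k ≤ c₀ / (2 * CE) * (Eu + 1) := by
      calc c * k ≤ c₀ / (2 * CE * Ck) * (Ck * (Eu + 1)) :=
            mul_le_mul (hc ▸ min_le_right _ _) hk hk0 (by positivity)
        _ = _ := by field_simp
    have h8 : c₀ / CE * Eu = 2 * (c₀ / (2 * CE) * Eu) := by field_simp
    have h9 := le_abs_self X₁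
    have h10 := le_abs_self Y
    have h11 : 0 ≤ c₀ * (N * S) := by positivity
    rw [hsplit, hA']
    rw [mul_add] at hX2
    linarith

/-! ### Ridge regression and the profile quadratic form -/

section Ridge

variable {n k m : ℕ} (X : Fin n → ℝ) (A : Matrix (Fin n) (Fin k) ℝ) (D : Matrix (Fin n) (Fin m) ℝ)
  (ν : ℝ)

/-- The penalised Gram matrix `D'D + I / ν`. -/
noncomputable def ridgeGram : Matrix (Fin m) (Fin m) ℝ :=
  Dᵀ * D + (1 / ν) • (1 : Matrix (Fin m) (Fin m) ℝ)

/-- The residual matrix `I - D (D'D + I / ν)⁻¹ D'` of ridge regression. -/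
noncomputable def ridgeResid : Matrix (Fin n) (Fin n) ℝ := 1 - D * (ridgeGram D ν)⁻¹ * Dᵀ

lemma ridgeGram_isSymm : (ridgeGram D ν)ᵀ = ridgeGram D ν := by
  simp [ridgeGram, Matrix.transpose_add, Matrix.transpose_mul]

lemma ridgeResid_isSymm : (ridgeResid D ν)ᵀ = ridgeResid D ν := by
  simp only [ridgeResid, Matrix.transpose_sub, Matrix.transpose_one, Matrix.transpose_mul,
    Matrix.transpose_transpose, Matrix.transpose_nonsing_inv, ridgeGram_isSymm, Matrix.mul_assoc]

lemma dotProduct_ridgeGram_mulVec (x : Fin m → ℝ) :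
    x ⬝ᵥ (ridgeGram D ν *ᵥ x) = (D *ᵥ x) ⬝ᵥ (D *ᵥ x) + 1 / ν * (x ⬝ᵥ x) := by
  rw [ridgeGram, Matrix.add_mulVec, dotProduct_add, Matrix.smul_mulVec, Matrix.one_mulVec,
    dotProduct_smul, smul_eq_mul, ← Matrix.mulVec_mulVec, Matrix.dotProduct_mulVec x Dᵀ,
    Matrix.vecMul_transpose]

lemma dotProduct_self_nonneg' {ι : Type*} [Fintype ι] (x : ι → ℝ) : 0 ≤ x ⬝ᵥ x :=
  Finset.sum_nonneg fun _ _ => mul_self_nonneg _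

variable {ν}

/-- The determinant is the product of the eigenvalues, and each eigenvalue is the value of the
quadratic form at a unit eigenvector. -/
lemma pow_le_det_of_le {M : Matrix (Fin m) (Fin m) ℝ} (hM : Mᵀ = M) {c : ℝ} (hc : 0 ≤ c)
    (h : ∀ x, c * (x ⬝ᵥ x) ≤ x ⬝ᵥ (M *ᵥ x)) : c ^ m ≤ M.det := by
  have hH : M.IsHermitian := by
    rw [Matrix.IsHermitian, Matrix.conjTranspose_eq_transpose_of_trivial, hM]
  rw [hH.det_eq_prod_eigenvalues]
  calc c ^ m = ∏ _i : Fin m, c := by simp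
    _ ≤ ∏ i, hH.eigenvalues i := Finset.prod_le_prod (fun _ _ => hc) fun i _ => ?_
  rw [hH.eigenvalues_eq]
  simp only [star_trivial, RCLike.re_to_real]
  refine le_trans (le_of_eq ?_) (h _)
  have h1 : (hH.eigenvectorBasis i).ofLp ⬝ᵥ (hH.eigenvectorBasis i).ofLp = 1 := by
    have h2 := hH.eigenvectorBasis.orthonormal.1 i
    have h3 := EuclideanSpace.real_norm_sq_eq (hH.eigenvectorBasis i)
    rw [h2] at h3
    simp only [dotProduct, ← sq]
    linarith
  rw [h1, mul_one]

lemma ridgeGram_det_pos (hν : 0 < ν) : 0 < (ridgeGram D ν).det := by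
  have := pow_le_det_of_le (ridgeGram_isSymm D ν) (c := 1 / ν) (by positivity) fun x => by
    rw [dotProduct_ridgeGram_mulVec]
    linarith [dotProduct_self_nonneg' (D *ᵥ x)]
  exact lt_of_lt_of_le (by positivity) this

lemma ridgeGram_mulVec_inv (hν : 0 < ν) (x : Fin m → ℝ) :
    ridgeGram D ν *ᵥ ((ridgeGram D ν)⁻¹ *ᵥ x) = x := by
  rw [Matrix.mulVec_mulVec, Matrix.mul_nonsing_inv _ (ridgeGram_det_pos D hν).ne'.isUnit,
    Matrix.one_mulVec]

/-- Completing the square around the ridge estimate. -/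
lemma ridge_objective_eq (hν : 0 < ν) (y : Fin n → ℝ) (μ : Fin m → ℝ) :
    (y - D *ᵥ μ) ⬝ᵥ (y - D *ᵥ μ) + 1 / ν * (μ ⬝ᵥ μ) = y ⬝ᵥ (ridgeResid D ν *ᵥ y) +
      (μ - (ridgeGram D ν)⁻¹ *ᵥ (Dᵀ *ᵥ y)) ⬝ᵥ
        (ridgeGram D ν *ᵥ (μ - (ridgeGram D ν)⁻¹ *ᵥ (Dᵀ *ᵥ y))) := by
  set μ₀ := (ridgeGram D ν)⁻¹ *ᵥ (Dᵀ *ᵥ y) with hμ₀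
  have h1 : ridgeGram D ν *ᵥ μ₀ = Dᵀ *ᵥ y := ridgeGram_mulVec_inv D hν _
  have h2 : y ⬝ᵥ (ridgeResid D ν *ᵥ y) = y ⬝ᵥ y - (Dᵀ *ᵥ y) ⬝ᵥ μ₀ := by
    rw [ridgeResid, Matrix.sub_mulVec, Matrix.one_mulVec, dotProduct_sub, Matrix.mul_assoc,
      ← Matrix.mulVec_mulVec, ← Matrix.mulVec_mulVec, Matrix.dotProduct_mulVec y D, hμ₀,
      Matrix.mulVec_transpose]
  have h3 : μ₀ ⬝ᵥ (ridgeGram D ν *ᵥ μ) = μ ⬝ᵥ (Dᵀ *ᵥ y) := by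
    rw [Matrix.dotProduct_mulVec, ← Matrix.mulVec_transpose, ridgeGram_isSymm, h1, dotProduct_comm]
  have h4 : y ⬝ᵥ (D *ᵥ μ) = μ ⬝ᵥ (Dᵀ *ᵥ y) := by
    rw [Matrix.dotProduct_mulVec, ← Matrix.mulVec_transpose, dotProduct_comm]
  have h5 := dotProduct_ridgeGram_mulVec D ν μ
  rw [h2, Matrix.mulVec_sub, h1]
  simp only [sub_dotProduct, dotProduct_sub]
  rw [h3, h5, dotProduct_comm (D *ᵥ μ) y, h4, dotProduct_comm μ₀ (Dᵀ *ᵥ y)]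
  ring

lemma dotProduct_ridgeGram_nonneg (hν : 0 < ν) (x : Fin m → ℝ) :
    0 ≤ x ⬝ᵥ (ridgeGram D ν *ᵥ x) := by
  rw [dotProduct_ridgeGram_mulVec]
  have := dotProduct_self_nonneg' (D *ᵥ x)
  have := dotProduct_self_nonneg' x
  positivity

lemma ridgeResid_le_objective (hν : 0 < ν) (y : Fin n → ℝ) (μ : Fin m → ℝ) :
    y ⬝ᵥ (ridgeResid D ν *ᵥ y) ≤ (y - D *ᵥ μ) ⬝ᵥ (y - D *ᵥ μ) + 1 / ν * (μ ⬝ᵥ μ) := by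
  rw [ridge_objective_eq D hν]
  linarith [dotProduct_ridgeGram_nonneg D hν (μ - (ridgeGram D ν)⁻¹ *ᵥ (Dᵀ *ᵥ y))]

lemma exists_objective_eq_ridgeResid (hν : 0 < ν) (y : Fin n → ℝ) :
    ∃ μ : Fin m → ℝ, (y - D *ᵥ μ) ⬝ᵥ (y - D *ᵥ μ) + 1 / ν * (μ ⬝ᵥ μ) =
      y ⬝ᵥ (ridgeResid D ν *ᵥ y) := by
  refine ⟨(ridgeGram D ν)⁻¹ *ᵥ (Dᵀ *ᵥ y), ?_⟩
  rw [ridge_objective_eq D hν, sub_self, zero_dotProduct, add_zero]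

lemma ridgeResid_nonneg (hν : 0 < ν) (y : Fin n → ℝ) : 0 ≤ y ⬝ᵥ (ridgeResid D ν *ᵥ y) := by
  obtain ⟨μ, hμ⟩ := exists_objective_eq_ridgeResid D hν y
  rw [← hμ]
  have := dotProduct_self_nonneg' (y - D *ᵥ μ)
  have := dotProduct_self_nonneg' μ
  positivity

/-- The profile quadratic form `X'{B - BA(A'BA)⁻¹A'B}X`. -/
noncomputable def profileForm (ν : ℝ) : ℝ :=
  X ⬝ᵥ ((ridgeResid D ν - ridgeResid D ν * A * (Aᵀ * ridgeResid D ν * A)⁻¹ * Aᵀ * ridgeResid D ν)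
    *ᵥ X)

lemma dotProduct_gram_mulVec (s s' : Fin k → ℝ) :
    s ⬝ᵥ ((Aᵀ * ridgeResid D ν * A) *ᵥ s') = (A *ᵥ s) ⬝ᵥ (ridgeResid D ν *ᵥ (A *ᵥ s')) := by
  rw [← Matrix.mulVec_mulVec, ← Matrix.mulVec_mulVec, Matrix.dotProduct_mulVec s Aᵀ,
    Matrix.vecMul_transpose]

lemma gram_isSymm : (Aᵀ * ridgeResid D ν * A)ᵀ = Aᵀ * ridgeResid D ν * A := by
  simp only [Matrix.transpose_mul, Matrix.transpose_transpose, ridgeResid_isSymm, Matrix.mul_assoc]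

lemma resid_quadratic_eq (s : Fin k → ℝ) :
    (X - A *ᵥ s) ⬝ᵥ (ridgeResid D ν *ᵥ (X - A *ᵥ s)) = X ⬝ᵥ (ridgeResid D ν *ᵥ X) -
      2 * (s ⬝ᵥ (Aᵀ *ᵥ (ridgeResid D ν *ᵥ X))) + s ⬝ᵥ ((Aᵀ * ridgeResid D ν * A) *ᵥ s) := by
  have h1 : s ⬝ᵥ (Aᵀ *ᵥ (ridgeResid D ν *ᵥ X)) = (A *ᵥ s) ⬝ᵥ (ridgeResid D ν *ᵥ X) := by
    rw [Matrix.dotProduct_mulVec s Aᵀ, Matrix.vecMul_transpose]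
  have h2 : X ⬝ᵥ (ridgeResid D ν *ᵥ (A *ᵥ s)) = (A *ᵥ s) ⬝ᵥ (ridgeResid D ν *ᵥ X) := by
    rw [Matrix.dotProduct_mulVec, ← Matrix.mulVec_transpose, ridgeResid_isSymm, dotProduct_comm]
  rw [dotProduct_gram_mulVec, h1, Matrix.mulVec_sub]
  simp only [sub_dotProduct, dotProduct_sub]
  rw [h2]; ring

lemma profileForm_eq_sub : profileForm X A D ν = X ⬝ᵥ (ridgeResid D ν *ᵥ X) -
    ((Aᵀ * ridgeResid D ν * A)⁻¹ *ᵥ (Aᵀ *ᵥ (ridgeResid D ν *ᵥ X))) ⬝ᵥ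
      (Aᵀ *ᵥ (ridgeResid D ν *ᵥ X)) := by
  rw [profileForm, Matrix.sub_mulVec, dotProduct_sub]
  congr 1
  simp only [Matrix.mul_assoc]
  rw [← Matrix.mulVec_mulVec, Matrix.dotProduct_mulVec X, ← Matrix.mulVec_transpose,
    ridgeResid_isSymm, ← Matrix.mulVec_mulVec, Matrix.dotProduct_mulVec _ A,
    ← Matrix.mulVec_transpose A, dotProduct_comm]
  simp only [← Matrix.mulVec_mulVec]

/-- For lower bounds it is enough that the form is the penalised residual sum of squares at some
parameters. This survives a singular `A'BA`: the inverse is then zero by convention, and `s = 0`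
serves. -/
lemma exists_profileForm_eq (hν : 0 < ν) : ∃ (s : Fin k → ℝ) (μ : Fin m → ℝ), profileForm X A D ν =
    (X - A *ᵥ s - D *ᵥ μ) ⬝ᵥ (X - A *ᵥ s - D *ᵥ μ) + 1 / ν * (μ ⬝ᵥ μ) := by
  set s := (Aᵀ * ridgeResid D ν * A)⁻¹ *ᵥ (Aᵀ *ᵥ (ridgeResid D ν *ᵥ X)) with hs
  obtain ⟨μ, hμ⟩ := exists_objective_eq_ridgeResid D hν (X - A *ᵥ s)
  refine ⟨s, μ, ?_⟩
  rw [hμ, resid_quadratic_eq, profileForm_eq_sub, ← hs]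
  by_cases hdet : IsUnit (Aᵀ * ridgeResid D ν * A).det
  · have h1 : (Aᵀ * ridgeResid D ν * A) *ᵥ s = Aᵀ *ᵥ (ridgeResid D ν *ᵥ X) := by
      rw [hs, Matrix.mulVec_mulVec, Matrix.mul_nonsing_inv _ hdet, Matrix.one_mulVec]
    rw [h1]; ring
  · have h1 : s = 0 := by
      rw [hs, Matrix.nonsing_inv_apply_not_isUnit _ hdet, Matrix.zero_mulVec]
    rw [h1]; simp

/-- If `A'BA` kills `v`, the penalised residual sum of squares of `A v` on `D` vanishes for some
`μ`; the penalty forces `μ = 0`, and then `A v = 0`. So an injective `A` makes `A'BA` invertible,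
and the profile form is the minimum. -/
lemma profileForm_le (hν : 0 < ν) (hA : ∀ s, A *ᵥ s = 0 → s = 0) (s : Fin k → ℝ) (μ : Fin m → ℝ) :
    profileForm X A D ν ≤
      (X - A *ᵥ s - D *ᵥ μ) ⬝ᵥ (X - A *ᵥ s - D *ᵥ μ) + 1 / ν * (μ ⬝ᵥ μ) := by
  have hdet : IsUnit (Aᵀ * ridgeResid D ν * A).det := by
    rw [isUnit_iff_ne_zero]
    intro h0
    obtain ⟨v, hv, hv0⟩ := Matrix.exists_mulVec_eq_zero_iff.2 h0
    have h1 := dotProduct_gram_mulVec A D (ν := ν) v v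
    rw [hv0, dotProduct_zero] at h1
    obtain ⟨μ, hμ⟩ := exists_objective_eq_ridgeResid D hν (A *ᵥ v)
    rw [← h1] at hμ
    have h2 := dotProduct_self_nonneg' (A *ᵥ v - D *ᵥ μ)
    have h3 := dotProduct_self_nonneg' μ
    have h4 : 0 < 1 / ν := by positivity
    have h5 : μ ⬝ᵥ μ = 0 := by nlinarith
    rw [h5, mul_zero, add_zero] at hμ
    rw [dotProduct_self_eq_zero] at h5 hμ
    rw [h5, Matrix.mulVec_zero, sub_zero] at hμ
    exact hv (hA v hμ)
  refine le_trans ?_ (ridgeResid_le_objective D hν (X - A *ᵥ s) μ)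
  set s₀ := (Aᵀ * ridgeResid D ν * A)⁻¹ *ᵥ (Aᵀ *ᵥ (ridgeResid D ν *ᵥ X)) with hs₀
  have h1 : (Aᵀ * ridgeResid D ν * A) *ᵥ s₀ = Aᵀ *ᵥ (ridgeResid D ν *ᵥ X) := by
    rw [hs₀, Matrix.mulVec_mulVec, Matrix.mul_nonsing_inv _ hdet, Matrix.one_mulVec]
  have h2 : 0 ≤ (s - s₀) ⬝ᵥ ((Aᵀ * ridgeResid D ν * A) *ᵥ (s - s₀)) := by
    rw [dotProduct_gram_mulVec]; exact ridgeResid_nonneg D hν _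
  have h3 : s₀ ⬝ᵥ ((Aᵀ * ridgeResid D ν * A) *ᵥ s) = s ⬝ᵥ (Aᵀ *ᵥ (ridgeResid D ν *ᵥ X)) := by
    rw [Matrix.dotProduct_mulVec, ← Matrix.mulVec_transpose, gram_isSymm, h1, dotProduct_comm]
  rw [Matrix.mulVec_sub, h1] at h2
  simp only [sub_dotProduct, dotProduct_sub] at h2
  rw [h3] at h2
  rw [resid_quadratic_eq, profileForm_eq_sub, ← hs₀]
  linarith

end Ridge

/-! ### Configurations and piecewise periodic mean functions -/

section Config

lemma add_le_of_gap {n : ℕ} {f : Fin (n + 1) → ℝ} {d : ℝ} (hd : 0 ≤ d)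
    (h : ∀ i : Fin n, d ≤ f i.succ - f i.castSucc) {i j : Fin (n + 1)} (hij : i < j) :
    f i + d ≤ f j := by
  have hmono : Monotone f := Fin.monotone_iff_le_succ.2 fun i => by linarith [h i]
  obtain ⟨i', rfl⟩ : ∃ i' : Fin n, i = i'.castSucc :=
    ⟨⟨i, by have := j.is_lt; have : (i : ℕ) < j := hij; omega⟩, rfl⟩
  have h1 : f i'.succ ≤ f j := hmono (by
    rw [Fin.le_iff_val_le_val, Fin.val_succ]
    have : (i'.castSucc : ℕ) < j := hij
    simpa using this)
  linarith [h i']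

lemma RelConfig.ext_zero (c : RelConfig) : c.ext 0 = 0 := rfl

lemma RelConfig.ext_last (c : RelConfig) : c.ext (Fin.last (c.m + 1)) = 1 := by
  rw [RelConfig.ext, ← Fin.succ_last, Fin.cons_succ, Fin.snoc_last]

lemma RelConfig.ext_loc (c : RelConfig) (r : Fin c.m) : c.ext r.castSucc.succ = c.loc r := by
  rw [RelConfig.ext, Fin.cons_succ, Fin.snoc_castSucc]

/-- The locations are at distance at least `d` from each other and from the edges. -/
def RelConfig.Separated (c : RelConfig) (d : ℝ) : Prop :=
  (∀ r, d ≤ c.loc r) ∧ (∀ r, c.loc r + d ≤ 1) ∧ ∀ r r', r < r' → c.loc r + d ≤ c.loc r'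

lemma separated_of_gap {c : RelConfig} {d : ℝ} (hd : 0 < d)
    (h : ∀ r : Fin (c.m + 1), d ≤ c.ext r.succ - c.ext r.castSucc) : c.Separated d := by
  refine ⟨fun r => ?_, fun r => ?_, fun r r' hr => ?_⟩
  · have := add_le_of_gap hd.le h (i := 0) (j := r.castSucc.succ) (Fin.succ_pos _)
    rwa [c.ext_zero, c.ext_loc, zero_add] at this
  · have := add_le_of_gap hd.le h (i := r.castSucc.succ) (j := Fin.last _) (by
      rw [Fin.lt_def]; simp)
    rwa [c.ext_last, c.ext_loc] at this
  · have := add_le_of_gap hd.le h (i := r.castSucc.succ) (j := r'.castSucc.succ) (by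
      rw [Fin.lt_def] at hr ⊢; simpa using hr)
    rwa [c.ext_loc, c.ext_loc] at this

lemma RelConfig.tau_le (c : RelConfig) {N : ℕ} {r : Fin c.m} (h : 0 ≤ c.loc r) :
    (c.tau N r : ℝ) ≤ c.loc r * N := Nat.floor_le (by positivity)

lemma RelConfig.lt_tau_add_one (c : RelConfig) (N : ℕ) (r : Fin c.m) :
    c.loc r * N < c.tau N r + 1 := Nat.lt_floor_add_one _

namespace RelConfig.Separated

variable {c : RelConfig} {d : ℝ} {N : ℕ}

lemma tau_ge (h : c.Separated d) (hN : 2 ≤ d * N) (r : Fin c.m) : d / 2 * N ≤ c.tau N r := by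
  have h1 := c.lt_tau_add_one N r
  have h2 := mul_le_mul_of_nonneg_right (h.1 r) (Nat.cast_nonneg (α := ℝ) N)
  linarith

lemma tau_add_le (h : c.Separated d) (hd : 0 < d) (r : Fin c.m) : c.tau N r + d * N ≤ N := by
  have h1 := c.tau_le (N := N) (hd.le.trans (h.1 r))
  have h2 := mul_le_mul_of_nonneg_right (h.2.1 r) (Nat.cast_nonneg (α := ℝ) N)
  linarith

lemma tau_add_le_tau (h : c.Separated d) (hd : 0 < d) (hN : 2 ≤ d * N) {r r' : Fin c.m}
    (hr : r < r') : c.tau N r + d / 2 * N ≤ c.tau N r' := by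
  have h1 := c.tau_le (N := N) (hd.le.trans (h.1 r))
  have h2 := mul_le_mul_of_nonneg_right (h.2.2 r r' hr) (Nat.cast_nonneg (α := ℝ) N)
  have h3 := c.lt_tau_add_one N r'
  linarith

lemma tau_lt_tau (h : c.Separated d) (hd : 0 < d) (hN : 2 ≤ d * N) {r r' : Fin c.m}
    (hr : r < r') : c.tau N r < c.tau N r' := by
  have h1 := h.tau_add_le_tau hd hN hr
  have : (c.tau N r : ℝ) < c.tau N r' := by linarith
  exact_mod_cast this

end RelConfig.Separated

/-- An initial segment is determined by its cardinality. This translates the regime, defined as a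
count, into the position of `t` among the changepoint times. -/
lemma mem_iff_lt_card_of_lower {m : ℕ} (S : Finset (Fin m))
    (hS : ∀ r ∈ S, ∀ r' < r, r' ∈ S) (r : Fin m) : r ∈ S ↔ (r : ℕ) < S.card := by
  constructor
  · intro hr
    have h1 : Finset.Iic r ⊆ S := fun r' hr' => by
      rw [Finset.mem_Iic] at hr'
      rcases hr'.eq_or_lt with rfl | h
      · exact hr
      · exact hS r hr r' h
    have h2 := Finset.card_le_card h1
    rw [Fin.card_Iic] at h2
    omega
  · intro hlt
    by_contra hr
    have h1 : S ⊆ Finset.Iio r := fun r' hr' => by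
      rw [Finset.mem_Iio]
      by_contra hle
      rcases (not_lt.1 hle).eq_or_lt with h | h
      · exact hr (h ▸ hr')
      · exact hr (hS r' hr' r h)
    have h2 := Finset.card_le_card h1
    rw [Fin.card_Iio] at h2
    omega

lemma RelConfig.regime_congr (c : RelConfig) {N t t' : ℕ}
    (h : ∀ r, c.tau N r ≤ t ↔ c.tau N r ≤ t') : c.regime N t = c.regime N t' := by
  simp only [RelConfig.regime, h]

lemma regimeCol_congr (c : RelConfig) {N t t' : ℕ}
    (h : ∀ r, c.tau N r ≤ t ↔ c.tau N r ≤ t') (r : Fin c.m) :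
    regimeCol c N r t = regimeCol c N r t' := by
  simp only [regimeCol, c.regime_congr h]

/-- The mean of regime `regime N t` as a sum of jumps. -/
lemma mu_regime_eq (c : RelConfig) {d : ℝ} {N : ℕ} (hc : c.Separated d) (hd : 0 < d)
    (hN : 2 ≤ d * N) (mu : Fin (c.m + 1) → ℝ) (t : ℕ) :
    mu (c.regime N t) = mu 0 + ∑ r : Fin c.m, (mu r.succ - mu r.castSucc) *
      (if c.tau N r ≤ t then 1 else 0) := by
  set S := Finset.univ.filter fun r : Fin c.m => c.tau N r ≤ t with hS
  have hmem : ∀ r : Fin c.m, c.tau N r ≤ t ↔ (r : ℕ) < S.card := by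
    intro r
    rw [← mem_iff_lt_card_of_lower S (fun r hr r' hr' => ?_) r]
    · simp [hS]
    · simp only [hS, Finset.mem_filter, Finset.mem_univ, true_and] at hr ⊢
      exact (hc.tau_lt_tau hd hN hr').le.trans hr
  have hcard : S.card ≤ c.m := by
    have := Finset.card_le_univ S
    rwa [Fintype.card_fin] at this
  set f : ℕ → ℝ := fun i => if h : i < c.m + 1 then mu ⟨i, h⟩ else 0 with hf
  have hreg : mu (c.regime N t) = f S.card := by
    simp only [hf, dif_pos (show S.card < c.m + 1 by omega)]; rfl
  have h0 : mu 0 = f 0 := by simp [hf]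
  have hterm : ∀ r : Fin c.m, (mu r.succ - mu r.castSucc) * (if c.tau N r ≤ t then 1 else 0) =
      (fun i => if i < S.card then f (i + 1) - f i else 0) (r : ℕ) := by
    intro r
    have h1 : f (r + 1) = mu r.succ := by
      simp only [hf, dif_pos (show (r : ℕ) + 1 < c.m + 1 by omega)]; rfl
    have h2 : f r = mu r.castSucc := by
      simp only [hf, dif_pos (show (r : ℕ) < c.m + 1 by omega)]; rfl
    simp only [hmem, h1, h2]
    split_ifs <;> simp
  rw [hreg, h0, Finset.sum_congr rfl fun r _ => hterm r,
    Fin.sum_univ_eq_sum_range (fun i => if i < S.card then f (i + 1) - f i else 0) c.m]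
  have h3 : ∑ i ∈ Finset.range c.m, (if i < S.card then f (i + 1) - f i else 0) =
      ∑ i ∈ Finset.range S.card, (f (i + 1) - f i) := by
    symm
    rw [← Finset.sum_subset (Finset.range_mono hcard)]
    · exact Finset.sum_congr rfl fun i hi => by rw [if_pos (Finset.mem_range.1 hi)]
    · intro i _ hi
      rw [if_neg (fun h => hi (Finset.mem_range.2 h))]
  rw [h3, Finset.sum_range_sub]
  ring

lemma mu_regime_eq_sum_regimeCol (c : RelConfig) (N : ℕ) (mu : Fin (c.m + 1) → ℝ) (h0 : mu 0 = 0)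
    (t : ℕ) : mu (c.regime N t) = ∑ r : Fin c.m, mu r.succ * regimeCol c N r t := by
  simp only [regimeCol, mul_ite, mul_one, mul_zero]
  rcases Fin.eq_zero_or_eq_succ (c.regime N t) with h | ⟨r, h⟩
  · rw [h, h0, Finset.sum_eq_zero]
    intro r _
    rw [if_neg (Fin.succ_ne_zero r).symm]
  · rw [h]
    simp [Fin.succ_inj]

/-- A mean function with seasonal means `s` and the regimes of `c`. -/
noncomputable def fitMean {T : ℕ} (c : RelConfig) (N : ℕ) (s : Fin T → ℝ) (μ : Fin c.m → ℝ)
    (t : ℕ) : ℝ :=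
  ∑ v, s v * seasonCol T v t + ∑ r, μ r * regimeCol c N r t

/-- The true mean function. -/
noncomputable def trueMean {T : ℕ} [NeZero T] (s : Fin T → ℝ) (c : RelConfig)
    (mu : Fin (c.m + 1) → ℝ) (N t : ℕ) : ℝ :=
  s (Fin.ofNat T (t - 1)) + mu (c.regime N t)

lemma sum_seasonCol {T : ℕ} [NeZero T] (s : Fin T → ℝ) (t : ℕ) :
    ∑ v, s v * seasonCol T v t = s (Fin.ofNat T (t - 1)) := by
  have hs : season T t = ((Fin.ofNat T (t - 1) : Fin T) : ℕ) := rfl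
  rw [Finset.sum_eq_single (Fin.ofNat T (t - 1))]
  · rw [seasonCol, if_pos hs, mul_one]
  · intro v _ hv
    rw [seasonCol, if_neg (fun h => hv (Fin.ext (by rw [← h, hs]))), mul_zero]
  · simp

lemma trueMean_eq_fitMean {T : ℕ} [NeZero T] (s : Fin T → ℝ) (c : RelConfig)
    (mu : Fin (c.m + 1) → ℝ) (h0 : mu 0 = 0) (N t : ℕ) :
    trueMean s c mu N t = fitMean c N s (fun r => mu r.succ) t := by
  rw [trueMean, fitMean, sum_seasonCol, mu_regime_eq_sum_regimeCol c N mu h0]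

lemma season_add_mul {T t : ℕ} (ht : 1 ≤ t) (k : ℕ) : season T (t + T * k) = season T t := by
  rw [season, season, show t + T * k - 1 = t - 1 + T * k by omega, Nat.add_mul_mod_self_left]

lemma seasonCol_add_mul {T : ℕ} (v : Fin T) {t : ℕ} (ht : 1 ≤ t) (k : ℕ) :
    seasonCol T v (t + T * k) = seasonCol T v t := by
  simp only [seasonCol, season_add_mul ht]

lemma ofNat_add_mul {T : ℕ} [NeZero T] {t : ℕ} (ht : 1 ≤ t) (k : ℕ) :
    Fin.ofNat T (t + T * k - 1) = Fin.ofNat T (t - 1) :=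
  Fin.ext (season_add_mul ht k)

lemma fitMean_add_mul {T : ℕ} (c : RelConfig) (N : ℕ) (s : Fin T → ℝ) (μ : Fin c.m → ℝ) {t : ℕ}
    (ht : 1 ≤ t) (k : ℕ) (h : ∀ r, c.tau N r ≤ t + T * k → c.tau N r ≤ t) :
    fitMean c N s μ (t + T * k) = fitMean c N s μ t := by
  simp only [fitMean, seasonCol_add_mul _ ht]
  congr 1
  refine Finset.sum_congr rfl fun r _ => ?_
  rw [regimeCol_congr c (t := t + T * k) (t' := t) fun r => ⟨h r, fun h => h.trans (by omega)⟩]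

/-- The changepoint times as a finite set. -/
noncomputable def RelConfig.times (c : RelConfig) (N : ℕ) : Finset ℕ := Finset.univ.image (c.tau N)

lemma RelConfig.card_times_le (c : RelConfig) (N : ℕ) : (c.times N).card ≤ c.m :=
  Finset.card_image_le.trans (by rw [Finset.card_univ, Fintype.card_fin])

lemma RelConfig.mem_times {c : RelConfig} {N b : ℕ} : b ∈ c.times N ↔ ∃ r, c.tau N r = b := by
  simp [RelConfig.times]

/-- Off the points of `B` the function `g` is `T`-periodic as soon as it is unchanged by steps
of length `T` that do not cross a point of `B`. -/
lemma jumpsIn_of_forall {T a N : ℕ} {B : Finset ℕ} {g : ℕ → ℝ}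
    (h : ∀ t, a ≤ t → (∀ b ∈ B, b ≤ t + T → b ≤ t) → g (t + T) = g t) : JumpsIn T T a N B g := by
  intro t ht _ hne
  by_contra hcon
  push Not at hcon
  apply hne
  have h1 := h (t - T) (by omega) fun b hb hbt => by
    have := hcon b hb (by omega)
    omega
  rwa [Nat.sub_add_cancel (by omega)] at h1

lemma fitMean_add_period {T : ℕ} (c : RelConfig) (N : ℕ) (s : Fin T → ℝ) (μ : Fin c.m → ℝ) {t : ℕ}
    (ht : 1 ≤ t) (h : ∀ b ∈ c.times N, b ≤ t + T → b ≤ t) :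
    fitMean c N s μ (t + T) = fitMean c N s μ t := by
  have := fitMean_add_mul c N s μ ht 1 fun r hr =>
    h _ (RelConfig.mem_times.2 ⟨r, rfl⟩) (by simpa using hr)
  simpa using this

variable {T : ℕ} [NeZero T] {d : ℝ} {N : ℕ}

lemma jumpsIn_fitMean_sub_trueMean (c c₀ : RelConfig) (s s₀ : Fin T → ℝ) (μ : Fin c.m → ℝ)
    (mu : Fin (c₀.m + 1) → ℝ) (h0 : mu 0 = 0) :
    JumpsIn T T 1 N (c.times N ∪ c₀.times N)
      (fun t => fitMean c N s μ t - trueMean s₀ c₀ mu N t) := by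
  refine jumpsIn_of_forall fun t ht h => ?_
  simp only [trueMean_eq_fitMean s₀ c₀ mu h0]
  rw [fitMean_add_period c N s μ ht fun b hb => h b (Finset.mem_union_left _ hb),
    fitMean_add_period c₀ N s₀ _ ht fun b hb => h b (Finset.mem_union_right _ hb)]

/-- If no fitted changepoint lies within `k` of a true one, then the error in the mean function
has energy at least proportional to `k`. -/
lemma le_energy_fitMean_sub_trueMean (c c₀ : RelConfig) (hd : 0 < d) (hN : 4 ≤ d * N)
    (hc₀ : c₀.Separated d) (s s₀ : Fin T → ℝ) (μ : Fin c.m → ℝ) (mu : Fin (c₀.m + 1) → ℝ)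
    (r : Fin c₀.m) {k : ℕ} (hk : (k : ℝ) ≤ d / 4 * N)
    (hfar : ∀ j, (k : ℝ) ≤ |(c.tau N j : ℝ) - c₀.tau N r|) :
    (mu r.succ - mu r.castSucc) ^ 2 / 2 * ((k : ℝ) - T) ≤
      energy 1 (N + 1) (fun t => fitMean c N s μ t - trueMean s₀ c₀ mu N t) := by
  have hT : 0 < T := Nat.pos_of_neZero T
  set u := fun t => fitMean c N s μ t - trueMean s₀ c₀ mu N t with hu
  set Δ := mu r.succ - mu r.castSucc with hΔ
  -- A shift by `T * q ≤ k` is a whole number of periods. From the `T * q` times before `τ` it leads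
  -- to the `T * q` times from `τ` on, crossing this true changepoint and no other, true or fitted;
  -- so it changes `u` by exactly the jump `Δ`.
  set q := k / T with hq
  have hqk : T * q ≤ k := Nat.mul_div_le k T
  have hqk' : k < T * q + T := by rw [← Nat.mul_succ]; exact Nat.lt_mul_div_succ k hT
  set τ := c₀.tau N r with hτ
  have hτ1 := hc₀.tau_ge (N := N) (by linarith) r
  have hτ2 := hc₀.tau_add_le (N := N) hd r
  have hkτ : k + 1 ≤ τ := by
    have : ((k : ℝ) + 1) ≤ τ := by linarith
    exact_mod_cast this
  have hkN : τ + k ≤ N := by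
    have : (τ : ℝ) + k ≤ N := by
      have : (0 : ℝ) ≤ N := Nat.cast_nonneg N
      nlinarith
    exact_mod_cast this
  have hfar' : ∀ j, c.tau N j + k ≤ τ ∨ τ + k ≤ c.tau N j := by
    intro j
    rcases le_total (c.tau N j) τ with h | h
    · left
      have h1 := hfar j
      rw [abs_sub_comm, abs_of_nonneg (sub_nonneg.2 (by exact_mod_cast h))] at h1
      have : (c.tau N j : ℝ) + k ≤ τ := by linarith
      exact_mod_cast this
    · right
      have h1 := hfar j
      rw [abs_of_nonneg (sub_nonneg.2 (by exact_mod_cast h))] at h1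
      have : (τ : ℝ) + k ≤ c.tau N j := by linarith
      exact_mod_cast this
  have hfar₀ : ∀ r', r' ≠ r → c₀.tau N r' + k ≤ τ ∨ τ + k ≤ c₀.tau N r' := by
    intro r' hr'
    rcases lt_or_gt_of_ne hr' with h | h
    · left
      have h1 := hc₀.tau_add_le_tau (N := N) hd (by linarith) h
      have : (c₀.tau N r' : ℝ) + k ≤ τ := by linarith
      exact_mod_cast this
    · right
      have h1 := hc₀.tau_add_le_tau (N := N) hd (by linarith) h
      have : (τ : ℝ) + k ≤ c₀.tau N r' := by linarith
      exact_mod_cast this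
  have hdiff : ∀ t, τ - T * q ≤ t → t < τ → u (t + T * q) = u t - Δ := by
    intro t ht htτ
    have h1 := fitMean_add_mul c N s μ (t := t) (by omega) q fun j hj => by
      rcases hfar' j with h | h <;> omega
    have h2 : trueMean s₀ c₀ mu N (t + T * q) = trueMean s₀ c₀ mu N t + Δ := by
      rw [trueMean, trueMean, ofNat_add_mul (by omega), mu_regime_eq c₀ hc₀ hd (by linarith) mu,
        mu_regime_eq c₀ hc₀ hd (by linarith) mu]
      have e2 : ∑ r' : Fin c₀.m, (mu r'.succ - mu r'.castSucc) *
            (if c₀.tau N r' ≤ t + T * q then 1 else 0) =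
          ∑ r' : Fin c₀.m, ((mu r'.succ - mu r'.castSucc) * (if c₀.tau N r' ≤ t then 1 else 0) +
            if r' = r then Δ else 0) := by
        refine Finset.sum_congr rfl fun r' _ => ?_
        by_cases hr' : r' = r
        · subst hr'
          rw [if_pos (by omega), if_neg (by omega), if_pos rfl]
          rw [hΔ]; ring
        · rw [if_neg hr', add_zero]
          congr 1
          rcases hfar₀ r' hr' with h | h
          · rw [if_pos (by omega), if_pos (by omega)]
          · rw [if_neg (by omega), if_neg (by omega)]
      rw [e2, Finset.sum_add_distrib, Finset.sum_ite_eq' Finset.univ r]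
      simp only [Finset.mem_univ, if_true]
      ring
    simp only [hu]
    rw [h1, h2]; ring
  have hE : ∑ i ∈ Finset.range (T * q), (u (τ - T * q + i) ^ 2 + u (τ + i) ^ 2) ≤
      energy 1 (N + 1) u := by
    rw [Finset.sum_add_distrib]
    have e1 : ∑ i ∈ Finset.range (T * q), u (τ - T * q + i) ^ 2 =
        ∑ t ∈ Finset.Ico (τ - T * q) τ, u t ^ 2 := by
      rw [Finset.sum_Ico_eq_sum_range, Nat.sub_sub_self (by omega)]
    have e2 : ∑ i ∈ Finset.range (T * q), u (τ + i) ^ 2 =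
        ∑ t ∈ Finset.Ico τ (τ + T * q), u t ^ 2 := by
      rw [Finset.sum_Ico_eq_sum_range, Nat.add_sub_cancel_left]
    rw [e1, e2, Finset.sum_Ico_consecutive _ (by omega) (by omega)]
    exact energy_mono u (by omega) (by omega)
  refine le_trans ?_ hE
  calc Δ ^ 2 / 2 * ((k : ℝ) - T) ≤ Δ ^ 2 / 2 * (T * q : ℕ) := by
        refine mul_le_mul_of_nonneg_left ?_ (by positivity)
        have : (k : ℝ) ≤ (T * q : ℕ) + T := by exact_mod_cast hqk'.le
        linarith
    _ = ∑ _i ∈ Finset.range (T * q), Δ ^ 2 / 2 := by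
        rw [Finset.sum_const, Finset.card_range, nsmul_eq_mul]; ring
    _ ≤ _ := by
        refine Finset.sum_le_sum fun i hi => ?_
        rw [Finset.mem_range] at hi
        have h1 := hdiff (τ - T * q + i) (by omega) (by omega)
        rw [show τ - T * q + i + T * q = τ + i by omega] at h1
        rw [h1]
        -- Two values that differ by `Δ` have squares summing to at least `Δ ^ 2 / 2`.
        nlinarith [sq_nonneg (2 * u (τ - T * q + i) - Δ)]

/-- When every true changepoint has a fitted one nearby, the error in the mean function splits
into a part with well separated changepoints and an explicit part. -/
lemma fineDecomp_of_match {p M : ℕ} (c c₀ : RelConfig) (hd : 0 < d) (hN : 2 ≤ d * N)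
    (hNp : (p : ℝ) + 1 ≤ d / 2 * N) (hcM : c.m ≤ M)
    (hc : c.Separated d) (hc₀ : c₀.Separated d) (s s₀ : Fin T → ℝ) (μ : Fin c.m → ℝ)
    (mu : Fin (c₀.m + 1) → ℝ) {D : ℝ} (hD : ∀ r : Fin c₀.m, |mu r.succ - mu r.castSucc| ≤ D)
    (j : Fin c₀.m → Fin c.m) (qs : Finset ℕ) (hqs : ∀ r, ∀ l ≤ p, c₀.tau N r + l ∈ qs) :
    FineDecomp T p M c₀.m (d / 2) D N qs
      (fun t => fitMean c N s μ t - trueMean s₀ c₀ mu N t)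
      (fun r => c.tau N (j r)) (fun r => c₀.tau N r) := by
  have hge : ∀ (c : RelConfig), c.Separated d → ∀ r, p + 1 ≤ c.tau N r := fun c hc r => by
    have := hc.tau_ge hN r
    have : ((p : ℝ) + 1) ≤ c.tau N r := by linarith
    exact_mod_cast this
  have hle : ∀ (c : RelConfig), c.Separated d → ∀ r, c.tau N r + p ≤ N := fun c hc r => by
    have := hc.tau_add_le (N := N) hd r
    have : (c.tau N r : ℝ) + p ≤ N := by linarith
    exact_mod_cast this
  have hN0 : (0 : ℝ) ≤ d / 2 * N := by positivity
  -- The regular part is the fitted mean minus the true mean with its changepoints moved to the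
  -- matched fitted times. It jumps at fitted changepoints only, and these are separated; moving the
  -- changepoints back produces the explicit steps.
  refine ⟨⟨c.times N, fun t => fitMean c N s μ t - (s₀ (Fin.ofNat T (t - 1)) + (mu 0 +
    ∑ r : Fin c₀.m, (mu r.succ - mu r.castSucc) * (if c.tau N (j r) ≤ t then 1 else 0))),
    fun r => mu r.succ - mu r.castSucc, (c.card_times_le N).trans hcM, ?_, ?_, ?_, ?_, hD, ?_⟩,
    fun r => hge c hc _, fun r => hge c₀ hc₀ _, fun r => hle c hc _, fun r => hle c₀ hc₀ _, hqs⟩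
  · intro b hb
    obtain ⟨r, rfl⟩ := RelConfig.mem_times.1 hb
    exact hc.tau_ge hN r
  · intro b hb
    obtain ⟨r, rfl⟩ := RelConfig.mem_times.1 hb
    have := hc.tau_add_le (N := N) hd r
    linarith
  · intro b hb b' hb' hbb'
    obtain ⟨r, rfl⟩ := RelConfig.mem_times.1 hb
    obtain ⟨r', rfl⟩ := RelConfig.mem_times.1 hb'
    refine hc.tau_add_le_tau hd hN ?_
    by_contra hle
    rcases (not_lt.1 hle).eq_or_lt with h | h
    · rw [h] at hbb'; omega
    · have := hc.tau_lt_tau hd hN h; omega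
  · refine jumpsIn_of_forall fun t ht h => ?_
    rw [fitMean_add_period c N s μ ht h]
    congr 2
    · have := ofNat_add_mul (T := T) ht 1
      rw [mul_one] at this
      rw [this]
    · congr 1
      refine Finset.sum_congr rfl fun r _ => ?_
      have h1 : c.tau N (j r) ≤ t + T ↔ c.tau N (j r) ≤ t :=
        ⟨h _ (RelConfig.mem_times.2 ⟨j r, rfl⟩), fun h => by omega⟩
      simp only [h1]
  · intro t
    have h1 : ∑ r, (mu r.succ - mu r.castSucc) * stepDiff (c.tau N (j r)) (c₀.tau N r) t =
        ∑ r : Fin c₀.m, (mu r.succ - mu r.castSucc) * (if c.tau N (j r) ≤ t then 1 else 0) -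
        ∑ r : Fin c₀.m, (mu r.succ - mu r.castSucc) * (if c₀.tau N r ≤ t then 1 else 0) := by
      rw [← Finset.sum_sub_distrib]
      exact Finset.sum_congr rfl fun r _ => by rw [stepDiff]; ring
    simp only [trueMean]
    rw [h1, mu_regime_eq c₀ hc₀ hd hN mu]
    ring

/-- A matching of the true changepoints with nearby fitted ones is strictly increasing. -/
lemma strictMono_of_match (c c₀ : RelConfig) (hd : 0 < d) (hN : 2 ≤ d * N) (hc : c.Separated d)
    (hc₀ : c₀.Separated d) (j : Fin c₀.m → Fin c.m)
    (hj : ∀ r, |(c.tau N (j r) : ℝ) - c₀.tau N r| ≤ d / 8 * N) : StrictMono j := by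
  intro r r' hr
  by_contra hle
  have h1 := hc₀.tau_add_le_tau (N := N) hd hN hr
  have h2 : (c.tau N (j r') : ℝ) ≤ c.tau N (j r) := by
    rcases (not_lt.1 hle).eq_or_lt with h | h
    · rw [h]
    · exact_mod_cast (hc.tau_lt_tau hd hN h).le
  have h3 := abs_le.1 (hj r)
  have h4 := abs_le.1 (hj r')
  have h5 : 0 < d * N := by linarith
  linarith

end Config

/-! ### The matrices of the criterion in terms of filtered sequences -/

section Criterion

variable {T p N : ℕ} {c : RelConfig} {x : ℕ → ℝ} {nu : ℝ}

lemma arFilter_eq_arf (phi : Fin p → ℝ) (x : ℕ → ℝ) (i : Fin (N - p)) :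
    arFilter p N phi x i = arf phi x (p + 1 + i) := rfl

lemma arf_sum_mul {ι : Type*} (s : Finset ι) (φ : Fin p → ℝ) (w : ι → ℝ) (f : ι → ℕ → ℝ) (t : ℕ) :
    arf φ (fun t => ∑ v ∈ s, w v * f v t) t = ∑ v ∈ s, w v * arf φ (f v) t := by
  simp only [arf, mul_sub, Finset.sum_sub_distrib, Finset.mul_sum]
  congr 1
  rw [Finset.sum_comm]
  exact Finset.sum_congr rfl fun v _ => Finset.sum_congr rfl fun j _ => by ring

lemma Ahat_mulVec (s : Fin T → ℝ) (i : Fin (N - p)) : (Ahat T p N c x *ᵥ s) i =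
    arf (phiHat T p N c x) (fun t => ∑ v, s v * seasonCol T v t) (p + 1 + i) := by
  rw [arf_sum_mul]
  simp only [Matrix.mulVec, dotProduct, Ahat, Matrix.of_apply, arFilter_eq_arf]
  exact Finset.sum_congr rfl fun v _ => mul_comm _ _

lemma Dhat_mulVec (μ : Fin c.m → ℝ) (i : Fin (N - p)) : (Dhat T p N c x *ᵥ μ) i =
    arf (phiHat T p N c x) (fun t => ∑ r, μ r * regimeCol c N r t) (p + 1 + i) := by
  rw [arf_sum_mul]
  simp only [Matrix.mulVec, dotProduct, Dhat, Matrix.of_apply, arFilter_eq_arf]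
  exact Finset.sum_congr rfl fun v _ => mul_comm _ _

lemma dotProduct_self_eq_energy (y : Fin (N - p) → ℝ) (f : ℕ → ℝ)
    (h : ∀ i : Fin (N - p), y i = f (p + 1 + i)) : y ⬝ᵥ y = energy (p + 1) (N + 1) f := by
  simp only [dotProduct, h, energy]
  rw [Finset.sum_Ico_eq_sum_range, show N + 1 - (p + 1) = N - p by omega, Finset.sum_range]
  exact Finset.sum_congr rfl fun i _ => (sq _).symm

lemma residual_dotProduct_self (s : Fin T → ℝ) (μ : Fin c.m → ℝ) :
    (Xhat T p N c x - Ahat T p N c x *ᵥ s - Dhat T p N c x *ᵥ μ) ⬝ᵥ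
      (Xhat T p N c x - Ahat T p N c x *ᵥ s - Dhat T p N c x *ᵥ μ) =
    energy (p + 1) (N + 1) (arf (phiHat T p N c x) (fun t => x t - fitMean c N s μ t)) := by
  refine dotProduct_self_eq_energy _ _ fun i => ?_
  rw [Pi.sub_apply, Pi.sub_apply, Ahat_mulVec, Dhat_mulVec, Xhat, arFilter_eq_arf]
  simp only [arf, fitMean, mul_sub, mul_add, Finset.sum_sub_distrib, Finset.sum_add_distrib]
  ring

lemma sub_mul_sigmaSqHat (hpN : p < N) :
    ((N : ℝ) - p) * sigmaSqHat T p N nu c x =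
      profileForm (Xhat T p N c x) (Ahat T p N c x) (Dhat T p N c x) nu := by
  have h : ((N : ℝ) - p) ≠ 0 := by
    have : (p : ℝ) < N := by exact_mod_cast hpN
    linarith
  rw [sigmaSqHat, ← mul_assoc, mul_one_div_cancel h, one_mul]
  rfl

lemma exists_energy_le_sigmaSqHat (hnu : 0 < nu) (hpN : p < N) : ∃ (s : Fin T → ℝ) (μ : Fin c.m → ℝ),
    energy (p + 1) (N + 1) (arf (phiHat T p N c x) (fun t => x t - fitMean c N s μ t)) ≤
      ((N : ℝ) - p) * sigmaSqHat T p N nu c x := by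
  obtain ⟨s, μ, h⟩ := exists_profileForm_eq (Xhat T p N c x) (Ahat T p N c x) (Dhat T p N c x) hnu
  refine ⟨s, μ, ?_⟩
  rw [sub_mul_sigmaSqHat hpN, h, residual_dotProduct_self]
  have := dotProduct_self_nonneg' μ
  have : 0 ≤ 1 / nu * (μ ⬝ᵥ μ) := by positivity
  linarith

lemma sigmaSqHat_le (hnu : 0 < nu) (hpN : p < N)
    (hA : ∀ s, Ahat T p N c x *ᵥ s = 0 → s = 0) (s : Fin T → ℝ) (μ : Fin c.m → ℝ) :
    ((N : ℝ) - p) * sigmaSqHat T p N nu c x ≤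
      energy (p + 1) (N + 1) (arf (phiHat T p N c x) (fun t => x t - fitMean c N s μ t)) +
      1 / nu * (μ ⬝ᵥ μ) := by
  rw [sub_mul_sigmaSqHat hpN, ← residual_dotProduct_self]
  exact profileForm_le _ _ _ hnu hA s μ

/-- A combination of seasonal columns is periodic throughout, so the filter is bounded below on it;
`T ≤ N` then allows each season to be read off. -/
lemma Ahat_injective [NeZero T] {C : ℝ} (hTN : T ≤ N)
    (h : ∀ y : ℕ → ℝ, (∀ t, 1 + T ≤ t → y t = y (t - T)) →
      energy 1 (N + 1) y ≤ C * energy (p + 1) (N + 1) (arf (phiHat T p N c x) y))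
    (s : Fin T → ℝ) (hs : Ahat T p N c x *ᵥ s = 0) : s = 0 := by
  set y : ℕ → ℝ := fun t => ∑ v, s v * seasonCol T v t with hy
  have h1 := h y fun t ht => by
    obtain ⟨t, rfl⟩ : ∃ t', t = t' + T := ⟨t - T, by omega⟩
    simp only [hy, Nat.add_sub_cancel]
    refine Finset.sum_congr rfl fun v _ => ?_
    have := seasonCol_add_mul v (show 1 ≤ t by omega) 1
    rw [mul_one] at this
    rw [this]
  have h2 : energy (p + 1) (N + 1) (arf (phiHat T p N c x) y) = 0 := by
    rw [← dotProduct_self_eq_energy (Ahat T p N c x *ᵥ s) _ (Ahat_mulVec s), hs, dotProduct_zero]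
  rw [h2, mul_zero] at h1
  have h3 := (Finset.sum_eq_zero_iff_of_nonneg fun _ _ => sq_nonneg _).1
    (le_antisymm h1 (energy_nonneg _ _ _))
  funext v
  have h4 := h3 ((v : ℕ) + 1) (Finset.mem_Ico.2 ⟨by omega, by omega⟩)
  have h5 : y ((v : ℕ) + 1) = s v := by
    simp only [hy]
    rw [sum_seasonCol]
    congr 1
    apply Fin.ext
    simp [Fin.ofNat, Nat.mod_eq_of_lt v.is_lt]
  rw [h5] at h4
  simpa using h4

lemma pow_le_ridge_det (hnu : 0 < nu) : (1 / nu) ^ c.m ≤ (ridge T p N nu c x).det :=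
  pow_le_det_of_le (ridgeGram_isSymm _ nu) (by positivity) fun y => by
    rw [dotProduct_ridgeGram_mulVec]
    linarith [dotProduct_self_nonneg' (Dhat T p N c x *ᵥ y)]

lemma regimeCol_eq_one {d : ℝ} (hc : c.Separated d) (hd : 0 < d) (hN : 2 ≤ d * N) (r : Fin c.m)
    {t k : ℕ} (hk : (k : ℝ) ≤ d / 2 * N) (ht : c.tau N r ≤ t) (ht' : t < c.tau N r + k) :
    regimeCol c N r t = 1 := by
  rw [regimeCol, if_pos]
  apply Fin.ext
  have h1 : (Finset.univ.filter fun r : Fin c.m => c.tau N r ≤ t) = Finset.Iic r := by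
    ext r'
    simp only [Finset.mem_filter, Finset.mem_univ, true_and, Finset.mem_Iic]
    constructor
    · intro h
      by_contra hlt
      have h2 := hc.tau_add_le_tau hd hN (not_le.1 hlt)
      have h3 : (c.tau N r : ℝ) + k ≤ c.tau N r' := by linarith
      have h4 : c.tau N r + k ≤ c.tau N r' := by exact_mod_cast h3
      omega
    · intro h
      rcases h.eq_or_lt with rfl | h
      · exact ht
      · exact (hc.tau_lt_tau hd hN h).le.trans ht
  simp only [RelConfig.regime, h1, Fin.card_Iic, Fin.val_succ]

/-- The regime indicators have disjoint supports, each with at least `d / 4 * N` observed times. -/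
lemma le_energy_sum_regimeCol {d : ℝ} (hc : c.Separated d) (hd : 0 < d) (hN : 4 ≤ d * N)
    (μ : Fin c.m → ℝ) : d / 4 * N * (μ ⬝ᵥ μ) ≤
      energy 1 (N + 1) (fun t => ∑ r, μ r * regimeCol c N r t) := by
  have hpt : ∀ t, (∑ r, μ r * regimeCol c N r t) ^ 2 = ∑ r, μ r ^ 2 * regimeCol c N r t := by
    intro t
    simp only [regimeCol, mul_ite, mul_one, mul_zero]
    rcases Fin.eq_zero_or_eq_succ (c.regime N t) with h | ⟨r, h⟩
    · rw [h, Finset.sum_eq_zero, Finset.sum_eq_zero]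
      · norm_num
      · intro r _; rw [if_neg (Fin.succ_ne_zero r).symm]
      · intro r _; rw [if_neg (Fin.succ_ne_zero r).symm]
    · rw [h]; simp [Fin.succ_inj]
  unfold energy
  simp only [hpt]
  rw [Finset.sum_comm, dotProduct, Finset.mul_sum]
  refine Finset.sum_le_sum fun r _ => ?_
  rw [← Finset.mul_sum, mul_comm, ← sq]
  refine mul_le_mul_of_nonneg_left ?_ (sq_nonneg _)
  set k := ⌊d / 2 * N⌋₊ with hk
  have hN0 : 0 ≤ d / 2 * N := by positivity
  have hk1 : (k : ℝ) ≤ d / 2 * N := Nat.floor_le hN0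
  have hk2 : d / 2 * N < k + 1 := Nat.lt_floor_add_one _
  have h1 := hc.tau_ge (N := N) (by linarith) r
  have h2 := hc.tau_add_le (N := N) hd r
  have h3 : 1 ≤ c.tau N r := by
    have : (1 : ℝ) ≤ c.tau N r := by linarith
    exact_mod_cast this
  have h4 : c.tau N r + k ≤ N := by
    have : (c.tau N r : ℝ) + k ≤ N := by linarith
    exact_mod_cast this
  calc d / 4 * N ≤ k := by linarith
    _ = ∑ t ∈ Finset.Ico (c.tau N r) (c.tau N r + k), (1 : ℝ) := by simp
    _ = ∑ t ∈ Finset.Ico (c.tau N r) (c.tau N r + k), regimeCol c N r t := by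
        refine Finset.sum_congr rfl fun t ht => ?_
        rw [Finset.mem_Ico] at ht
        rw [regimeCol_eq_one hc hd (by linarith) r hk1 ht.1 ht.2]
    _ ≤ _ := by
        refine Finset.sum_le_sum_of_subset_of_nonneg
          (Finset.Ico_subset_Ico h3 (by omega)) fun t _ _ => ?_
        rw [regimeCol]; split_ifs <;> norm_num

/-- The quadratic form of the ridge matrix dominates the energy of a filtered step function, and the
filter loses at most the factor `C`. This is the half of `log N` per changepoint contributed by the
determinant. -/
lemma pow_le_ridge_det_of_near {d C : ℝ} (hC : 0 < C) (hc : c.Separated d) (hd : 0 < d)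
    (hN : 4 ≤ d * N) (hnu : 0 < nu)
    (h : ∀ y : ℕ → ℝ, (∀ t, 1 + T ≤ t → (∀ b ∈ c.times N, t < b) → y t = y (t - T)) →
      energy 1 (N + 1) y ≤ C * energy (p + 1) (N + 1) (arf (phiHat T p N c x) y)) :
    (d / (4 * C) * N) ^ c.m ≤ (ridge T p N nu c x).det := by
  refine pow_le_det_of_le (ridgeGram_isSymm _ nu) (by positivity) fun μ => ?_
  rw [dotProduct_ridgeGram_mulVec, dotProduct_self_eq_energy _ _ (Dhat_mulVec μ)]
  have h1 := le_energy_sum_regimeCol hc hd hN μ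
  have h2 := h (fun t => ∑ r, μ r * regimeCol c N r t) fun t ht hb => by
    refine Finset.sum_congr rfl fun r _ => ?_
    rw [regimeCol_congr c (t := t) (t' := t - T) fun r => ?_]
    have := hb _ (RelConfig.mem_times.2 ⟨r, rfl⟩)
    constructor <;> intro <;> omega
  have h3 := dotProduct_self_nonneg' μ
  have h4 : 0 ≤ 1 / nu * (μ ⬝ᵥ μ) := by positivity
  have h5 : d / (4 * C) * N * (μ ⬝ᵥ μ) = (d / 4 * N * (μ ⬝ᵥ μ)) / C := by field_simp
  rw [h5, div_le_iff₀ hC]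
  nlinarith

/-- The entries are at most a constant times `N`, and the Leibniz expansion has `m!` terms; only the
power of `N` matters. -/
lemma ridge_det_le (hnu : 0 < nu) {Φ : ℝ} (hΦ : ∑ j, |phiHat T p N c x j| ≤ Φ) (hN : 1 ≤ N) :
    (ridge T p N nu c x).det ≤ (c.m).factorial * (((1 + Φ) ^ 2 + 1 / nu) * N) ^ c.m := by
  have hΦ0 : 0 ≤ Φ := (Finset.sum_nonneg fun _ _ => abs_nonneg _).trans hΦ
  have hcol : ∀ r t, |regimeCol c N r t| ≤ 1 := by
    intro r t; rw [regimeCol]; split_ifs <;> norm_num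
  have hD : ∀ i r, |Dhat T p N c x i r| ≤ 1 + Φ := by
    intro i r
    rw [Dhat, Matrix.of_apply, arFilter]
    refine (abs_sub _ _).trans (add_le_add (hcol _ _) ?_)
    refine (Finset.abs_sum_le_sum_abs _ _).trans (le_trans (Finset.sum_le_sum fun j _ => ?_) hΦ)
    rw [abs_mul]
    exact mul_le_of_le_one_right (abs_nonneg _) (hcol _ _)
  have hN' : (1 : ℝ) ≤ N := by exact_mod_cast hN
  have hentry : ∀ r r', IsAbsoluteValue.toAbsoluteValue (abs : ℝ → ℝ) (ridge T p N nu c x r r') ≤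
      ((1 + Φ) ^ 2 + 1 / nu) * N := by
    intro r r'
    change |ridge T p N nu c x r r'| ≤ _
    rw [ridge, Matrix.add_apply, Matrix.smul_apply, Matrix.mul_apply, add_mul]
    refine (abs_add_le _ _).trans (add_le_add ?_ ?_)
    · refine (Finset.abs_sum_le_sum_abs _ _).trans ?_
      calc _ ≤ ∑ _i : Fin (N - p), (1 + Φ) ^ 2 := by
            refine Finset.sum_le_sum fun i _ => ?_
            rw [abs_mul, sq, Matrix.transpose_apply]
            exact mul_le_mul (hD i r) (hD i r') (abs_nonneg _) (by positivity)
        _ = ((N - p : ℕ) : ℝ) * (1 + Φ) ^ 2 := by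
            rw [Finset.sum_const, Finset.card_univ, Fintype.card_fin, nsmul_eq_mul]
        _ ≤ (1 + Φ) ^ 2 * N := by
            rw [mul_comm]
            refine mul_le_mul_of_nonneg_left ?_ (by positivity)
            exact_mod_cast Nat.sub_le N p
    · rw [smul_eq_mul, abs_mul, abs_of_pos (by positivity : 0 < 1 / nu)]
      refine mul_le_mul_of_nonneg_left (le_trans ?_ hN') (by positivity)
      rw [Matrix.one_apply]; split_ifs <;> simp
  have h := Matrix.det_le hentry
  rw [Fintype.card_fin, nsmul_eq_mul] at h
  exact (le_abs_self _).trans h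

end Criterion

/-! ### The Gamma terms as a penalty -/

section Penalty

/-- The functional equation of `Γ` removes `m` factors, each between `κ / 2 * N` and `(1 + b) * N`,
so the logarithm of each is `log N` up to a bounded error. -/
lemma abs_log_Gamma_sub_le {b κ : ℝ} (hb : 0 < b) (hκ : 0 < κ) {M N n : ℕ} (hN : 2 * M ≤ κ * N)
    (hN1 : 1 ≤ N) (hn : κ * N ≤ n) (hnN : n ≤ N) (m : ℕ) (hm : m ≤ M) :
    |Real.log (Real.Gamma (b + n - m)) + m * Real.log N - Real.log (Real.Gamma (b + n))|
      ≤ m * (|Real.log (κ / 2)| + |Real.log (1 + b)|) := by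
  have hN0 : (1 : ℝ) ≤ N := by exact_mod_cast hN1
  have hnN' : (n : ℝ) ≤ N := by exact_mod_cast hnN
  have hκN : 0 < κ * N := by positivity
  induction m with
  | zero => simp
  | succ m ih =>
    have hmM : (m : ℝ) + 1 ≤ M := by exact_mod_cast hm
    obtain ⟨y, hy⟩ : ∃ y : ℝ, y = b + n - (m + 1 : ℕ) := ⟨_, rfl⟩
    have hy' : y = b + n - (m + 1) := by rw [hy]; push_cast; ring
    have hylow : κ / 2 * N ≤ y := by linarith
    have hy0 : 0 < y := lt_of_lt_of_le (by positivity) hylow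
    have hyup : y ≤ (1 + b) * N := by
      have : b * 1 ≤ b * N := mul_le_mul_of_nonneg_left hN0 hb.le
      have : (0 : ℝ) ≤ m := Nat.cast_nonneg m
      linarith
    have hG : Real.Gamma (b + n - m) = y * Real.Gamma y := by
      rw [← Real.Gamma_add_one hy0.ne', hy']
      congr 1; ring
    have hlog : Real.log (Real.Gamma (b + n - m)) = Real.log y + Real.log (Real.Gamma y) := by
      rw [hG, Real.log_mul hy0.ne' (Real.Gamma_pos_of_pos hy0).ne']
    have l1 : Real.log (κ / 2) + Real.log N ≤ Real.log y := by
      rw [← Real.log_mul (by positivity) (by positivity)]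
      exact Real.log_le_log (by positivity) hylow
    have l2 : Real.log y ≤ Real.log (1 + b) + Real.log N := by
      rw [← Real.log_mul (by positivity) (by positivity)]
      exact Real.log_le_log hy0 hyup
    have ih' := abs_le.1 (ih (by omega))
    rw [← hy]
    have k1 := neg_abs_le (Real.log (κ / 2))
    have k2 := le_abs_self (Real.log (1 + b))
    have k3 := abs_nonneg (Real.log (κ / 2))
    have k4 := abs_nonneg (Real.log (1 + b))
    rw [abs_le]
    push_cast
    constructor <;> linarith [ih'.1, ih'.2]

variable {p : ℕ}

lemma card_timeClass_le (N : ℕ) (doc : Finset ℕ) (k : Fin 2) :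
    (timeClass p N doc k).card ≤ N := by
  have h : timeClass p N doc k ⊆ Finset.Icc (p + 1) N := by
    unfold timeClass
    split_ifs
    · exact Finset.sdiff_subset
    · exact Finset.inter_subset_left
  refine (Finset.card_le_card h).trans ?_
  rw [Nat.card_Icc]; omega

lemma sum_numChanges {N : ℕ} (doc : Finset ℕ) (c : RelConfig)
    (hc : ∀ r, c.tau N r ∈ Finset.Icc (p + 1) N) : ∑ k, numChanges p N doc c k = c.m := by
  have h : ∀ r, c.tau N r ∈ timeClass p N doc 0 ↔ ¬ c.tau N r ∈ timeClass p N doc 1 := by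
    intro r
    simp [timeClass, hc r, -Finset.mem_Icc]
  rw [Fin.sum_univ_two, numChanges, numChanges, Finset.filter_congr fun r _ => h r, add_comm,
    Finset.card_filter_add_card_filter_not, Finset.card_univ, Fintype.card_fin]

/-- The Gamma terms of the criterion amount to a penalty of `log N` for each changepoint, up to
a bounded error and a term that is the same for all configurations. -/
lemma exists_abs_sum_log_Gamma_le {a d : ℝ} {b : Fin 2 → ℝ} (ha : 0 < a) (hb : ∀ k, 0 < b k)
    (hd : 0 < d) (M : ℕ) (doc : ℕ → Finset ℕ)
    (hdoc : ∀ k : Fin 2,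
      (∀ᶠ N : ℕ in atTop, (timeClass p N (doc N) k).card = 0) ∨
      (∃ κ : ℝ, 0 < κ ∧ ∀ᶠ N : ℕ in atTop,
        κ * (N : ℝ) ≤ ((timeClass p N (doc N) k).card : ℝ))) :
    ∃ G : ℝ, 0 ≤ G ∧ ∃ C : ℕ → ℝ, ∀ᶠ N : ℕ in atTop, ∀ c : RelConfig, c.Separated d → c.m ≤ M →
      |∑ k : Fin 2, Real.log (Real.Gamma (a + (numChanges p N (doc N) c k : ℝ)) *
          Real.Gamma (b k + ((timeClass p N (doc N) k).card : ℝ)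
            - (numChanges p N (doc N) c k : ℝ))) + c.m * Real.log N - C N| ≤ G := by
  have key : ∀ k : Fin 2, ∃ G : ℝ, ∀ᶠ N : ℕ in atTop, ∀ m : ℕ, m ≤ M →
      m ≤ (timeClass p N (doc N) k).card →
      |Real.log (Real.Gamma (a + m) *
          Real.Gamma (b k + ((timeClass p N (doc N) k).card : ℝ) - m)) + m * Real.log N
        - Real.log (Real.Gamma (b k + ((timeClass p N (doc N) k).card : ℝ)))| ≤ G := by
    intro k
    have hA : ∀ m : ℕ, m ≤ M → |Real.log (Real.Gamma (a + m))| ≤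
        ∑ i ∈ Finset.range (M + 1), |Real.log (Real.Gamma (a + i))| := fun m hm =>
      Finset.single_le_sum (f := fun i : ℕ => |Real.log (Real.Gamma (a + i))|)
        (fun i _ => abs_nonneg _) (Finset.mem_range.2 (Nat.lt_succ_of_le hm))
    have hsplit : ∀ n m : ℕ, m ≤ n → Real.log (Real.Gamma (a + m) *
        Real.Gamma (b k + (n : ℝ) - m)) =
        Real.log (Real.Gamma (a + m)) + Real.log (Real.Gamma (b k + (n : ℝ) - m)) := by
      intro n m hmn
      have h1 : (m : ℝ) ≤ n := by exact_mod_cast hmn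
      have h2 := hb k
      exact Real.log_mul (Real.Gamma_pos_of_pos (by positivity)).ne'
        (Real.Gamma_pos_of_pos (by linarith)).ne'
    -- An empty class contains no changepoint and contributes no `log N`; a class of linear size
    -- contributes `log N` for each of its changepoints.
    rcases hdoc k with h | ⟨κ, hκ, h⟩
    · refine ⟨∑ i ∈ Finset.range (M + 1), |Real.log (Real.Gamma (a + i))|,
        h.mono fun N hN m hm hmn => ?_⟩
      have hm0 : m = 0 := by omega
      rw [hsplit _ _ hmn, hm0]
      simp only [Nat.cast_zero, sub_zero, zero_mul, add_zero, add_sub_cancel_right]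
      simpa using hA 0 (Nat.zero_le M)
    · refine ⟨∑ i ∈ Finset.range (M + 1), |Real.log (Real.Gamma (a + i))| +
        M * (|Real.log (κ / 2)| + |Real.log (1 + b k)|), ?_⟩
      have hev : ∀ᶠ N : ℕ in atTop, 2 * (M : ℝ) ≤ κ * N := by
        have : Tendsto (fun N : ℕ => κ * (N : ℝ)) atTop atTop :=
          tendsto_natCast_atTop_atTop.const_mul_atTop hκ
        exact this.eventually_ge_atTop _
      filter_upwards [h, hev, eventually_ge_atTop 1] with N hN hN2 hN1 m hm hmn
      rw [hsplit _ _ hmn]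
      have h1 := abs_log_Gamma_sub_le (hb k) hκ hN2 hN1 hN (card_timeClass_le N (doc N) k) m hm
      have h2 := hA m hm
      have h3 : (m : ℝ) * (|Real.log (κ / 2)| + |Real.log (1 + b k)|) ≤
          M * (|Real.log (κ / 2)| + |Real.log (1 + b k)|) :=
        mul_le_mul_of_nonneg_right (by exact_mod_cast hm) (by positivity)
      rw [add_assoc, add_sub_assoc]
      exact (abs_add_le _ _).trans (add_le_add h2 (h1.trans h3))
  choose G hG using key
  refine ⟨max (∑ k, G k) 0, le_max_right _ _,
    fun N => ∑ k, Real.log (Real.Gamma (b k + ((timeClass p N (doc N) k).card : ℝ))), ?_⟩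
  have hev : ∀ᶠ N : ℕ in atTop, 2 * ((p : ℝ) + 1) ≤ d * N := by
    have : Tendsto (fun N : ℕ => d * (N : ℝ)) atTop atTop :=
      tendsto_natCast_atTop_atTop.const_mul_atTop hd
    exact this.eventually_ge_atTop _
  filter_upwards [eventually_all.2 hG, hev] with N hN hNp c hc hcM
  have hp0 : (0 : ℝ) ≤ p := Nat.cast_nonneg p
  -- For large `N` all changepoint times exceed `p`, so the two classes together account for all of
  -- them.
  have hmem : ∀ r, c.tau N r ∈ Finset.Icc (p + 1) N := by
    intro r
    have h1 := hc.tau_ge (N := N) (by linarith) r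
    have h2 := hc.tau_add_le (N := N) hd r
    have h3 : (p : ℝ) + 1 ≤ c.tau N r := by linarith
    have h4 : (c.tau N r : ℝ) ≤ N := by
      have : 0 ≤ d * N := by positivity
      linarith
    exact Finset.mem_Icc.2 ⟨by exact_mod_cast h3, by exact_mod_cast h4⟩
  have hsum := sum_numChanges (doc N) c hmem
  have hinj : Function.Injective (c.tau N) := by
    intro r r' h
    rcases lt_trichotomy r r' with hlt | heq | hlt
    · exact absurd h (hc.tau_lt_tau (N := N) hd (by linarith) hlt).ne
    · exact heq
    · exact absurd h (hc.tau_lt_tau (N := N) hd (by linarith) hlt).ne'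
  have hnum : ∀ k, numChanges p N (doc N) c k ≤ (timeClass p N (doc N) k).card := by
    intro k
    refine Finset.card_le_card_of_injOn (c.tau N) (fun r hr => ?_) hinj.injOn
    exact (Finset.mem_filter.1 hr).2
  have hle : ∀ k, numChanges p N (doc N) c k ≤ M := fun k =>
    (Finset.single_le_sum (f := fun k => numChanges p N (doc N) c k) (fun _ _ => Nat.zero_le _)
      (Finset.mem_univ k)).trans (hsum.le.trans hcM)
  have hm : (c.m : ℝ) = ∑ k, (numChanges p N (doc N) c k : ℝ) := by exact_mod_cast hsum.symm
  rw [hm, Finset.sum_mul, ← Finset.sum_add_distrib, ← Finset.sum_sub_distrib]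
  exact (Finset.abs_sum_le_sum_abs _ _).trans ((Finset.sum_le_sum fun k _ =>
    hN k _ (hle k) (hnum k)).trans (le_max_left _ _))

end Penalty

/-! ### Sequences extended by zero -/

section ZeroStart

variable {p : ℕ} {u : ℕ → ℝ}

lemma energy_add_sub (a b k : ℕ) (y : ℕ → ℝ) :
    energy (a + k) (b + k) (fun t => y (t - k)) = energy a b y := by
  simp [energy, ← Finset.sum_Ico_add' (fun t => y (t - k) ^ 2) a b k]

/-- Subtraction of natural numbers stops at `0`, so a sequence with `u 0 = 0` reads as zero at all
earlier times. The filter bounds then hold from time `0` on, without loss of the first `p` times. -/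
lemma energy_sub_of_zero (hu : u 0 = 0) (b k : ℕ) :
    energy 0 (b + k) (fun t => u (t - k)) = energy 0 b u := by
  rw [← energy_add_sub 0 b k u, energy, energy, zero_add,
    ← Finset.sum_Ico_consecutive _ (Nat.zero_le k) (by omega : k ≤ b + k)]
  rw [Finset.sum_eq_zero, zero_add]
  intro t ht
  rw [Finset.mem_Ico] at ht
  simp [Nat.sub_eq_zero_of_le ht.2.le, hu]

lemma energy_lag_le_of_zero (hu : u 0 = 0) (η : Fin p → ℝ) (b : ℕ) :
    energy 0 b (fun t => ∑ j : Fin p, η j * u (t - ((j : ℕ) + 1))) ≤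
      p * (∑ j, η j ^ 2) * energy 0 b u := by
  have h := energy_lag_le η 0 (b + p) (fun t => u (t - p))
  rw [zero_add, energy_sub_of_zero hu] at h
  rw [← energy_add_sub 0 b p, zero_add]
  refine le_trans (le_of_eq (energy_congr fun t ht _ => ?_)) h
  refine Finset.sum_congr rfl fun j _ => ?_
  rw [Nat.sub_right_comm]

lemma energy_arf_le_of_zero (hu : u 0 = 0) (φ : Fin p → ℝ) (b : ℕ) :
    energy 0 b (arf φ u) ≤ (2 + 2 * (p * ∑ j, φ j ^ 2)) * energy 0 b u := by
  have h := energy_arf_le φ 0 (b + p) (fun t => u (t - p))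
  rw [zero_add, energy_sub_of_zero hu] at h
  rw [← energy_add_sub 0 b p, zero_add]
  refine le_trans (le_of_eq (energy_congr fun t ht _ => ?_)) h
  simp only [arf]
  congr 1
  refine Finset.sum_congr rfl fun j _ => ?_
  rw [Nat.sub_right_comm]

lemma energy_shift_le_of_zero (hu : u 0 = 0) (b k : ℕ) :
    energy 0 b (fun t => u (t - k)) ≤ energy 0 b u := by
  rw [← energy_sub_of_zero hu b k]
  exact energy_mono _ le_rfl (by omega)

end ZeroStart

lemma sq_sum_mul_le_energy {a b : ℕ} {u v : ℕ → ℝ} {U V : ℝ} (hu : energy a b u ≤ U)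
    (hv : energy a b v ≤ V) : (∑ t ∈ Finset.Ico a b, u t * v t) ^ 2 ≤ U * V := by
  refine (Finset.sum_mul_sq_le_sq_mul_sq _ _ _).trans ?_
  exact mul_le_mul hu hv (energy_nonneg _ _ _) ((energy_nonneg _ _ _).trans hu)

/-- The function that agrees with `x` on `[1, N]` and vanishes elsewhere. -/
def cutoff (N : ℕ) (x : ℕ → ℝ) (t : ℕ) : ℝ := if 1 ≤ t ∧ t ≤ N then x t else 0

lemma cutoff_zero (N : ℕ) (x : ℕ → ℝ) : cutoff N x 0 = 0 := by simp [cutoff]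

lemma cutoff_of_mem {N t : ℕ} (x : ℕ → ℝ) (h : 1 ≤ t) (h' : t ≤ N) : cutoff N x t = x t :=
  if_pos ⟨h, h'⟩

lemma cutoff_of_lt {N t : ℕ} (x : ℕ → ℝ) (h : N < t) : cutoff N x t = 0 :=
  if_neg (by omega)

lemma energy_cutoff (N R : ℕ) (hR : N + 1 ≤ R) (x : ℕ → ℝ) :
    energy 0 R (cutoff N x) = energy 1 (N + 1) x := by
  rw [← energy_congr (x := cutoff N x) (y := x) (a := 1) (b := N + 1) fun t h1 h2 =>
    cutoff_of_mem x h1 (by omega)]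
  refine (Finset.sum_subset (Finset.Ico_subset_Ico (Nat.zero_le 1) hR) fun t _ ht => ?_).symm
  rw [Finset.mem_Ico] at ht
  rw [cutoff, if_neg (by omega)]
  norm_num

lemma energy_cutoff_le (N a b : ℕ) (x : ℕ → ℝ) :
    energy a b (cutoff N x) ≤ energy (max a 1) (min b (N + 1)) x := by
  have h : energy (max a 1) (min b (N + 1)) x = energy (max a 1) (min b (N + 1)) (cutoff N x) := by
    refine energy_congr fun t h1 h2 => (cutoff_of_mem x ?_ ?_).symm <;> omega
  rw [h]
  refine le_of_eq (Finset.sum_subset (Finset.Ico_subset_Ico (by omega) (by omega))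
    fun t ht ht' => ?_).symm
  rw [Finset.mem_Ico] at ht ht'
  rw [cutoff, if_neg (by omega)]
  norm_num

/-- The sizes of an autoregressive path and of its least squares fit `g` at the true
configuration. -/
structure SmallFit (p N : ℕ) (A : ℝ) (e g : ℕ → ℝ) : Prop where
  fit : energy 1 (N + 1) g ≤ A
  energy_le : energy 1 (N + 1) e ≤ A * N
  first : energy 1 (p + 1) e ≤ A
  last : energy (N + 1 - p) (N + 1) e ≤ A

/-! ### The Yule–Walker equations at the true configuration -/

section YuleWalker

variable {T p : ℕ} {φ : Fin p → ℝ} {σ2 ε A : ℝ} {N : ℕ} {qs : Finset ℕ} {z e g : ℕ → ℝ}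

lemma sq_add_five_le (a b c d e : ℝ) :
    (a + b + c - d - e) ^ 2 ≤ 5 * (a ^ 2 + b ^ 2 + c ^ 2 + d ^ 2 + e ^ 2) := by
  nlinarith [sq_nonneg (a - b), sq_nonneg (a - c), sq_nonneg (a + d), sq_nonneg (a + e),
    sq_nonneg (b - c), sq_nonneg (b + d), sq_nonneg (b + e), sq_nonneg (c + d),
    sq_nonneg (c + e), sq_nonneg (d - e)]

/-- The Yule–Walker equations hold for the true coefficients up to errors of order `√N`. -/
lemma GoodPath.sq_sum_lag_mul_arf_le (hG : GoodPath T φ σ2 ε A N qs z e)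
    (hS : SmallFit p N A e g) (hA : 0 ≤ A) (hN : 1 ≤ N) (hpN : p ≤ N) (i : Fin p) :
    (∑ t ∈ Finset.Ico 0 (N + p + 1), cutoff N (fun t => e t - g t) (t - ((i : ℕ) + 1)) *
      arf φ (cutoff N fun t => e t - g t) t) ^ 2 ≤
      40 * (2 + 2 * (p * ∑ j, φ j ^ 2)) * A ^ 2 * N := by
  obtain ⟨C₁, hC₁⟩ : ∃ x : ℝ, x = 2 + 2 * (p * ∑ j, φ j ^ 2) := ⟨_, rfl⟩
  have hC1 : 1 ≤ C₁ := by
    have : 0 ≤ 2 * (p * ∑ j, φ j ^ 2) := by positivity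
    linarith
  have hN1 : (1 : ℝ) ≤ N := by exact_mod_cast hN
  have hs : √(N : ℝ) ^ 2 = N := Real.sq_sqrt (Nat.cast_nonneg N)
  obtain ⟨f, hf⟩ : ∃ f, f = cutoff N fun t => e t - g t := ⟨_, rfl⟩
  obtain ⟨e', he'⟩ : ∃ f, f = cutoff N e := ⟨_, rfl⟩
  obtain ⟨g', hg'⟩ : ∃ f, f = cutoff N g := ⟨_, rfl⟩
  have hf0 : f 0 = 0 := by rw [hf, cutoff_zero]
  have he0 : e' 0 = 0 := by rw [he', cutoff_zero]
  have hg0 : g' 0 = 0 := by rw [hg', cutoff_zero]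
  have hfe : ∀ t, f t = e' t - g' t := by
    intro t
    rw [hf, he', hg']
    simp only [cutoff]
    split_ifs <;> simp
  have hEe : energy 0 (N + p + 1) e' ≤ A * N := by
    rw [he', energy_cutoff N _ (by omega)]; exact hS.energy_le
  have hEg : energy 0 (N + p + 1) g' ≤ A := by
    rw [hg', energy_cutoff N _ (by omega)]; exact hS.fit
  have hEf : energy 0 (N + p + 1) f ≤ 4 * A * N := by
    have h := energy_le_two (a := 0) (b := N + p + 1) (x := f) (y := e') (z := fun t => - g' t)
      fun t _ _ => by rw [hfe]; ring
    have h2 : energy 0 (N + p + 1) (fun t => - g' t) = energy 0 (N + p + 1) g' := by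
      simp [energy]
    have h3 : A * 1 ≤ A * N := mul_le_mul_of_nonneg_left hN1 hA
    linarith
  rw [← hf, ← hC₁]
  -- The first term is the noise against a lagged error. The next two are boundary pieces, where the
  -- cutoff disturbs the filter. The last two contain the fit `g`, of bounded energy. Each is of
  -- order `√N` or less.
  have hsplit : ∑ t ∈ Finset.Ico 0 (N + p + 1), f (t - ((i : ℕ) + 1)) * arf φ f t =
      ∑ t ∈ Finset.Ico (p + 1) (N + 1), z t * e (t - ((i : ℕ) + 1)) +
      ∑ t ∈ Finset.Ico 0 (p + 1), e' (t - ((i : ℕ) + 1)) * arf φ e' t +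
      ∑ t ∈ Finset.Ico (N + 1) (N + p + 1), e' (t - ((i : ℕ) + 1)) * arf φ e' t -
      ∑ t ∈ Finset.Ico 0 (N + p + 1), e' (t - ((i : ℕ) + 1)) * arf φ g' t -
      ∑ t ∈ Finset.Ico 0 (N + p + 1), g' (t - ((i : ℕ) + 1)) * arf φ f t := by
    have hmid : ∑ t ∈ Finset.Ico (p + 1) (N + 1), z t * e (t - ((i : ℕ) + 1)) =
        ∑ t ∈ Finset.Ico (p + 1) (N + 1), e' (t - ((i : ℕ) + 1)) * arf φ e' t := by
      refine Finset.sum_congr rfl fun t ht => ?_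
      rw [Finset.mem_Ico] at ht
      have hlag : ∀ l ≤ p, e' (t - l) = e (t - l) := fun l hl => by
        rw [he', cutoff_of_mem e (by omega) (by omega)]
      rw [hlag _ (by omega), ← hG.filter_eq t ht.1 (by omega)]
      have h0 := hlag 0 (Nat.zero_le p)
      rw [Nat.sub_zero] at h0
      rw [mul_comm]
      congr 1
      rw [arf, arf, h0]
      congr 1
      exact Finset.sum_congr rfl fun j _ => by rw [hlag _ (by omega)]
    rw [hmid, add_comm (∑ t ∈ Finset.Ico (p + 1) (N + 1), _),
      Finset.sum_Ico_consecutive _ (Nat.zero_le _) (by omega),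
      Finset.sum_Ico_consecutive _ (Nat.zero_le _) (by omega), ← Finset.sum_sub_distrib,
      ← Finset.sum_sub_distrib]
    refine Finset.sum_congr rfl fun t _ => ?_
    have harf : arf φ f t = arf φ e' t - arf φ g' t := by
      rw [← arf_sub]
      exact congrFun (congrArg (arf φ) (funext hfe)) t
    rw [hfe, harf]
    ring
  have b1 : (∑ t ∈ Finset.Ico (p + 1) (N + 1), z t * e (t - ((i : ℕ) + 1))) ^ 2 ≤ A ^ 2 * N := by
    have := hG.cross_error i
    rw [← sq_abs]
    calc _ ≤ (A * √N) ^ 2 := pow_le_pow_left₀ (abs_nonneg _) this 2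
      _ = A ^ 2 * N := by rw [mul_pow, hs]
  have hfirst : energy 0 (p + 1) e' ≤ A := by
    rw [he']
    refine (energy_cutoff_le N 0 (p + 1) e).trans (le_trans (energy_mono e ?_ ?_) hS.first) <;> omega
  have b2 : (∑ t ∈ Finset.Ico 0 (p + 1), e' (t - ((i : ℕ) + 1)) * arf φ e' t) ^ 2 ≤
      A * (C₁ * A) := by
    refine sq_sum_mul_le_energy (u := fun t => e' (t - ((i : ℕ) + 1)))
      ((energy_shift_le_of_zero he0 _ _).trans hfirst) ?_
    refine (energy_arf_le_of_zero he0 φ _).trans ?_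
    rw [← hC₁]
    exact mul_le_mul_of_nonneg_left hfirst (by linarith)
  have hlast : energy (N + 1 - p) (N + p + 1) e' ≤ A := by
    rw [he']
    refine (energy_cutoff_le N _ _ e).trans (le_trans (energy_mono e ?_ ?_) hS.last) <;> omega
  have b3 : (∑ t ∈ Finset.Ico (N + 1) (N + p + 1), e' (t - ((i : ℕ) + 1)) * arf φ e' t) ^ 2 ≤
      A * (C₁ * A) := by
    refine sq_sum_mul_le_energy (u := fun t => e' (t - ((i : ℕ) + 1)))
      ((energy_shift_le e' (by omega)).trans hlast) ?_
    have h := energy_arf_le φ (N + 1 - p) (N + p + 1) e'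
    rw [show N + 1 - p + p = N + 1 by omega, ← hC₁] at h
    exact h.trans (mul_le_mul_of_nonneg_left hlast (by linarith))
  have b4 : (∑ t ∈ Finset.Ico 0 (N + p + 1), e' (t - ((i : ℕ) + 1)) * arf φ g' t) ^ 2 ≤
      A * N * (C₁ * A) := by
    refine sq_sum_mul_le_energy (u := fun t => e' (t - ((i : ℕ) + 1)))
      ((energy_shift_le_of_zero he0 _ _).trans hEe) ?_
    refine (energy_arf_le_of_zero hg0 φ _).trans ?_
    rw [← hC₁]
    exact mul_le_mul_of_nonneg_left hEg (by linarith)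
  have b5 : (∑ t ∈ Finset.Ico 0 (N + p + 1), g' (t - ((i : ℕ) + 1)) * arf φ f t) ^ 2 ≤
      A * (C₁ * (4 * A * N)) := by
    refine sq_sum_mul_le_energy (u := fun t => g' (t - ((i : ℕ) + 1)))
      ((energy_shift_le_of_zero hg0 _ _).trans hEg) ?_
    refine (energy_arf_le_of_zero hf0 φ _).trans ?_
    rw [← hC₁]
    exact mul_le_mul_of_nonneg_left hEf (by linarith)
  rw [hsplit]
  refine (sq_add_five_le _ _ _ _ _).trans ?_
  have k1 : A ^ 2 * N * 1 ≤ A ^ 2 * N * C₁ := mul_le_mul_of_nonneg_left hC1 (by positivity)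
  have k2 : A ^ 2 * C₁ * 1 ≤ A ^ 2 * C₁ * N := mul_le_mul_of_nonneg_left hN1 (by positivity)
  linarith

/-- Residuals differ from errors by the fit, whose energy is at most `A`; a lower bound for lagged
errors therefore passes to lagged residuals, up to a factor `2` and a bounded term. -/
lemma energy_lag_cutoff_ge (hS : SmallFit p N A e g) {c : ℝ} {x : Fin p → ℝ}
    (hc : c * (N * ∑ j, x j ^ 2) ≤
      energy (p + 1) (N + 1) (fun t => ∑ j : Fin p, x j * e (t - ((j : ℕ) + 1)))) :
    (c / 2 * N - p * A) * ∑ j, x j ^ 2 ≤ energy 0 (N + p + 1)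
      (fun t => ∑ j : Fin p, x j * cutoff N (fun t => e t - g t) (t - ((j : ℕ) + 1))) := by
  have h1 := energy_le_two (a := p + 1) (b := N + 1)
    (x := fun t => ∑ j : Fin p, x j * e (t - ((j : ℕ) + 1)))
    (y := fun t => ∑ j : Fin p, x j * cutoff N (fun t => e t - g t) (t - ((j : ℕ) + 1)))
    (z := fun t => ∑ j : Fin p, x j * cutoff N g (t - ((j : ℕ) + 1))) fun t h1 h2 => by
      rw [← Finset.sum_add_distrib]
      refine Finset.sum_congr rfl fun j _ => ?_
      rw [cutoff_of_mem _ (by omega) (by omega), cutoff_of_mem _ (by omega) (by omega)]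
      ring
  have h2 := energy_mono (a := p + 1) (b := N + 1) (a' := 0) (b' := N + p + 1)
    (fun t => ∑ j : Fin p, x j * cutoff N (fun t => e t - g t) (t - ((j : ℕ) + 1)))
    (by omega) (by omega)
  have h3 := energy_mono (a := p + 1) (b := N + 1) (a' := 0) (b' := N + p + 1)
    (fun t => ∑ j : Fin p, x j * cutoff N g (t - ((j : ℕ) + 1)))
    (by omega) (by omega)
  have h4 := energy_lag_le_of_zero (cutoff_zero N g) x (N + p + 1)
  rw [energy_cutoff N _ (by omega)] at h4
  have h5 : p * (∑ j, x j ^ 2) * energy 1 (N + 1) g ≤ p * (∑ j, x j ^ 2) * A :=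
    mul_le_mul_of_nonneg_left hS.fit (by positivity)
  linarith

end YuleWalker

/-! ### The Yule–Walker estimator and the residual variance at the true configuration -/

section Estimator

variable {T p N : ℕ} {c : RelConfig} {x : ℕ → ℝ}

/-- Padding the residuals by zero on both sides makes the Toeplitz matrix of sample autocovariances
exactly a Gram matrix of lagged sequences, with no boundary terms. -/
lemma natCast_mul_gammaHat (hN : 1 ≤ N) {f : ℕ → ℝ}
    (hf : ∀ i : Fin N, olsResid T N c x i = f (i + 1)) {k i j : ℕ} (hi : i ≤ k) (hj : j ≤ k) :
    N * gammaHat T N c x ((i : ℤ) - (j : ℤ)).natAbs =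
      ∑ t ∈ Finset.Ico 0 (N + k + 1), cutoff N f (t - i) * cutoff N f (t - j) := by
  wlog hij : j ≤ i generalizing i j
  · rw [← neg_sub, Int.natAbs_neg, this hj hi (by omega)]
    exact Finset.sum_congr rfl fun t _ => mul_comm _ _
  obtain ⟨h, rfl⟩ := Nat.exists_eq_add_of_le hij
  have hN0 : (N : ℝ) ≠ 0 := by exact_mod_cast (by omega : N ≠ 0)
  rw [show (((j + h : ℕ) : ℤ) - (j : ℤ)).natAbs = h by push_cast; omega, gammaHat,
    mul_div_cancel₀ _ hN0]
  have h1 : ∑ t ∈ Finset.Ico (j + h + 1) (j + N + 1), cutoff N f (t - (j + h)) * cutoff N f (t - j)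
      = ∑ t ∈ Finset.Ico 0 (N + k + 1), cutoff N f (t - (j + h)) * cutoff N f (t - j) := by
    refine Finset.sum_subset (Finset.Ico_subset_Ico (by omega) (by omega)) fun t _ ht => ?_
    rw [Finset.mem_Ico] at ht
    rcases Nat.lt_or_ge t (j + h + 1) with h1 | h1
    · rw [Nat.sub_eq_zero_of_le (by omega : t ≤ j + h), cutoff_zero, zero_mul]
    · rw [cutoff_of_lt (t := t - j) _ (by omega), mul_zero]
  rw [← h1, Finset.sum_Ico_eq_sum_range, show j + N + 1 - (j + h + 1) = N - h by omega,
    Finset.sum_range]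
  refine Finset.sum_congr rfl fun i _ => ?_
  have hi := i.is_lt
  rw [hf, hf, cutoff_of_mem _ (by omega) (by omega), cutoff_of_mem _ (by omega) (by omega), mul_comm]
  simp only
  congr 2 <;> omega

/-- A quadratic lower bound for the sample autocovariances and a bound for the defect in the
Yule–Walker equations control the error of the Yule–Walker estimator. -/
lemma sum_sq_phiHat_sub_le (hN : 1 ≤ N) {f : ℕ → ℝ}
    (hf : ∀ i : Fin N, olsResid T N c x i = f (i + 1)) (φ : Fin p → ℝ) {κ Q : ℝ} (hκ : 0 < κ)
    (hquad : ∀ y : Fin p → ℝ, κ * N * ∑ j, y j ^ 2 ≤ energy 0 (N + p + 1)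
      (fun t => ∑ j : Fin p, y j * cutoff N f (t - ((j : ℕ) + 1))))
    (hdef : ∀ i : Fin p, (∑ t ∈ Finset.Ico 0 (N + p + 1), cutoff N f (t - ((i : ℕ) + 1)) *
      arf φ (cutoff N f) t) ^ 2 ≤ Q * N) :
    (∑ j, (phiHat T p N c x j - φ j) ^ 2) * N ≤ p * Q / κ ^ 2 := by
  have hN0 : (0 : ℝ) < N := by exact_mod_cast (by omega : 0 < N)
  obtain ⟨G, hG⟩ : ∃ G : Matrix (Fin p) (Fin p) ℝ,
    G = Matrix.of fun i j : Fin p => gammaHat T N c x ((i : ℤ) - (j : ℤ)).natAbs := ⟨_, rfl⟩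
  have hGij : ∀ i j : Fin p, N * G i j = ∑ t ∈ Finset.Ico 0 (N + p + 1),
      cutoff N f (t - ((i : ℕ) + 1)) * cutoff N f (t - ((j : ℕ) + 1)) := by
    intro i j
    rw [hG, ← natCast_mul_gammaHat hN hf (i := (i : ℕ) + 1) (j := (j : ℕ) + 1) (by omega)
      (by omega), Matrix.of_apply]
    congr 2
    push_cast
    omega
  have hmul : ∀ (y : Fin p → ℝ) (i : Fin p), N * (G *ᵥ y) i = ∑ t ∈ Finset.Ico 0 (N + p + 1),
      cutoff N f (t - ((i : ℕ) + 1)) * ∑ j : Fin p, y j * cutoff N f (t - ((j : ℕ) + 1)) := by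
    intro y i
    simp only [Matrix.mulVec, dotProduct, Finset.mul_sum]
    rw [Finset.sum_comm]
    refine Finset.sum_congr rfl fun j _ => ?_
    rw [← mul_assoc, hGij, Finset.sum_mul]
    exact Finset.sum_congr rfl fun t _ => by ring
  have hform : ∀ y : Fin p → ℝ, N * (y ⬝ᵥ (G *ᵥ y)) = energy 0 (N + p + 1)
      (fun t => ∑ j : Fin p, y j * cutoff N f (t - ((j : ℕ) + 1))) := by
    intro y
    rw [dotProduct, Finset.mul_sum, energy]
    calc ∑ i, N * (y i * (G *ᵥ y) i) = ∑ i, y i * (N * (G *ᵥ y) i) :=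
          Finset.sum_congr rfl fun i _ => by ring
      _ = _ := by
          simp only [hmul]
          simp only [Finset.mul_sum (s := Finset.Ico 0 (N + p + 1))]
          rw [Finset.sum_comm]
          refine Finset.sum_congr rfl fun t _ => ?_
          rw [sq, Finset.sum_mul]
          exact Finset.sum_congr rfl fun i _ => by ring
  have hunit : IsUnit G.det := by
    rw [← Matrix.isUnit_iff_isUnit_det]
    refine Matrix.mulVec_injective_iff_isUnit.1 ((injective_iff_map_eq_zero G.mulVecLin).2 fun y hy => ?_)
    have h1 := hquad y
    rw [Matrix.mulVecLin_apply] at hy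
    rw [← hform y, hy, dotProduct_zero, mul_zero] at h1
    have h2 : ∑ j, y j ^ 2 ≤ 0 := by
      by_contra hcon
      have := mul_pos (mul_pos hκ hN0) (not_le.1 hcon)
      linarith
    have h3 := (Finset.sum_eq_zero_iff_of_nonneg fun _ _ => sq_nonneg _).1
      (le_antisymm h2 (Finset.sum_nonneg fun _ _ => sq_nonneg _))
    funext j
    exact pow_eq_zero_iff (two_ne_zero) |>.1 (h3 j (Finset.mem_univ j))
  obtain ⟨η, hη⟩ : ∃ η : Fin p → ℝ, η = phiHat T p N c x - φ := ⟨_, rfl⟩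
  -- As `φ̂` solves the sample equations, applying the Gram matrix to `φ̂ - φ` gives the defect of
  -- the true `φ` in these equations.
  have hYW : ∀ i, N * (G *ᵥ η) i = ∑ t ∈ Finset.Ico 0 (N + p + 1),
      cutoff N f (t - ((i : ℕ) + 1)) * arf φ (cutoff N f) t := by
    intro i
    have h1 : G *ᵥ phiHat T p N c x = fun i : Fin p => gammaHat T N c x ((i : ℕ) + 1) := by
      rw [phiHat, ← hG, Matrix.mulVec_mulVec, Matrix.mul_nonsing_inv _ hunit, Matrix.one_mulVec]
    have h2 := natCast_mul_gammaHat hN hf (k := p) (i := (i : ℕ) + 1) (j := 0) (by omega)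
      (by omega)
    rw [show (((((i : ℕ) + 1 : ℕ) : ℤ)) - ((0 : ℕ) : ℤ)).natAbs = (i : ℕ) + 1 by
      push_cast; omega] at h2
    rw [hη, Matrix.mulVec_sub, Pi.sub_apply, mul_sub, h1, h2, hmul, ← Finset.sum_sub_distrib]
    refine Finset.sum_congr rfl fun t _ => ?_
    rw [Nat.sub_zero, arf]
    ring
  have h1 := hquad η
  have hdot : N * (η ⬝ᵥ (G *ᵥ η)) = ∑ i, N * (η i * (G *ᵥ η) i) := by
    rw [dotProduct, Finset.mul_sum]
  rw [← hform, hdot] at h1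
  have h2 : (∑ i, N * (η i * (G *ᵥ η) i)) ^ 2 ≤ (∑ j, η j ^ 2) * (p * (Q * N)) := by
    calc (∑ i, N * (η i * (G *ᵥ η) i)) ^ 2 = (∑ i, η i * (N * (G *ᵥ η) i)) ^ 2 := by
          congr 1; exact Finset.sum_congr rfl fun i _ => by ring
      _ ≤ (∑ j, η j ^ 2) * ∑ i, (N * (G *ᵥ η) i) ^ 2 := Finset.sum_mul_sq_le_sq_mul_sq _ _ _
      _ ≤ (∑ j, η j ^ 2) * (p * (Q * N)) := by
          refine mul_le_mul_of_nonneg_left ?_ (Finset.sum_nonneg fun _ _ => sq_nonneg _)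
          calc _ ≤ ∑ i : Fin p, Q * N := Finset.sum_le_sum fun i _ => by rw [hYW]; exact hdef i
            _ = _ := by simp
  have hS0 : 0 ≤ ∑ j, η j ^ 2 := Finset.sum_nonneg fun _ _ => sq_nonneg _
  have hSη : ∑ j, (phiHat T p N c x j - φ j) ^ 2 = ∑ j, η j ^ 2 := by
    rw [hη]; rfl
  rw [hSη]
  obtain ⟨S, hS⟩ : ∃ S : ℝ, S = ∑ j, η j ^ 2 := ⟨_, rfl⟩
  rw [← hS] at h1 h2 hS0 ⊢
  have h3 : (κ * N * S) ^ 2 ≤ S * (p * (Q * N)) :=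
    (pow_le_pow_left₀ (by positivity) h1 2).trans h2
  rw [le_div_iff₀ (by positivity)]
  rcases hS0.eq_or_lt with h0 | h0
  · rw [← h0, zero_mul, zero_mul]
    rcases Nat.eq_zero_or_pos p with hp | hp
    · simp [hp]
    · have h5 := (sq_nonneg _).trans (hdef ⟨0, hp⟩)
      have h6 : 0 ≤ Q := by
        by_contra hcon
        have := mul_neg_of_neg_of_pos (not_le.1 hcon) hN0
        linarith
      positivity
  · have h4 : S * N * κ ^ 2 * (S * N) ≤ p * Q * (S * N) := by nlinarith
    exact le_of_mul_le_mul_right h4 (by positivity)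

lemma sample_fitMean_mem_designSpace (s : Fin T → ℝ) (μ : Fin c.m → ℝ) :
    sample N (fitMean c N s μ) ∈ designSpace T N c := by
  have h : sample N (fitMean c N s μ) = ∑ v, s v • sample N (seasonCol T v) +
      ∑ r, μ r • sample N (regimeCol c N r) := by
    ext i
    simp [sample, fitMean, PiLp.add_apply, WithLp.ofLp_sum, Finset.sum_apply]
  rw [h]
  refine add_mem (sum_mem fun v _ => Submodule.smul_mem _ _ (Submodule.subset_span ?_))
    (sum_mem fun r _ => Submodule.smul_mem _ _ (Submodule.subset_span ?_))
  · exact Or.inl ⟨v, rfl⟩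
  · exact Or.inr ⟨r, rfl⟩

lemma olsResid_fitMean_add (s : Fin T → ℝ) (μ : Fin c.m → ℝ) (e : ℕ → ℝ) :
    olsResid T N c (fun t => fitMean c N s μ t + e t) =
      sample N e - (designSpace T N c).starProjection (sample N e) := by
  have h : sample N (fun t => fitMean c N s μ t + e t) = sample N (fitMean c N s μ) + sample N e :=
    rfl
  rw [olsResid, h, map_add, Submodule.starProjection_eq_self_iff.2
    (sample_fitMean_mem_designSpace s μ)]
  abel

lemma eventually_le_mul_natCast {c : ℝ} (hc : 0 < c) (B : ℝ) : ∃ N₀ : ℕ, ∀ N ≥ N₀, B ≤ c * N := by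
  obtain ⟨n, hn⟩ := exists_nat_ge (B / c)
  refine ⟨n, fun N hN => ?_⟩
  rw [div_le_iff₀ hc] at hn
  have : (n : ℝ) ≤ N := by exact_mod_cast hN
  nlinarith

/-- At the true configuration the estimated residual variance is at most the empirical noise
variance up to `O(1 / N)`, and the ridge determinant is of polynomial order. -/
theorem exists_sigmaSqHat_true_le [NeZero T] (φ : Fin p → ℝ) (ψ : ℕ → ℝ) (Ψ : ℝ)
    (hΨ : ∀ n, ∑ k ∈ Finset.range n, |ψ k| ≤ Ψ)
    (hinv : PowerSeries.mk ψ * lagSeries φ = 1) {σ2 : ℝ} (hσ : 0 < σ2) {nu : ℝ} (hnu : 0 < nu)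
    (c : RelConfig) (s : Fin T → ℝ) (μ : Fin c.m → ℝ) :
    ∃ ε₁ : ℝ, 0 < ε₁ ∧ ∀ A : ℝ, 0 ≤ A → ∃ A' : ℝ, 0 < A' ∧ ∃ N₀ : ℕ, ∀ N ≥ N₀,
      ∀ (ε : ℝ) (qs : Finset ℕ) (z e g : ℕ → ℝ), ε ≤ ε₁ → GoodPath T φ σ2 ε A N qs z e →
        SmallFit p N A e g →
        (∀ i : Fin N, (designSpace T N c).starProjection (sample N e) i = g (i + 1)) →
        ((N : ℝ) - p) * sigmaSqHat T p N nu c (fun t => fitMean c N s μ t + e t) ≤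
          energy (p + 1) (N + 1) z + A' ∧
        (ridge T p N nu c (fun t => fitMean c N s μ t + e t)).det ≤ A' * N ^ c.m := by
  have hT : 0 < T := Nat.pos_of_ne_zero (NeZero.ne T)
  obtain ⟨c₀, hc₀, L, hreg⟩ := exists_regressor_bounds hT φ ψ Ψ hΨ hinv hσ
  -- Only lagged errors are needed here: the bound is used with `g = 0` and no jumps.
  obtain ⟨ε₁, hε₁, hreg⟩ := hreg 0 1 one_pos
  obtain ⟨C, hC, η₀, hη₀, L', hnear⟩ := exists_energy_le_energy_arf_of_near hT φ ψ Ψ hΨ hinv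
  refine ⟨ε₁, hε₁, fun A hA => ?_⟩
  obtain ⟨N₁, hreg⟩ := hreg A hA
  -- The constant `c₀ / 4` is what remains of `c₀` after half is lost in passing from errors to
  -- residuals and a further quarter pays for `p * A`. The resulting `Q` bounds `N` times the
  -- squared error of the estimator.
  obtain ⟨Q, hQ⟩ : ∃ x : ℝ, x = p * (40 * (2 + 2 * (p * ∑ j, φ j ^ 2)) * A ^ 2) / (c₀ / 4) ^ 2 :=
    ⟨_, rfl⟩
  have hQ0 : 0 ≤ Q := by rw [hQ]; positivity
  obtain ⟨N₂, hN₂⟩ := eventually_le_mul_natCast (show 0 < c₀ / 4 by positivity) (p * A)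
  obtain ⟨N₃, hN₃⟩ := eventually_le_mul_natCast hη₀ Q
  obtain ⟨Φ, hΦ⟩ : ∃ x : ℝ, x = ∑ j, |φ j| + (p + Q) := ⟨_, rfl⟩
  have hΦ0 : 0 ≤ Φ := by rw [hΦ]; positivity
  obtain ⟨A₁, hA₁⟩ : ∃ x : ℝ, x = (1 + p * A ^ 2 * Q) + p * Q * A + 1 / nu * (μ ⬝ᵥ μ) := ⟨_, rfl⟩
  obtain ⟨A₂, hA₂⟩ : ∃ x : ℝ, x = (c.m).factorial * ((1 + Φ) ^ 2 + 1 / nu) ^ c.m := ⟨_, rfl⟩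
  have hA₂0 : 0 < A₂ := by
    rw [hA₂]; have := Nat.factorial_pos c.m; positivity
  refine ⟨max A₁ A₂, lt_max_of_lt_right hA₂0, N₁ + N₂ + N₃ + T + p + L' + 1,
    fun N hN ε qs z e g hε hG hS hg => ?_⟩
  have hN0 : (0 : ℝ) < N := by exact_mod_cast (by omega : 0 < N)
  have hN1 : (1 : ℝ) ≤ N := by exact_mod_cast (by omega : 1 ≤ N)
  obtain ⟨x, hx⟩ : ∃ x : ℕ → ℝ, x = fun t => fitMean c N s μ t + e t := ⟨_, rfl⟩
  rw [← hx]
  have hf : ∀ i : Fin N, olsResid T N c x i = e (i + 1) - g (i + 1) := by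
    intro i
    rw [hx, olsResid_fitMean_add, PiLp.sub_apply, hg]
    rfl
  have hη : (∑ j, (phiHat T p N c x j - φ j) ^ 2) * N ≤ Q := by
    rw [hQ]
    refine sum_sq_phiHat_sub_le (by omega) (f := fun t => e t - g t) hf φ
      (show 0 < c₀ / 4 by positivity) (fun y => ?_) (fun i => ?_)
    · have h1 := (hreg N (by omega) ε qs z e hε hG y (fun _ => 0) ∅ (by simp) (by simp)
        (fun t _ _ h => absurd rfl h)).1
      simp only [add_zero] at h1
      have h0 : energy (p + 1) (N + 1) (fun _ => (0 : ℝ)) = 0 := by simp [energy]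
      rw [h0, add_zero] at h1
      refine le_trans ?_ (energy_lag_cutoff_ge hS h1)
      refine mul_le_mul_of_nonneg_right ?_ (Finset.sum_nonneg fun _ _ => sq_nonneg _)
      linarith [hN₂ N (by omega)]
    · exact hG.sq_sum_lag_mul_arf_le hS hA (by omega) (by omega) i
  obtain ⟨S, hSd⟩ : ∃ S : ℝ, S = ∑ j, (phiHat T p N c x j - φ j) ^ 2 := ⟨_, rfl⟩
  have hS0 : 0 ≤ S := by rw [hSd]; exact Finset.sum_nonneg fun _ _ => sq_nonneg _
  rw [← hSd] at hη
  have hSη₀ : S ≤ η₀ := by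
    have := hN₃ N (by omega)
    exact le_of_mul_le_mul_right (hη.trans this) hN0
  constructor
  · refine le_trans ?_ (add_le_add le_rfl (le_max_left A₁ A₂))
    have hAinj : ∀ s, Ahat T p N c x *ᵥ s = 0 → s = 0 := by
      refine Ahat_injective (C := C) (by omega) fun y hy => ?_
      have := hnear 1 (N + 1) y (phiHat T p N c x) (hSd ▸ hSη₀) (by omega)
        fun t ht _ => hy t (by omega)
      rwa [Nat.add_comm 1 p] at this
    -- The true means are an admissible choice, leaving the noise minus lagged errors weighted by
    -- `φ̂ - φ`. As `N * S ≤ Q`, both the cross term and the energy of the latter are bounded.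
    have h1 := sigmaSqHat_le hnu (by omega) hAinj s μ
    have h2 : energy (p + 1) (N + 1)
        (arf (phiHat T p N c x) fun t => x t - fitMean c N s μ t) =
        energy (p + 1) (N + 1) (arf (phiHat T p N c x) fun t => e t - (fun _ => (0 : ℝ)) t) := by
      congr 2
      funext t
      rw [hx]; ring
    rw [h2, hG.energy_residual_eq] at h1
    have harf0 : ∀ t, arf (phiHat T p N c x) (fun _ => (0 : ℝ)) t = 0 := fun t => by simp [arf]
    simp only [harf0, add_zero] at h1
    have h3 := hG.sq_sum_noise_lag_error_le fun j => phiHat T p N c x j - φ j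
    have h4 := energy_lag_le (fun j => phiHat T p N c x j - φ j) 1 (N + 1) e
    rw [← hSd] at h3 h4
    rw [Nat.add_comm 1 p] at h4
    have h5 : p * A ^ 2 * (N * S) ≤ p * A ^ 2 * Q := by
      rw [mul_comm (N : ℝ) S]
      exact mul_le_mul_of_nonneg_left hη (by positivity)
    have h6 : p * S * energy 1 (N + 1) e ≤ p * Q * A := by
      calc p * S * energy 1 (N + 1) e ≤ p * S * (A * N) :=
            mul_le_mul_of_nonneg_left hS.energy_le (by positivity)
        _ = p * (S * N) * A := by ring
        _ ≤ p * Q * A := by gcongr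
    have h7 := h3.trans h5
    obtain ⟨X, hX⟩ : ∃ X : ℝ, X = ∑ t ∈ Finset.Ico (p + 1) (N + 1), z t *
        ∑ j : Fin p, (phiHat T p N c x j - φ j) * e (t - ((j : ℕ) + 1)) := ⟨_, rfl⟩
    rw [← hX] at h1 h7
    have h8 : - (2 * X) ≤ 1 + X ^ 2 := by nlinarith [sq_nonneg (X + 1)]
    rw [hA₁]
    linarith [h4.trans h6]
  · have hsum : ∑ j, |phiHat T p N c x j| ≤ Φ := by
      have hSQ : S ≤ Q := by nlinarith
      calc ∑ j, |phiHat T p N c x j| ≤ ∑ j, (|φ j| + (1 + (phiHat T p N c x j - φ j) ^ 2)) := by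
            refine Finset.sum_le_sum fun j _ => ?_
            have h1 := abs_add_le (φ j) (phiHat T p N c x j - φ j)
            rw [add_sub_cancel] at h1
            have h2 : |phiHat T p N c x j - φ j| ≤ 1 + (phiHat T p N c x j - φ j) ^ 2 := by
              rw [← sq_abs (phiHat T p N c x j - φ j)]
              nlinarith [sq_nonneg (|phiHat T p N c x j - φ j| - 1),
                abs_nonneg (phiHat T p N c x j - φ j)]
            linarith
        _ = ∑ j, |φ j| + (p + S) := by
            rw [Finset.sum_add_distrib, Finset.sum_add_distrib, hSd]; simp
        _ ≤ Φ := by rw [hΦ]; linarith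
    refine (ridge_det_le hnu hsum (by omega)).trans ?_
    rw [mul_pow, ← mul_assoc, ← hA₂]
    exact mul_le_mul_of_nonneg_right (le_max_right _ _) (by positivity)

end Estimator

/-! ### The dichotomy for candidate configurations -/

section Candidates

variable {T p : ℕ} [NeZero T] {d : ℝ}

/-- For a candidate configuration, either the residual sum of squares exceeds that of the noise
by a linear amount, or each true changepoint is matched by a fitted one, and the residual sum of
squares increases linearly with the distances. -/
theorem exists_candidate_lower_bound (φ : Fin p → ℝ) (ψ : ℕ → ℝ) (Ψ : ℝ)
    (hΨ : ∀ n, ∑ k ∈ Finset.range n, |ψ k| ≤ Ψ)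
    (hinv : PowerSeries.mk ψ * lagSeries φ = 1) {σ2 : ℝ} (hσ : 0 < σ2) {nu : ℝ} (hnu : 0 < nu)
    (hd : 0 < d) (hd1 : d ≤ 1) (M : ℕ) (c₀ : RelConfig) (hM : c₀.m ≤ M) (hc₀ : c₀.Separated d)
    (s₀ : Fin T → ℝ) (mu : Fin (c₀.m + 1) → ℝ) (h0 : mu 0 = 0)
    (hmu : ∀ r : Fin c₀.m, mu r.castSucc ≠ mu r.succ) :
    ∃ c₁ : ℝ, 0 < c₁ ∧ ∃ κ : ℝ, 0 < κ ∧ ∃ ε₀ : ℝ, 0 < ε₀ ∧ ∀ A : ℝ, 0 ≤ A →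
      ∃ A' : ℝ, 0 ≤ A' ∧ ∃ N₀ : ℕ, ∀ N ≥ N₀, ∀ (qs : Finset ℕ) (z e : ℕ → ℝ),
        (∀ r, ∀ l ≤ p, c₀.tau N r + l ∈ qs) → GoodPath T φ σ2 ε₀ A N qs z e →
        ∀ c : RelConfig, c.Separated d → c.m ≤ M →
          energy (p + 1) (N + 1) z + c₁ * N ≤
            ((N : ℝ) - p) * sigmaSqHat T p N nu c (fun t => trueMean s₀ c₀ mu N t + e t) ∨
          ∃ j : Fin c₀.m → Fin c.m, StrictMono j ∧
            energy (p + 1) (N + 1) z + c₁ * ∑ r, |(c.tau N (j r) : ℝ) - c₀.tau N r| - A' ≤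
              ((N : ℝ) - p) * sigmaSqHat T p N nu c (fun t => trueMean s₀ c₀ mu N t + e t) ∧
            (κ * N) ^ c.m ≤ (ridge T p N nu c (fun t => trueMean s₀ c₀ mu N t + e t)).det := by
  have hT : 0 < T := Nat.pos_of_ne_zero (NeZero.ne T)
  obtain ⟨C, hC, η₁, hη₁, L, hnear⟩ := exists_energy_le_energy_arf_of_near hT φ ψ Ψ hΨ hinv
  obtain ⟨Δ, hΔ⟩ : ∃ Δ : Fin c₀.m → ℝ, Δ = fun r => mu r.succ - mu r.castSucc := ⟨_, rfl⟩
  have hΔ0 : ∀ r, 0 < Δ r ^ 2 := fun r => by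
    have : Δ r ≠ 0 := by rw [hΔ]; exact sub_ne_zero.2 (hmu r).symm
    positivity
  obtain ⟨W, hW⟩ : ∃ W : ℝ, W = 1 + ∑ r, 1 / Δ r ^ 2 := ⟨_, rfl⟩
  have hW1 : 1 ≤ W := by
    rw [hW]
    have := Finset.sum_nonneg (s := Finset.univ) fun r _ => (one_div_pos.2 (hΔ0 r)).le
    linarith
  have hWΔ : ∀ r, 1 ≤ W * Δ r ^ 2 := fun r => by
    have h1 := Finset.single_le_sum (f := fun r => 1 / Δ r ^ 2)
      (fun r _ => (one_div_pos.2 (hΔ0 r)).le) (Finset.mem_univ r)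
    have h2 : 1 / Δ r ^ 2 ≤ W := by rw [hW]; linarith
    rwa [div_le_iff₀ (hΔ0 r)] at h2
  obtain ⟨D, hD⟩ : ∃ D : ℝ, D = ∑ r, |Δ r| := ⟨_, rfl⟩
  have hDΔ : ∀ r, |Δ r| ≤ D := fun r => by
    rw [hD]
    exact Finset.single_le_sum (f := fun r => |Δ r|) (fun r _ => abs_nonneg _) (Finset.mem_univ r)
  have hD0 : 0 ≤ D := by rw [hD]; exact Finset.sum_nonneg fun _ _ => abs_nonneg _
  -- With no fitted changepoint within `d / 8 * N`, the mean error has energy at least `Δ ^ 2 / 2 ≥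
  -- 1 / (2 * W)` times `d / 16 * N`.
  obtain ⟨κ₁, hκ₁⟩ : ∃ x : ℝ, x = d / (32 * W) := ⟨_, rfl⟩
  obtain ⟨Ck, hCk⟩ : ∃ x : ℝ, x = c₀.m * (T + 2 * W) + 1 := ⟨_, rfl⟩
  have hκ₁0 : 0 < κ₁ := by rw [hκ₁]; positivity
  have hCk0 : 0 < Ck := by rw [hCk]; positivity
  -- The mean error may jump at fitted and at true changepoints, hence `2 * M`. Rounding to integer
  -- times is covered by replacing `d` by `d / 2`.
  obtain ⟨η₀, hη₀, hη₀₁, c₁, hc₁, ε₀, hε₀, hmain⟩ := exists_residual_lower_bound hT φ ψ Ψ hΨ hinv hσ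
    (2 * M) c₀.m (show 0 < d / 2 by positivity) (by linarith) hD0 hκ₁0 hCk0 hη₁
  refine ⟨c₁, hc₁, d / (4 * C), by positivity, ε₀, hε₀, fun A hA => ?_⟩
  obtain ⟨A', hA', N₁, hmain⟩ := hmain A hA
  obtain ⟨N₂, hN₂⟩ := eventually_le_mul_natCast hd (4 * (p + 1) + 2 * L + 16 * (1 + T) + 8)
  refine ⟨A', hA', N₁ + N₂ + p + L + 1, fun N hN qs z e hqs hG c hc hcM => ?_⟩
  have hNd := hN₂ N (by omega)
  have hp0 : (0 : ℝ) ≤ p := Nat.cast_nonneg p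
  have hL0 : (0 : ℝ) ≤ L := Nat.cast_nonneg L
  have hT0 : (0 : ℝ) ≤ T := Nat.cast_nonneg T
  obtain ⟨x, hx⟩ : ∃ x : ℕ → ℝ, x = fun t => trueMean s₀ c₀ mu N t + e t := ⟨_, rfl⟩
  rw [← hx]
  obtain ⟨s, μ, hsμ⟩ := exists_energy_le_sigmaSqHat (T := T) (c := c) (x := x) hnu
    (show p < N by omega)
  obtain ⟨u, hu⟩ : ∃ u : ℕ → ℝ, u = fun t => fitMean c N s μ t - trueMean s₀ c₀ mu N t := ⟨_, rfl⟩
  have hxu : (fun t => x t - fitMean c N s μ t) = fun t => e t - u t := by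
    funext t; rw [hx, hu]; ring
  rw [hxu] at hsμ
  have hjump : JumpsIn T T 1 N (c.times N ∪ c₀.times N) u := by
    rw [hu]; exact jumpsIn_fitMean_sub_trueMean c c₀ s s₀ μ mu h0
  obtain ⟨hcoarse, hfine⟩ := hmain N (by omega) qs z e hG (phiHat T p N c x) u
    (c.times N ∪ c₀.times N) ((Finset.card_union_le _ _).trans (by
      have := c.card_times_le N
      have := c₀.card_times_le N
      omega)) (by
      intro b hb
      rcases Finset.mem_union.1 hb with h | h <;> obtain ⟨r, rfl⟩ := RelConfig.mem_times.1 h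
      · exact hc.tau_ge (by linarith) r
      · exact hc₀.tau_ge (by linarith) r) hjump
  by_cases hφ : η₀ < ∑ j, (phiHat T p N c x j - φ j) ^ 2
  · exact Or.inl ((hcoarse (Or.inl hφ)).trans hsμ)
  rw [not_lt] at hφ
  have hE0 : 0 ≤ energy 1 (N + 1) u := energy_nonneg _ _ _
  by_cases hfar : ∃ r, ∀ j, d / 8 * N ≤ |(c.tau N j : ℝ) - c₀.tau N r|
  · obtain ⟨r, hr⟩ := hfar
    have hk := Nat.floor_le (show 0 ≤ d / 8 * (N : ℝ) by positivity)
    have hk' := Nat.lt_floor_add_one (d / 8 * (N : ℝ))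
    have h1 := le_energy_fitMean_sub_trueMean (N := N) c c₀ hd (by linarith) hc₀ s s₀ μ mu r
      (k := ⌊d / 8 * (N : ℝ)⌋₊) (by linarith) fun j => hk.trans (hr j)
    rw [← hu] at h1
    have h2 : (mu r.succ - mu r.castSucc) ^ 2 = Δ r ^ 2 := by rw [hΔ]
    rw [h2] at h1
    refine Or.inl ((hcoarse (Or.inr ?_)).trans hsμ)
    refine le_trans ?_ h1
    have h3 : d / 16 * N ≤ (⌊d / 8 * (N : ℝ)⌋₊ : ℝ) - T := by linarith
    have h4 : 1 / (2 * W) ≤ Δ r ^ 2 / 2 := by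
      rw [div_le_div_iff₀ (by positivity) (by norm_num)]
      linarith [hWΔ r]
    calc κ₁ * N = 1 / (2 * W) * (d / 16 * N) := by rw [hκ₁]; field_simp; ring
      _ ≤ Δ r ^ 2 / 2 * ((⌊d / 8 * (N : ℝ)⌋₊ : ℝ) - T) := by
        gcongr
  · push Not at hfar
    have hmin : ∀ r, ∃ j, |(c.tau N j : ℝ) - c₀.tau N r| < d / 8 * N ∧
        ∀ j', |(c.tau N j : ℝ) - c₀.tau N r| ≤ |(c.tau N j' : ℝ) - c₀.tau N r| := by
      intro r
      obtain ⟨j₁, hj₁⟩ := hfar r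
      have : Nonempty (Fin c.m) := ⟨j₁⟩
      obtain ⟨j, hj⟩ := Finite.exists_min fun j => |(c.tau N j : ℝ) - c₀.tau N r|
      exact ⟨j, (hj j₁).trans_lt hj₁, hj⟩
    choose j hjlt hjmin using hmin
    -- The same energy bound, now with the distance to the nearest fitted changepoint itself as `k`,
    -- shows that distances are at most a multiple of the energy plus one.
    have hk : ∀ r, |(c.tau N (j r) : ℝ) - c₀.tau N r| ≤ T + 2 * W * energy 1 (N + 1) u := by
      intro r
      obtain ⟨k, hk⟩ : ∃ k : ℕ, (k : ℝ) = |(c.tau N (j r) : ℝ) - c₀.tau N r| :=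
        ⟨((c.tau N (j r) : ℤ) - c₀.tau N r).natAbs, by rw [Nat.cast_natAbs]; push_cast; rfl⟩
      have h1 := le_energy_fitMean_sub_trueMean (N := N) c c₀ hd (by linarith) hc₀ s s₀ μ mu r
        (k := k) (by have := hjlt r; linarith) fun j' => by rw [hk]; exact hjmin r j'
      have h2 : (mu r.succ - mu r.castSucc) ^ 2 = Δ r ^ 2 := by rw [hΔ]
      rw [← hu, h2] at h1
      rw [← hk]
      rcases le_or_gt (k : ℝ) T with hkT | hkT
      · have : 0 ≤ 2 * W * energy 1 (N + 1) u := by positivity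
        linarith
      · have h3 := mul_le_mul_of_nonneg_right (hWΔ r) (sub_pos.2 hkT).le
        have h4 := mul_le_mul_of_nonneg_left h1 (by linarith : 0 ≤ 2 * W)
        linarith
    have hφ₁ := hφ.trans hη₀₁
    have hfd := fineDecomp_of_match (p := p) (M := 2 * M) (N := N) c c₀ hd (by linarith)
      (by linarith) (by omega) hc hc₀ s s₀ μ mu (D := D)
      (fun r => by have := hDΔ r; rwa [hΔ] at this) j qs hqs
    rw [← hu] at hfd
    refine Or.inr ⟨j, strictMono_of_match c c₀ hd (by linarith) hc hc₀ j fun r => (hjlt r).le,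
      (hfine hφ _ _ hfd ?_).trans hsμ, ?_⟩
    · refine (Finset.sum_le_sum fun r _ => hk r).trans ?_
      rw [Finset.sum_const, Finset.card_univ, Fintype.card_fin, nsmul_eq_mul, hCk]
      have h1 : 0 ≤ (c₀.m : ℝ) * (T * energy 1 (N + 1) u) := by positivity
      have h2 : 0 ≤ (c₀.m : ℝ) * (2 * W) := by positivity
      linarith
    · refine pow_le_ridge_det_of_near hC hc hd (by linarith) hnu fun y hy => ?_
      have := hnear 1 (N + 1) y (phiHat T p N c x) hφ₁ (by omega) fun t h1 h2 =>
        hy t h1 fun b hb => by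
          obtain ⟨r, rfl⟩ := RelConfig.mem_times.1 hb
          have h3 := hc.tau_ge (N := N) (by linarith) r
          have h4 : (1 : ℝ) + L ≤ c.tau N r := by linarith
          have h5 : 1 + L ≤ c.tau N r := by exact_mod_cast h4
          omega
      rwa [Nat.add_comm 1 p] at this

end Candidates

/-! ### From residual sums of squares to the criterion -/

lemma sub_div_le_log_sub_log {x y : ℝ} (hx : 0 < x) (hy : 0 < y) :
    (y - x) / y ≤ Real.log y - Real.log x := by
  rw [← Real.log_div hy.ne' hx.ne', sub_div, div_self hy.ne']
  have := Real.one_sub_inv_le_log_of_pos (div_pos hy hx)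
  rwa [inv_div] at this

/-- A linear excess of the residual sum of squares outweighs every penalty of order `log N`. -/
lemma exists_logLik_ge {σ2 c A' K : ℝ} (hσ : 0 < σ2) (hc : 0 < c) (p : ℕ) :
    ∃ N₀ : ℕ, ∀ N ≥ N₀, ∀ E Q Q₀ : ℝ, E ≤ 2 * σ2 * N → σ2 / 4 * N ≤ E → 0 < Q₀ → Q₀ ≤ E + A' →
      E + c * N ≤ Q →
      K * (1 + Real.log N) < ((N : ℝ) - p) / 2 * (Real.log Q - Real.log Q₀) := by
  -- A lower bound for the relative excess, and so for the difference of the logarithms, once `A'`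
  -- is at most half of the linear excess.
  obtain ⟨c₂, hc₂⟩ : ∃ x : ℝ, x = c / 2 / (2 * σ2 + c) := ⟨_, rfl⟩
  have hc₂0 : 0 < c₂ := by rw [hc₂]; positivity
  obtain ⟨N₁, hN₁⟩ := eventually_le_mul_natCast (half_pos hc) A'
  have hlim : Tendsto (fun x : ℝ => Real.log x / x) atTop (𝓝 0) := by
    simpa using Real.isLittleO_log_id_atTop.tendsto_div_nhds_zero
  have hlim2 : Tendsto (fun x : ℝ => K * (1 + Real.log x) / x) atTop (𝓝 0) := by
    have h1 : Tendsto (fun x : ℝ => K * (x⁻¹ + Real.log x / x)) atTop (𝓝 (K * (0 + 0))) :=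
      (tendsto_inv_atTop_zero.add hlim).const_mul K
    rw [add_zero, mul_zero] at h1
    refine h1.congr fun x => ?_
    rw [mul_div_assoc, add_div, one_div]
  have hev : ∀ᶠ N : ℕ in atTop, K * (1 + Real.log N) / N < c₂ / 4 :=
    (hlim2.comp tendsto_natCast_atTop_atTop).eventually_lt_const (by positivity)
  obtain ⟨N₂, hN₂⟩ := eventually_atTop.1 hev
  refine ⟨N₁ + N₂ + 2 * p + 1, fun N hN E Q Q₀ hE hE' hQ₀ hQ₀E hQ => ?_⟩
  have hN0 : (0 : ℝ) < N := by exact_mod_cast (by omega : 0 < N)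
  have hpN : (2 : ℝ) * p ≤ N := by exact_mod_cast (by omega : 2 * p ≤ N)
  have h1 := hN₁ N (by omega)
  have h2 := hN₂ N (by omega)
  rw [div_lt_iff₀ hN0] at h2
  have hE0 : 0 < E := lt_of_lt_of_le (by positivity) hE'
  have hcN : 0 < c * N := by positivity
  have h3 : c₂ ≤ Real.log Q - Real.log Q₀ := by
    have k1 := Real.log_le_log (by positivity) hQ
    have k2 := Real.log_le_log hQ₀ hQ₀E
    have k3 := sub_div_le_log_sub_log (x := E + A') (y := E + c * N) (by linarith) (by positivity)
    have k4 : c₂ ≤ (E + c * N - (E + A')) / (E + c * N) := by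
      rw [hc₂, div_le_div_iff₀ (by positivity) (by positivity)]
      have k5 : c / 2 * (E + c * N) ≤ c / 2 * ((2 * σ2 + c) * N) :=
        mul_le_mul_of_nonneg_left (by linarith) (by positivity)
      have k6 : c / 2 * N * (2 * σ2 + c) ≤ (E + c * N - (E + A')) * (2 * σ2 + c) :=
        mul_le_mul_of_nonneg_right (by linarith) (by positivity)
      linarith
    linarith
  calc K * (1 + Real.log N) < c₂ / 4 * N := h2
    _ = N / 4 * c₂ := by ring
    _ ≤ ((N : ℝ) - p) / 2 * (Real.log Q - Real.log Q₀) := by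
      refine mul_le_mul (by linarith) h3 hc₂0.le (by linarith)

/-- The likelihood gain is at least proportional to the excess of the residual sum of squares. -/
lemma le_logLik {σ2 c A' E Q Q₀ k B : ℝ} {N p : ℕ} (hσ : 0 < σ2) (hc : 0 < c) (hA' : 0 ≤ A')
    (hN : 0 < N) (hpN : 2 * p ≤ N) (hNA : A' ≤ σ2 / 8 * N) (hE' : σ2 / 4 * N ≤ E)
    (hk : 0 ≤ k) (hB : E + c * k ≤ B * N) (hQ₀ : 0 < Q₀) (hQ₀E : Q₀ ≤ E + A')
    (hQ : E + c * k - A' ≤ Q) :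
    c / (4 * B) * k - 8 * A' / σ2 ≤ ((N : ℝ) - p) / 2 * (Real.log Q - Real.log Q₀) := by
  have hN0 : (0 : ℝ) < N := by exact_mod_cast hN
  have hpN' : (2 : ℝ) * p ≤ N := by exact_mod_cast hpN
  have hp0 : (0 : ℝ) ≤ p := Nat.cast_nonneg p
  have hck : 0 ≤ c * k := by positivity
  have hσN : 0 < σ2 / 8 * N := by positivity
  obtain ⟨q, hq⟩ : ∃ q : ℝ, q = E + c * k - A' := ⟨_, rfl⟩
  have hq1 : σ2 / 8 * N ≤ q := by linarith
  have hq0 : 0 < q := by linarith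
  have hB0 : 0 < B := by
    by_contra hcon
    have := mul_nonpos_of_nonpos_of_nonneg (not_lt.1 hcon) hN0.le
    linarith
  have hqB : q ≤ B * N := by linarith
  have k1 := Real.log_le_log hq0 (hq ▸ hQ)
  have k2 := Real.log_le_log hQ₀ hQ₀E
  have k3 := sub_div_le_log_sub_log (x := E + A') (y := q) (by linarith) hq0
  have k4 : (q - (E + A')) / q = c * k / q - 2 * A' / q := by rw [hq, ← sub_div]; congr 1; ring
  have k5 : c * k / (B * N) ≤ c * k / q := div_le_div_of_nonneg_left hck hq0 hqB
  have k6 : 2 * A' / q ≤ 2 * A' / (σ2 / 8 * N) :=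
    div_le_div_of_nonneg_left (by positivity) hσN hq1
  have hP1 : (N : ℝ) / 4 ≤ ((N : ℝ) - p) / 2 := by linarith
  have hP2 : ((N : ℝ) - p) / 2 ≤ N / 2 := by linarith
  have hP0 : 0 ≤ ((N : ℝ) - p) / 2 := by linarith
  calc c / (4 * B) * k - 8 * A' / σ2 = N / 4 * (c * k / (B * N)) - N / 2 * (2 * A' / (σ2 / 8 * N)) := by
        field_simp
    _ ≤ ((N : ℝ) - p) / 2 * (c * k / q) - ((N : ℝ) - p) / 2 * (2 * A' / q) := by
        refine sub_le_sub ?_ ?_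
        · exact mul_le_mul hP1 k5 (by positivity) hP0
        · exact mul_le_mul hP2 k6 (by positivity) (by positivity)
    _ = ((N : ℝ) - p) / 2 * ((q - (E + A')) / q) := by rw [k4]; ring
    _ ≤ _ := mul_le_mul_of_nonneg_left (by linarith) hP0

lemma GoodPath.mono {T p : ℕ} {φ : Fin p → ℝ} {σ2 ε ε' A : ℝ} {N : ℕ} {qs : Finset ℕ}
    {z e : ℕ → ℝ} (h : GoodPath T φ σ2 ε A N qs z e) (hε : ε ≤ ε') :
    GoodPath T φ σ2 ε' A N qs z e where
  filter_eq := h.filter_eq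
  abs_sum_le := h.abs_sum_le
  abs_sum_sq_step_le a h1 h2 n hn := (h.abs_sum_sq_step_le a h1 h2 n hn).trans (by gcongr)
  abs_sum_sq_le a h1 h2 n hn := (h.abs_sum_sq_le a h1 h2 n hn).trans (by gcongr)
  near_right q hq k hk := (h.near_right q hq k hk).trans (by gcongr)
  near_left q hq k hk := (h.near_left q hq k hk).trans (by gcongr)
  cross_error := h.cross_error
  cross_noise := h.cross_noise

/-- The only order automorphism of a finite chain is the identity, so a strictly increasing matching
of equally many changepoints pairs them in order. -/
lemma StrictMono.eq_cast {m n : ℕ} (h : m = n) {j : Fin m → Fin n} (hj : StrictMono j) (r : Fin m) :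
    j r = Fin.cast h r := by
  subst h
  have hs : Function.Surjective j := Finite.injective_iff_surjective.1 hj.injective
  exact DFunLike.congr_fun (Subsingleton.elim (hj.orderIsoOfSurjective j hs) (OrderIso.refl _)) r

section Comparison

variable {T p : ℕ} [NeZero T] {d : ℝ}

/-- On good paths, every configuration whose criterion is at most that of the true one has the
right number of changepoints, at distances of order `1 / N` from the true ones. -/
theorem exists_loc_near_of_bmdl_le (φ : Fin p → ℝ) (ψ : ℕ → ℝ) (Ψ : ℝ)
    (hΨ : ∀ n, ∑ k ∈ Finset.range n, |ψ k| ≤ Ψ)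
    (hinv : PowerSeries.mk ψ * lagSeries φ = 1) {σ2 : ℝ} (hσ : 0 < σ2) {nu : ℝ} (hnu : 0 < nu)
    (hd : 0 < d) (hd1 : d ≤ 1) (M : ℕ) (c₀ : RelConfig) (hM : c₀.m ≤ M) (hc₀ : c₀.Separated d)
    (s₀ : Fin T → ℝ) (mu : Fin (c₀.m + 1) → ℝ) (h0 : mu 0 = 0)
    (hmu : ∀ r : Fin c₀.m, mu r.castSucc ≠ mu r.succ)
    {a : ℝ} {b : Fin 2 → ℝ} (ha : 0 < a) (hb : ∀ k, 0 < b k) (doc : ℕ → Finset ℕ)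
    (hdoc : ∀ k : Fin 2,
      (∀ᶠ N : ℕ in atTop, (timeClass p N (doc N) k).card = 0) ∨
      (∃ κ : ℝ, 0 < κ ∧ ∀ᶠ N : ℕ in atTop,
        κ * (N : ℝ) ≤ ((timeClass p N (doc N) k).card : ℝ))) :
    ∃ ε₀ : ℝ, 0 < ε₀ ∧ ∀ A : ℝ, 0 ≤ A → ∃ C : ℝ, ∃ N₀ : ℕ, ∀ N ≥ N₀,
      ∀ (qs : Finset ℕ) (z e g : ℕ → ℝ), (∀ r, ∀ l ≤ p, c₀.tau N r + l ∈ qs) →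
        GoodPath T φ σ2 ε₀ A N qs z e → SmallFit p N A e g →
        (∀ i : Fin N, (designSpace T N c₀).starProjection (sample N e) i = g (i + 1)) →
        ∀ c : RelConfig, c.Separated d → c.m ≤ M →
          bmdl T p nu a b (doc N) N (fun t => trueMean s₀ c₀ mu N t + e t) c ≤
            bmdl T p nu a b (doc N) N (fun t => trueMean s₀ c₀ mu N t + e t) c₀ →
          ∃ h : c₀.m = c.m, ∀ r, |c.loc (Fin.cast h r) - c₀.loc r| ≤ C / N := by
  obtain ⟨c₁, hc₁, κ, hκ, ε₁, hε₁, hlow⟩ := exists_candidate_lower_bound φ ψ Ψ hΨ hinv hσ hnu hd hd1 M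
    c₀ hM hc₀ s₀ mu h0 hmu
  obtain ⟨ε₂, hε₂, hupp⟩ := exists_sigmaSqHat_true_le φ ψ Ψ hΨ hinv hσ hnu c₀ s₀
    fun r => mu r.succ
  obtain ⟨G, hG0, Cn, hgam⟩ := exists_abs_sum_log_Gamma_le ha hb hd M doc hdoc
  obtain ⟨N₁, hgam⟩ := eventually_atTop.1 hgam
  refine ⟨min ε₁ (min ε₂ (σ2 / 4)), by positivity, fun A hA => ?_⟩
  obtain ⟨A₁, hA₁, N₂, hlow⟩ := hlow A hA
  obtain ⟨A₂, hA₂, N₃, hupp⟩ := hupp A hA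
  obtain ⟨A', hA'⟩ : ∃ x : ℝ, x = max A₁ A₂ := ⟨_, rfl⟩
  have hA'0 : 0 ≤ A' := by rw [hA']; exact le_max_of_le_left hA₁
  obtain ⟨U, hU⟩ : ∃ x : ℝ, x = M * |Real.log nu| + M * |Real.log κ| + |Real.log A₂| + 2 * G :=
    ⟨_, rfl⟩
  have hU0 : 0 ≤ U := by rw [hU]; positivity
  -- Bounds `(E + c₁ * k) / N`, because `E ≤ 2 * σ2 * N` and the total displacement `k` is at most
  -- `M * N`.
  obtain ⟨B, hB⟩ : ∃ x : ℝ, x = 2 * σ2 + c₁ * M := ⟨_, rfl⟩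
  have hB0 : 0 < B := by rw [hB]; positivity
  obtain ⟨V, hV⟩ : ∃ x : ℝ, x = (U + 8 * A' / σ2) * (4 * B / c₁) := ⟨_, rfl⟩
  obtain ⟨N₄, hlik⟩ := exists_logLik_ge (A' := A') (K := U + 2 * M) hσ hc₁ p
  obtain ⟨N₅, hN₅⟩ := eventually_le_mul_natCast (show 0 < σ2 / 8 by positivity) (A' + 1 + p * σ2)
  obtain ⟨N₆, hN₆⟩ := eventually_atTop.1 ((Real.tendsto_log_atTop.comp
    tendsto_natCast_atTop_atTop).eventually_gt_atTop (U + 8 * A' / σ2))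
  refine ⟨V + 1, N₁ + N₂ + N₃ + N₄ + N₅ + N₆ + 2 * p + 1,
    fun N hN qs z e g hqs hG hS hg c hc hcM hle => ?_⟩
  have hN0 : (0 : ℝ) < N := by exact_mod_cast (by omega : 0 < N)
  have hN1 : (1 : ℝ) ≤ N := by exact_mod_cast (by omega : 1 ≤ N)
  have hlogN : 0 ≤ Real.log N := Real.log_nonneg hN1
  have hpN : (2 : ℝ) * p ≤ N := by exact_mod_cast (by omega : 2 * p ≤ N)
  have hp0 : (0 : ℝ) ≤ p := Nat.cast_nonneg p
  obtain ⟨E, hE⟩ : ∃ E : ℝ, E = energy (p + 1) (N + 1) z := ⟨_, rfl⟩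
  have hE12 : E ≤ 2 * σ2 * N ∧ σ2 / 4 * N ≤ E := by
    have h1 := hG.abs_sum_sq_le (p + 1) (by omega) (by omega) (N - p) (by omega)
    have h2 : E = ∑ i ∈ Finset.range (N - p), z (p + 1 + i) ^ 2 := by
      rw [hE, energy, Finset.sum_Ico_eq_sum_range, show N + 1 - (p + 1) = N - p by omega]
    rw [← h2, Nat.cast_sub (by omega)] at h1
    have h3 : min ε₁ (min ε₂ (σ2 / 4)) * N ≤ σ2 / 4 * N :=
      mul_le_mul_of_nonneg_right ((min_le_right _ _).trans (min_le_right _ _)) hN0.le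
    have h4 := abs_le.1 (h1.trans h3)
    have h5 := mul_le_mul_of_nonneg_right hpN hσ.le
    have h6 : 0 ≤ p * σ2 := by positivity
    have h7 : 0 < N * σ2 := by positivity
    constructor <;> linarith [h4.1, h4.2]
  have hG₁ : GoodPath T φ σ2 ε₁ A N qs z e := hG.mono (min_le_left _ _)
  obtain ⟨x, hx⟩ : ∃ x : ℕ → ℝ, x = fun t => trueMean s₀ c₀ mu N t + e t := ⟨_, rfl⟩
  have hx' : (fun t => fitMean c₀ N s₀ (fun r => mu r.succ) t + e t) = x := by
    rw [hx]; funext t; rw [trueMean_eq_fitMean s₀ c₀ mu h0]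
  have hupp := hupp N (by omega) _ qs z e g ((min_le_right _ _).trans (min_le_left _ _)) hG hS hg
  rw [hx', ← hE] at hupp
  have hlow := fun c => hlow N (by omega) qs z e hqs hG₁ c
  rw [← hx, ← hE] at hlow
  rw [← hx] at hle
  have hNA := hN₅ N (by omega)
  have hpσ : 0 ≤ p * σ2 := by positivity
  have hA₁' : A₁ ≤ A' := by rw [hA']; exact le_max_left _ _
  have hA₂' : A₂ ≤ A' := by rw [hA']; exact le_max_right _ _
  have hpos : ∀ c : RelConfig, c.Separated d → c.m ≤ M →
      0 < ((N : ℝ) - p) * sigmaSqHat T p N nu c x := by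
    intro c hc hcM
    have hcN : 0 ≤ c₁ * N := by positivity
    rcases hlow c hc hcM with h | ⟨j, -, h, -⟩
    · linarith [hE12.2]
    · have : 0 ≤ c₁ * ∑ r, |(c.tau N (j r) : ℝ) - c₀.tau N r| := by positivity
      linarith [hE12.2]
  obtain ⟨Q, hQ⟩ : ∃ Q : ℝ, Q = ((N : ℝ) - p) * sigmaSqHat T p N nu c x := ⟨_, rfl⟩
  obtain ⟨Q₀, hQ₀⟩ : ∃ Q : ℝ, Q = ((N : ℝ) - p) * sigmaSqHat T p N nu c₀ x := ⟨_, rfl⟩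
  have hQpos : 0 < Q := hQ ▸ hpos c hc hcM
  have hQ₀pos : 0 < Q₀ := hQ₀ ▸ hpos c₀ hc₀ hM
  have hNp : (0 : ℝ) < (N : ℝ) - p := by linarith
  have hQ₀E : Q₀ ≤ E + A' := by rw [hQ₀]; linarith [hupp.1]
  have hlogQ : ∀ {s : ℝ}, 0 < ((N : ℝ) - p) * s →
      Real.log s = Real.log (((N : ℝ) - p) * s) - Real.log ((N : ℝ) - p) := fun {s} hs => by
    rw [Real.log_mul hNp.ne' (pos_of_mul_pos_right hs hNp.le).ne']; ring
  -- The factor `1 / (N - p)` in the variances and the common part of the Gamma terms cancel in the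
  -- comparison.
  have hcomp : ((N : ℝ) - p) / 2 * (Real.log Q - Real.log Q₀) ≤
      c₀.m / 2 * Real.log nu + 1 / 2 * Real.log (ridge T p N nu c₀ x).det -
      (c.m / 2 * Real.log nu + 1 / 2 * Real.log (ridge T p N nu c x).det) +
      ((c₀.m : ℝ) - c.m) * Real.log N + 2 * G := by
    have h1 := abs_le.1 (hgam N (by omega) c hc hcM)
    have h2 := abs_le.1 (hgam N (by omega) c₀ hc₀ hM)
    rw [bmdl, bmdl, hlogQ (hpos c hc hcM), hlogQ (hpos c₀ hc₀ hM), ← hQ, ← hQ₀] at hle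
    linarith [h1.1, h2.2]
  have hdet₀pos : 0 < (ridge T p N nu c₀ x).det :=
    lt_of_lt_of_le (by positivity) (pow_le_ridge_det hnu)
  have hdet₀ : Real.log (ridge T p N nu c₀ x).det ≤ |Real.log A₂| + c₀.m * Real.log N := by
    have h1 := Real.log_le_log hdet₀pos hupp.2
    rw [Real.log_mul hA₂.ne' (by positivity), Real.log_pow] at h1
    linarith [le_abs_self (Real.log A₂)]
  have hmM : (c₀.m : ℝ) ≤ M := by exact_mod_cast hM
  have hcM' : (c.m : ℝ) ≤ M := by exact_mod_cast hcM
  have hm0 : (0 : ℝ) ≤ c₀.m := Nat.cast_nonneg _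
  have hcm0 : (0 : ℝ) ≤ c.m := Nat.cast_nonneg _
  have hnu₀ : c₀.m / 2 * Real.log nu ≤ M / 2 * |Real.log nu| :=
    (mul_le_mul_of_nonneg_left (le_abs_self _) (by positivity)).trans
      (mul_le_mul_of_nonneg_right (by linarith) (abs_nonneg _))
  have hnuabs : 0 ≤ (M : ℝ) * |Real.log nu| := by positivity
  have hκabs : 0 ≤ (M : ℝ) * |Real.log κ| := by positivity
  have hAabs : 0 ≤ |Real.log A₂| := abs_nonneg _
  have hmlog : (c₀.m : ℝ) * Real.log N ≤ M * Real.log N := mul_le_mul_of_nonneg_right hmM hlogN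
  rcases hlow c hc hcM with h | ⟨j, hj, h, hdet⟩
  · exfalso
    have h1 := hlik N (by omega) E Q Q₀ hE12.1 hE12.2 hQ₀pos hQ₀E (hQ ▸ h)
    have h2 : 0 ≤ c.m / 2 * Real.log nu + 1 / 2 * Real.log (ridge T p N nu c x).det := by
      have h3 := Real.log_le_log (by positivity) (pow_le_ridge_det (T := T) (p := p) (N := N)
        (c := c) (x := x) hnu)
      rw [Real.log_pow, one_div, Real.log_inv] at h3
      linarith
    have h4 : 0 ≤ (c.m : ℝ) * Real.log N := by positivity
    have h5 : 0 ≤ U * Real.log N := by positivity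
    have h6 : 0 ≤ (M : ℝ) * Real.log N := by positivity
    rw [hU] at h1 h5
    linarith
  · have hm : c₀.m ≤ c.m := by
      have := Fintype.card_le_of_injective j hj.injective
      simpa using this
    obtain ⟨k, hk⟩ : ∃ k : ℝ, k = ∑ r, |(c.tau N (j r) : ℝ) - c₀.tau N r| := ⟨_, rfl⟩
    have hk0 : 0 ≤ k := by rw [hk]; positivity
    have htau : ∀ c : RelConfig, c.Separated d → ∀ r, (c.tau N r : ℝ) ≤ N := fun c hc r => by
      have := hc.tau_add_le (N := N) hd r
      have : 0 ≤ d * N := by positivity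
      linarith
    have hkN : k ≤ M * N := by
      rw [hk]
      calc _ ≤ ∑ r : Fin c₀.m, (N : ℝ) := Finset.sum_le_sum fun r _ => by
            have h1 := htau c hc (j r)
            have h2 := htau c₀ hc₀ r
            have h3 : (0 : ℝ) ≤ c.tau N (j r) := Nat.cast_nonneg _
            have h4 : (0 : ℝ) ≤ c₀.tau N r := Nat.cast_nonneg _
            rw [abs_le]; constructor <;> linarith
        _ = c₀.m * N := by simp
        _ ≤ M * N := by gcongr
    rw [← hk, ← hQ] at h
    have h1 := le_logLik (B := B) (Q := Q) hσ hc₁ hA'0 (by omega) (by omega : 2 * p ≤ N) (by linarith)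
      hE12.2 hk0 (by
        rw [hB]
        have := mul_le_mul_of_nonneg_left hkN hc₁.le
        linarith [hE12.1]) hQ₀pos hQ₀E (by linarith)
    have h2 := Real.log_le_log (by positivity) hdet
    rw [Real.log_pow, Real.log_mul hκ.ne' hN0.ne'] at h2
    have h3 : -(c.m / 2 * Real.log nu) ≤ M / 2 * |Real.log nu| := by
      rw [← mul_neg]
      exact (mul_le_mul_of_nonneg_left (neg_le_abs _) (by positivity)).trans
        (mul_le_mul_of_nonneg_right (by linarith) (abs_nonneg _))
    have h4 : -((c.m : ℝ) * Real.log κ) ≤ M * |Real.log κ| := by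
      rw [← mul_neg]
      exact (mul_le_mul_of_nonneg_left (neg_le_abs _) (by positivity)).trans
        (mul_le_mul_of_nonneg_right (by linarith) (abs_nonneg _))
    -- The factor `3 / 2` combines `1` from the Gamma terms with `1 / 2` from the determinant. For
    -- large `N` it excludes superfluous changepoints, and then `k` is bounded.
    have h5 : c₁ / (4 * B) * k + 3 / 2 * (((c.m : ℝ) - c₀.m) * Real.log N) ≤ U + 8 * A' / σ2 := by
      rw [hU]
      linarith
    have hk1 : 0 ≤ c₁ / (4 * B) * k := by positivity
    have heq : c₀.m = c.m := by
      by_contra hne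
      have h6 : (c₀.m : ℝ) + 1 ≤ c.m := by exact_mod_cast (by omega : c₀.m + 1 ≤ c.m)
      have h7 := hN₆ N (by omega)
      simp only [Function.comp] at h7
      have h8 : 1 * Real.log N ≤ ((c.m : ℝ) - c₀.m) * Real.log N :=
        mul_le_mul_of_nonneg_right (by linarith) hlogN
      linarith
    refine ⟨heq, fun r => ?_⟩
    have hkV : k ≤ V := by
      have h6 : ((c.m : ℝ) - c₀.m) = 0 := by rw [heq]; ring
      rw [h6, zero_mul, mul_zero, add_zero] at h5
      rw [hV]
      calc k = c₁ / (4 * B) * k * (4 * B / c₁) := by field_simp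
        _ ≤ _ := mul_le_mul_of_nonneg_right h5 (by positivity)
    have hr : |(c.tau N (j r) : ℝ) - c₀.tau N r| ≤ k := by
      rw [hk]
      exact Finset.single_le_sum (f := fun r => |(c.tau N (j r) : ℝ) - c₀.tau N r|)
        (fun r _ => abs_nonneg _) (Finset.mem_univ r)
    rw [StrictMono.eq_cast heq hj r] at hr
    have t1 := c.lt_tau_add_one N (Fin.cast heq r)
    have t2 := c.tau_le (N := N) (hd.le.trans (hc.1 (Fin.cast heq r)))
    have t3 := c₀.lt_tau_add_one N r
    have t4 := c₀.tau_le (N := N) (hd.le.trans (hc₀.1 r))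
    have hr' := abs_le.1 hr
    -- The integer times are within `k ≤ V` of each other; rounding adds at most one, hence `V + 1`.
    rw [le_div_iff₀ hN0, ← abs_of_pos hN0, ← abs_mul, sub_mul, abs_le]
    constructor <;> linarith [hr'.1, hr'.2]

end Comparison

/-! ### Events of uniformly small probability -/

section Negligible

variable {Ω : Type*} [MeasurableSpace Ω] {P : Measure Ω}

/-- The probability of the events `bad A N` is small for large `A` and `N`. -/
def Negligible (P : Measure Ω) (bad : ℝ → ℕ → Set Ω) : Prop :=
  ∀ δ : ENNReal, 0 < δ → ∀ᶠ A : ℝ in atTop, ∀ᶠ N : ℕ in atTop, P (bad A N) ≤ δ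

lemma Negligible.mono {bad bad' : ℝ → ℕ → Set Ω} (h : Negligible P bad)
    (hsub : ∀ᶠ A : ℝ in atTop, ∀ᶠ N : ℕ in atTop, bad' A N ⊆ bad A N) : Negligible P bad' := by
  intro δ hδ
  filter_upwards [h δ hδ, hsub] with A h1 h2
  filter_upwards [h1, h2] with N h3 h4
  exact (measure_mono h4).trans h3

lemma Negligible.union {bad bad' : ℝ → ℕ → Set Ω} (h : Negligible P bad)
    (h' : Negligible P bad') : Negligible P fun A N => bad A N ∪ bad' A N := by
  intro δ hδ
  have hδ2 : 0 < δ / 2 := ENNReal.half_pos hδ.ne'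
  filter_upwards [h _ hδ2, h' _ hδ2] with A h1 h2
  filter_upwards [h1, h2] with N h3 h4
  calc P (bad A N ∪ bad' A N) ≤ P (bad A N) + P (bad' A N) := measure_union_le _ _
    _ ≤ δ / 2 + δ / 2 := add_le_add h3 h4
    _ = δ := ENNReal.add_halves δ

lemma Negligible.biUnion {ι : Type*} (s : Finset ι) {bad : ι → ℝ → ℕ → Set Ω}
    (h : ∀ i ∈ s, Negligible P (bad i)) : Negligible P fun A N => ⋃ i ∈ s, bad i A N := by
  classical
  induction s using Finset.induction_on with
  | empty =>
    intro δ _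
    simp
  | insert i s _ ih =>
    simp only [Finset.set_biUnion_insert]
    exact (h i (Finset.mem_insert_self i s)).union
      (ih fun j hj => h j (Finset.mem_insert_of_mem hj))

lemma negligible_of_ae {bad : ℝ → ℕ → Set Ω} (h : ∀ A N, P (bad A N) = 0) : Negligible P bad :=
  fun δ _ => Eventually.of_forall fun A => Eventually.of_forall fun N => by simp [h A N]

lemma negligible_of_tendsto {bad : ℝ → ℕ → Set Ω} {f : ℝ → ENNReal} (hf : Tendsto f atTop (𝓝 0))
    (h : ∀ᶠ A : ℝ in atTop, ∀ᶠ N : ℕ in atTop, P (bad A N) ≤ f A) : Negligible P bad := by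
  intro δ hδ
  filter_upwards [hf.eventually_le_const hδ, h] with A h1 h2
  filter_upwards [h2] with N h3
  exact h3.trans h1

lemma tendsto_ofReal_div_sq (C : ℝ) :
    Tendsto (fun A : ℝ => ENNReal.ofReal (C / A ^ 2)) atTop (𝓝 0) := by
  have h : Tendsto (fun A : ℝ => C / A ^ 2) atTop (𝓝 0) :=
    (tendsto_pow_atTop two_ne_zero).const_div_atTop C
  have h2 := (ENNReal.continuous_ofReal.tendsto 0).comp h
  rwa [ENNReal.ofReal_zero] at h2

end Negligible

/-! ### Second moments -/

section MeanSquare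

variable {Ω : Type*} [MeasurableSpace Ω] {P : Measure Ω}

/-- The second moment of a random variable. -/
noncomputable def msq (P : Measure Ω) (f : Ω → ℝ) : ENNReal := ∫⁻ ω, ENNReal.ofReal (f ω ^ 2) ∂P

lemma msq_eq_ofReal {f : Ω → ℝ} (hf : MemLp f 2 P) : msq P f = ENNReal.ofReal (∫ ω, f ω ^ 2 ∂P) :=
  (ofReal_integral_eq_lintegral_ofReal hf.integrable_sq
    (Eventually.of_forall fun ω => sq_nonneg (f ω))).symm

lemma measure_lt_abs_le_msq {f : Ω → ℝ} (hf : AEMeasurable f P) {c C : ℝ} (hc : 0 < c)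
    (h : msq P f ≤ ENNReal.ofReal C) : P {ω | c < |f ω|} ≤ ENNReal.ofReal (C / c ^ 2) := by
  have h1 : P {ω | c < |f ω|} ≤ P {ω | ENNReal.ofReal (c ^ 2) ≤ ENNReal.ofReal (f ω ^ 2)} := by
    refine measure_mono fun ω hω => ENNReal.ofReal_le_ofReal ?_
    rw [← sq_abs (f ω)]
    exact pow_le_pow_left₀ hc.le (le_of_lt hω) 2
  refine h1.trans ?_
  rw [ENNReal.ofReal_div_of_pos (by positivity)]
  exact (meas_ge_le_lintegral_div (hf.pow_const 2).ennreal_ofReal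
    (by simpa using hc.ne') ENNReal.ofReal_ne_top).trans (ENNReal.div_le_div_right h _)

/-- Fatou's lemma. With values in `ENNReal`, no integrability of the limit has to be known
beforehand. -/
lemma msq_le_of_tendsto {f : ℕ → Ω → ℝ} {g : Ω → ℝ} (hf : ∀ n, AEMeasurable (f n) P)
    (hlim : ∀ᵐ ω ∂P, Tendsto (fun n => f n ω) atTop (𝓝 (g ω))) {C : ENNReal}
    (h : ∀ᶠ n in atTop, msq P (f n) ≤ C) : msq P g ≤ C := by
  have h1 : msq P g ≤ ∫⁻ ω, liminf (fun n => ENNReal.ofReal (f n ω ^ 2)) atTop ∂P := by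
    refine lintegral_mono_ae (hlim.mono fun ω hω => le_of_eq ?_)
    exact (((ENNReal.continuous_ofReal.tendsto _).comp (hω.pow 2)).liminf_eq).symm
  refine h1.trans ((lintegral_liminf_le' fun n => ((hf n).pow_const 2).ennreal_ofReal).trans ?_)
  exact liminf_le_of_frequently_le' h.frequently

/-- Cauchy–Schwarz with weights `|w i|`. The bound depends on the weights through the sum of `|w i|`
only, so it is uniform over the partial sums of an absolutely summable series. -/
lemma msq_sum_mul_le {ι : Type*} (s : Finset ι) (w : ι → ℝ) (y : ι → Ω → ℝ)
    (hy : ∀ i ∈ s, AEMeasurable (y i) P) {C W : ℝ} (hC : 0 ≤ C) (hW : ∑ i ∈ s, |w i| ≤ W)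
    (h : ∀ i ∈ s, msq P (y i) ≤ ENNReal.ofReal C) :
    msq P (fun ω => ∑ i ∈ s, w i * y i ω) ≤ ENNReal.ofReal (W ^ 2 * C) := by
  have hW0 : 0 ≤ W := (Finset.sum_nonneg fun _ _ => abs_nonneg _).trans hW
  have hpt : ∀ ω, ENNReal.ofReal ((∑ i ∈ s, w i * y i ω) ^ 2) ≤
      ENNReal.ofReal W * ∑ i ∈ s, ENNReal.ofReal |w i| * ENNReal.ofReal (y i ω ^ 2) := by
    intro ω
    have h1 : ∑ i ∈ s, ENNReal.ofReal |w i| * ENNReal.ofReal (y i ω ^ 2) =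
        ENNReal.ofReal (∑ i ∈ s, |w i| * y i ω ^ 2) := by
      rw [ENNReal.ofReal_sum_of_nonneg fun i _ => by positivity]
      exact Finset.sum_congr rfl fun i _ => (ENNReal.ofReal_mul (abs_nonneg _)).symm
    rw [h1, ← ENNReal.ofReal_mul hW0]
    refine ENNReal.ofReal_le_ofReal ?_
    have h2 := Finset.sum_sq_le_sum_mul_sum_of_sq_le_mul s (r := fun i => w i * y i ω)
      (f := fun i => |w i|) (g := fun i => |w i| * y i ω ^ 2) (fun i _ => abs_nonneg _)
      (fun i _ => by positivity) fun i _ => by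
        rw [mul_pow, ← sq_abs (w i)]; exact le_of_eq (by ring)
    refine h2.trans (mul_le_mul_of_nonneg_right hW (Finset.sum_nonneg fun i _ => by positivity))
  calc msq P (fun ω => ∑ i ∈ s, w i * y i ω)
      ≤ ∫⁻ ω, ENNReal.ofReal W * ∑ i ∈ s, ENNReal.ofReal |w i| * ENNReal.ofReal (y i ω ^ 2) ∂P :=
        lintegral_mono hpt
    _ = ENNReal.ofReal W * ∑ i ∈ s, ENNReal.ofReal |w i| * msq P (y i) := by
        rw [lintegral_const_mul' _ _ ENNReal.ofReal_ne_top, lintegral_finsetSum' _ fun i hi =>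
          (((hy i hi).pow_const 2).ennreal_ofReal).const_mul _]
        congr 1
        exact Finset.sum_congr rfl fun i _ => lintegral_const_mul' _ _ ENNReal.ofReal_ne_top
    _ ≤ ENNReal.ofReal W * ∑ i ∈ s, ENNReal.ofReal |w i| * ENNReal.ofReal C := by
        gcongr with i hi
        exact h i hi
    _ = ENNReal.ofReal (W * ((∑ i ∈ s, |w i|) * C)) := by
        rw [← Finset.sum_mul, ENNReal.ofReal_mul hW0, ENNReal.ofReal_mul
          (Finset.sum_nonneg fun _ _ => abs_nonneg _),
          ENNReal.ofReal_sum_of_nonneg fun _ _ => abs_nonneg _]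
    _ ≤ ENNReal.ofReal (W ^ 2 * C) := by
        refine ENNReal.ofReal_le_ofReal ?_
        rw [sq, mul_assoc]
        gcongr

lemma integral_sum_mul_sq {ι : Type*} (s : Finset ι) (a : ι → ℝ) {y : ι → Ω → ℝ}
    (hy : ∀ i, MemLp (y i) 2 P) {v : ℝ} (hv : ∀ i, ∫ ω, y i ω ^ 2 ∂P = v)
    (horth : ∀ i j, i ≠ j → ∫ ω, y i ω * y j ω ∂P = 0) :
    ∫ ω, (∑ i ∈ s, a i * y i ω) ^ 2 ∂P = v * ∑ i ∈ s, a i ^ 2 := by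
  classical
  have hint : ∀ i j, Integrable (fun ω => y i ω * y j ω) P := fun i j => (hy i).integrable_mul (hy j)
  have h1 : ∀ ω, (∑ i ∈ s, a i * y i ω) ^ 2 =
      ∑ i ∈ s, ∑ j ∈ s, a i * a j * (y i ω * y j ω) := by
    intro ω
    rw [sq, Finset.sum_mul_sum]
    exact Finset.sum_congr rfl fun i _ => Finset.sum_congr rfl fun j _ => by ring
  simp only [h1]
  rw [integral_finsetSum _ fun i _ => integrable_finsetSum _ fun j _ => (hint i j).const_mul _,
    Finset.mul_sum]
  refine Finset.sum_congr rfl fun i hi => ?_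
  rw [integral_finsetSum _ fun j _ => (hint i j).const_mul _, Finset.sum_eq_single i]
  · rw [integral_const_mul]
    have : ∫ ω, y i ω * y i ω ∂P = v := by rw [← hv i]; simp only [sq]
    rw [this]; ring
  · intro j _ hj
    rw [integral_const_mul, horth i j hj.symm, mul_zero]
  · exact fun h => absurd hi h

end MeanSquare

/-! ### Moments and maximal inequality for the noise -/

section Noise

variable {Ω : Type*} [MeasurableSpace Ω] {P : Measure Ω} {Z : ℤ → Ω → ℝ} {σ2 : ℝ}

namespace IsIIDNoise

lemma memLp' (h : IsIIDNoise P Z σ2) (t : ℤ) : MemLp (Z t) 2 P :=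
  (h.ident t).memLp_iff.2 h.memLp

lemma integral_eq (h : IsIIDNoise P Z σ2) (t : ℤ) : ∫ ω, Z t ω ∂P = 0 :=
  (h.ident t).integral_eq.trans h.mean_zero

lemma integral_sq [IsProbabilityMeasure P] (h : IsIIDNoise P Z σ2) (t : ℤ) : ∫ ω, Z t ω ^ 2 ∂P = σ2 := by
  rw [← variance_of_integral_eq_zero (h.memLp' t).aestronglyMeasurable.aemeasurable
    (h.integral_eq t), (h.ident t).variance_eq, h.variance_eq]

lemma integral_mul (h : IsIIDNoise P Z σ2) {s t : ℤ} (hst : s ≠ t) :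
    ∫ ω, Z s ω * Z t ω ∂P = 0 := by
  rw [(h.indep.indepFun hst).integral_fun_mul_eq_mul_integral (h.memLp' s).aestronglyMeasurable
    (h.memLp' t).aestronglyMeasurable, h.integral_eq s, zero_mul]

lemma nonneg [IsProbabilityMeasure P] (h : IsIIDNoise P Z σ2) : 0 ≤ σ2 := by
  rw [← h.integral_sq 0]; exact integral_nonneg fun ω => sq_nonneg _

lemma msq_sum [IsProbabilityMeasure P] (h : IsIIDNoise P Z σ2) {ι : Type*} (s : Finset ι) (a : ι → ℝ) {f : ι → ℤ}
    (hf : Function.Injective f) :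
    msq P (fun ω => ∑ i ∈ s, a i * Z (f i) ω) = ENNReal.ofReal (σ2 * ∑ i ∈ s, a i ^ 2) := by
  rw [msq_eq_ofReal (memLp_finsetSum s fun i _ => (h.memLp' (f i)).const_mul (a i)),
    integral_sum_mul_sq s a (fun i => h.memLp' (f i)) (fun i => h.integral_sq (f i))
      fun i j hij => h.integral_mul (hf.ne hij)]

/-- Kolmogorov's maximal inequality. -/
lemma measure_exists_le_abs_sum [IsProbabilityMeasure P] (h : IsIIDNoise P Z σ2) (hm : ∀ t, Measurable (Z t)) {f : ℕ → ℤ}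
    (hf : Function.Injective f) {c : ℝ} (hc : 0 < c) (n : ℕ) :
    P {ω | ∃ k ≤ n, c < |∑ i ∈ Finset.range k, Z (f i) ω|} ≤ ENNReal.ofReal (n * σ2 / c ^ 2) := by
  obtain ⟨X, hX⟩ : ∃ X : ℕ → Ω → ℝ, X = fun i => Z (f i) := ⟨_, rfl⟩
  have hXi : ∀ i ω, Z (f i) ω = X i ω := fun i ω => by rw [hX]
  have hXm : ∀ i, StronglyMeasurable (X i) := fun i => by
    rw [hX]; exact (hm (f i)).stronglyMeasurable
  have hXL : ∀ i, MemLp (X i) 2 P := fun i => by rw [hX]; exact h.memLp' (f i)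
  have hXI : iIndepFun X P := by rw [hX]; exact h.indep.precomp hf
  obtain ⟨S, hS⟩ : ∃ S : ℕ → Ω → ℝ, S = fun k ω => ∑ i ∈ Finset.range (k + 1), X i ω := ⟨_, rfl⟩
  have hSL : ∀ k, MemLp (S k) 2 P := fun k => by
    rw [hS]; exact memLp_finsetSum _ fun i _ => hXL i
  have hSadp : StronglyAdapted (Filtration.natural X hXm) S := by
    intro k
    rw [hS]
    refine Finset.stronglyMeasurable_fun_sum _ fun i hi => ?_
    exact ((Filtration.stronglyAdapted_natural hXm) i).mono
      ((Filtration.natural X hXm).mono (by rw [Finset.mem_range] at hi; omega))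
  have hcond : ∀ k, P[S (k + 1) | Filtration.natural X hXm k] =ᵐ[P] S k := by
    intro k
    have h1 : S (k + 1) = S k + X (k + 1) := by
      funext ω; rw [hS]; simp [Finset.sum_range_succ _ (k + 1)]
    rw [h1]
    refine (condExp_add ((hSL k).integrable one_le_two) ((hXL (k + 1)).integrable one_le_two)
      _).trans ?_
    have h2 := hXI.condExp_natural_ae_eq_of_lt hXm (Nat.lt_succ_self k)
    rw [condExp_of_stronglyMeasurable (Filtration.le _ _) (hSadp k)
      ((hSL k).integrable one_le_two)]
    filter_upwards [h2] with ω hω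
    have h3 : ∫ ω, X (k + 1) ω ∂P = 0 := by rw [hX]; exact h.integral_eq _
    rw [Pi.add_apply, hω, h3, add_zero]
  -- The partial sums form a martingale for the natural filtration, so their squares form a
  -- submartingale by the conditional Jensen inequality; Doob's maximal inequality applies to these.
  have hsub : Submartingale (fun k ω => S k ω ^ 2) (Filtration.natural X hXm) P := by
    refine submartingale_nat (fun k => (hSadp k).pow 2) (fun k => (hSL k).integrable_sq) fun k => ?_
    have h1 := (even_two.convexOn_pow (𝕜 := ℝ) (n := 2)).map_condExp_le_univ
      (Filtration.le (Filtration.natural X hXm) k) (continuous_pow 2).lowerSemicontinuous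
      ((hSL (k + 1)).integrable one_le_two) (hSL (k + 1)).integrable_sq
    filter_upwards [h1, hcond k] with ω hω1 hω2
    rw [Function.comp_apply, hω2] at hω1
    exact hω1
  rcases n with _ | n
  · have : {ω | ∃ k ≤ 0, c < |∑ i ∈ Finset.range k, Z (f i) ω|} = ∅ := by
      ext ω; simp [hc.le]
    rw [this, measure_empty]; exact bot_le
  have hmax := maximal_ineq hsub (fun k ω => sq_nonneg (S k ω)) (ε := (c ^ 2).toNNReal) n
  have hc2 : 0 < c ^ 2 := by positivity
  have hsubset : {ω | ∃ k ≤ n + 1, c < |∑ i ∈ Finset.range k, Z (f i) ω|} ⊆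
      {ω | (((c ^ 2).toNNReal : NNReal) : ℝ) ≤ (Finset.range (n + 1)).sup'
        Finset.nonempty_range_add_one fun k => S k ω ^ 2} := by
    rintro ω ⟨k, hk, hck⟩
    rcases k with _ | k
    · simp at hck; linarith
    rw [Set.mem_ofPred_eq, Real.coe_toNNReal _ hc2.le, Finset.le_sup'_iff]
    refine ⟨k, Finset.mem_range.2 (by omega), ?_⟩
    have : S k ω = ∑ i ∈ Finset.range (k + 1), Z (f i) ω := by rw [hS, hX]
    rw [this, ← sq_abs (∑ i ∈ Finset.range (k + 1), Z (f i) ω)]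
    exact pow_le_pow_left₀ hc.le hck.le 2
  have hint : ∫ ω, S n ω ^ 2 ∂P = (n + 1 : ℕ) * σ2 := by
    have h1 := integral_sum_mul_sq (P := P) (Finset.range (n + 1)) (fun _ => (1 : ℝ)) hXL (v := σ2)
      (fun i => by rw [hX]; exact h.integral_sq _)
      (fun i j hij => by rw [hX]; exact h.integral_mul (hf.ne hij))
    simp only [one_mul, one_pow, Finset.sum_const, Finset.card_range, nsmul_eq_mul, mul_one] at h1
    rw [hS]
    rw [h1, mul_comm]
  have hle := hmax.trans (ENNReal.ofReal_le_ofReal (setIntegral_le_integral (hSL n).integrable_sq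
    (Eventually.of_forall fun ω => sq_nonneg _)))
  rw [hint] at hle
  rw [ENNReal.ofReal_div_of_pos hc2, ENNReal.le_div_iff_mul_le (by left; simpa using hc.ne')
    (by left; exact ENNReal.ofReal_ne_top), mul_comm]
  refine le_trans ?_ hle
  gcongr
  exact le_of_eq rfl

end IsIIDNoise

end Noise

/-! ### Uniform bounds and laws of large numbers for partial sums -/

section Uniform

variable {Ω : Type*} [MeasurableSpace Ω] {P : Measure Ω} [IsProbabilityMeasure P]
  {Z : ℤ → Ω → ℝ} {σ2 : ℝ}

/-- Partial sums of the noise along any sequence of times stay below a line of small slope and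
large intercept, with high probability. -/
lemma IsIIDNoise.exists_measure_sum_gt_line_le (h : IsIIDNoise P Z σ2)
    (hm : ∀ t, Measurable (Z t)) {ε : ℝ} (hε : 0 < ε) :
    ∃ Φ : ℝ → ENNReal, Tendsto Φ atTop (𝓝 0) ∧ ∀ A > 0, ∀ f : ℕ → ℤ, Function.Injective f →
      P {ω | ∃ k : ℕ, ε * k + A < |∑ i ∈ Finset.range k, Z (f i) ω|} ≤ Φ A := by
  have hσ := h.nonneg
  -- `F A j` is Kolmogorov's bound for crossing the line at some `k` in the dyadic block ending at
  -- `2 ^ j`, where the line lies above `ε / 2 * 2 ^ j + A`. A geometric series dominates these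
  -- bounds for all `A > 0`, so their sum tends to zero as `A` grows.
  obtain ⟨F, hF⟩ : ∃ F : ℝ → ℕ → ℝ,
    F = fun A j => ((2 ^ j : ℕ) : ℝ) * σ2 / (ε / 2 * (2 ^ j : ℕ) + A) ^ 2 := ⟨_, rfl⟩
  have hF0 : ∀ A j, 0 ≤ F A j := fun A j => by rw [hF]; positivity
  have hbound : ∀ A, 0 < A → ∀ j, F A j ≤ 4 * σ2 / ε ^ 2 * (1 / 2) ^ j := by
    intro A hA j
    rw [hF]
    have h1 : ((2 ^ j : ℕ) : ℝ) * σ2 / (ε / 2 * (2 ^ j : ℕ) + A) ^ 2 ≤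
        ((2 ^ j : ℕ) : ℝ) * σ2 / (ε / 2 * (2 ^ j : ℕ)) ^ 2 := by
      refine div_le_div_of_nonneg_left (by positivity) (by positivity) ?_
      exact pow_le_pow_left₀ (by positivity) (by linarith) 2
    refine h1.trans (le_of_eq ?_)
    rw [one_div, inv_pow]
    push_cast
    field_simp
    norm_num
  have hsummable : Summable fun j : ℕ => 4 * σ2 / ε ^ 2 * (1 / 2 : ℝ) ^ j :=
    summable_geometric_two.mul_left _
  have hFs : ∀ A, 0 < A → Summable (F A) := fun A hA =>
    Summable.of_nonneg_of_le (hF0 A) (hbound A hA) hsummable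
  have hlim : Tendsto (fun A => ∑' j, F A j) atTop (𝓝 (∑' _ : ℕ, (0 : ℝ))) := by
    refine tendsto_tsum_of_dominated_convergence hsummable (fun j => ?_) ?_
    · rw [hF]
      refine Tendsto.const_div_atTop ?_ _
      exact (tendsto_pow_atTop two_ne_zero).comp (tendsto_atTop_add_const_left _ _ tendsto_id)
    · filter_upwards [eventually_gt_atTop 0] with A hA j
      rw [Real.norm_of_nonneg (hF0 A j)]
      exact hbound A hA j
  rw [tsum_zero] at hlim
  refine ⟨fun A => ENNReal.ofReal (∑' j, F A j), ?_, fun A hA f hf => ?_⟩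
  · have := (ENNReal.continuous_ofReal.tendsto 0).comp hlim
    rwa [ENNReal.ofReal_zero] at this
  · simp only [ENNReal.ofReal_tsum_of_nonneg (hF0 A) (hFs A hA)]
    have hsub : {ω | ∃ k : ℕ, ε * k + A < |∑ i ∈ Finset.range k, Z (f i) ω|} ⊆
        ⋃ j : ℕ, {ω | ∃ k ≤ 2 ^ j, ε / 2 * (2 ^ j : ℕ) + A <
          |∑ i ∈ Finset.range k, Z (f i) ω|} := by
      rintro ω ⟨k, hk⟩
      rcases Nat.eq_zero_or_pos k with rfl | hk0
      · simp at hk; linarith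
      refine Set.mem_iUnion.2 ⟨Nat.log 2 k + 1, k, (Nat.lt_pow_succ_log_self one_lt_two k).le, ?_⟩
      refine lt_of_le_of_lt ?_ hk
      have h1 : ((2 ^ Nat.log 2 k : ℕ) : ℝ) ≤ k := by
        exact_mod_cast Nat.pow_log_le_self 2 hk0.ne'
      have h2 := mul_le_mul_of_nonneg_left h1 hε.le
      push_cast at h2 ⊢
      rw [pow_succ]
      linarith
    refine (measure_mono hsub).trans ((measure_iUnion_le _).trans ?_)
    refine ENNReal.tsum_le_tsum fun j => ?_
    rw [hF]
    exact h.measure_exists_le_abs_sum hm hf (by positivity) _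

/-- From some index on, convergence of the averages gives the bound with `n ≤ N`; the finitely many
earlier deviations are bounded and are eventually below `ε * N`. -/
lemma eventually_forall_abs_sub_le {y : ℕ → ℝ} {c ε : ℝ} (hε : 0 < ε)
    (h : Tendsto (fun n : ℕ => y n / n) atTop (𝓝 c)) (hy0 : y 0 = 0) :
    ∀ᶠ N : ℕ in atTop, ∀ n ≤ N, |y n - n * c| ≤ ε * N := by
  obtain ⟨n₀, hn₀⟩ := eventually_atTop.1 (Metric.tendsto_nhds.1 h ε hε)
  obtain ⟨B, hB⟩ : ∃ B : ℝ, B = ∑ n ∈ Finset.range n₀, |y n - n * c| := ⟨_, rfl⟩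
  obtain ⟨N₁, hN₁⟩ := eventually_le_mul_natCast hε B
  filter_upwards [eventually_ge_atTop N₁] with N hN n hn
  rcases Nat.lt_or_ge n n₀ with hlt | hge
  · refine le_trans ?_ (hN₁ N hN)
    rw [hB]
    exact Finset.single_le_sum (f := fun n : ℕ => |y n - n * c|) (fun _ _ => abs_nonneg _)
      (Finset.mem_range.2 hlt)
  · rcases Nat.eq_zero_or_pos n with rfl | hpos
    · simp [hy0]; positivity
    have h1 := hn₀ n hge
    rw [Real.dist_eq] at h1
    have hn0 : (0 : ℝ) < n := by exact_mod_cast hpos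
    have h2 : y n - n * c = (y n / n - c) * n := by field_simp
    rw [h2, abs_mul, abs_of_pos hn0]
    have h3 : (n : ℝ) ≤ N := by exact_mod_cast hn
    exact mul_le_mul h1.le h3 hn0.le hε.le

/-- A law of large numbers for the squared noise, uniform over the partial sums. -/
lemma IsIIDNoise.tendsto_measure_sum_sq (h : IsIIDNoise P Z σ2) (hm : ∀ t, Measurable (Z t))
    {f : ℕ → ℤ} (hf : Function.Injective f) {ε : ℝ} (hε : 0 < ε) :
    Tendsto (fun N : ℕ => P {ω | ∃ n ≤ N,
      ε * N < |∑ i ∈ Finset.range n, Z (f i) ω ^ 2 - n * σ2|}) atTop (𝓝 0) := by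
  have hsq : Measurable fun x : ℝ => x ^ 2 := measurable_id.pow_const 2
  have hslln := strong_law_ae_real (μ := P) (fun i ω => Z (f i) ω ^ 2)
    (h.memLp' (f 0)).integrable_sq
    (fun i j hij => (h.indep.indepFun (hf.ne hij)).comp hsq hsq)
    (fun i => ((h.ident (f i)).trans (h.ident (f 0)).symm).comp hsq)
  rw [show ∫ ω, (fun i ω => Z (f i) ω ^ 2) 0 ω ∂P = σ2 from h.integral_sq (f 0)] at hslln
  rw [← measure_empty (μ := P)]
  refine tendsto_measure_of_ae_tendsto_indicator_of_isFiniteMeasure atTop MeasurableSet.empty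
    (fun N => ?_) (hslln.mono fun ω hω => ?_)
  · have hset : {ω | ∃ n ≤ N, ε * N < |∑ i ∈ Finset.range n, Z (f i) ω ^ 2 - n * σ2|} =
        ⋃ n ∈ Finset.range (N + 1),
          {ω | ε * N < |∑ i ∈ Finset.range n, Z (f i) ω ^ 2 - n * σ2|} := by
      ext ω; simp
    rw [hset]
    refine Finset.measurableSet_biUnion _ fun n _ => measurableSet_lt measurable_const ?_
    refine Measurable.abs (Measurable.sub_const (Finset.measurable_fun_sum _ fun i _ => ?_) _)
    exact (hm (f i)).pow_const 2
  · filter_upwards [eventually_forall_abs_sub_le hε hω (by simp)] with N hN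
    simp only [Set.mem_empty_iff_false, iff_false, not_exists, not_and, not_lt]
    exact hN

end Uniform

/-! ### Products of the noise at different times -/

section Products

variable {Ω : Type*} [MeasurableSpace Ω] {P : Measure Ω}
  {Z : ℤ → Ω → ℝ} {σ2 : ℝ}

namespace IsIIDNoise

/-- By independence the product has a finite second moment although no fourth moment of the noise is
assumed. -/
lemma integral_mul_sq [IsProbabilityMeasure P] (h : IsIIDNoise P Z σ2) {s t : ℤ} (hst : s ≠ t) :
    MemLp (fun ω => Z s ω * Z t ω) 2 P ∧ ∫ ω, (Z s ω * Z t ω) ^ 2 ∂P = σ2 ^ 2 := by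
  have hsq : Measurable fun x : ℝ => x ^ 2 := measurable_id.pow_const 2
  have hind : IndepFun (fun ω => Z s ω ^ 2) (fun ω => Z t ω ^ 2) P :=
    (h.indep.indepFun hst).comp hsq hsq
  have heq : (fun ω => (Z s ω * Z t ω) ^ 2) = (fun ω => Z s ω ^ 2) * fun ω => Z t ω ^ 2 := by
    funext ω; simp [mul_pow]
  constructor
  · refine (memLp_two_iff_integrable_sq ((h.memLp' s).aestronglyMeasurable.mul
      (h.memLp' t).aestronglyMeasurable)).2 ?_
    simp only [Pi.mul_apply]
    rw [heq]
    exact hind.integrable_mul (h.memLp' s).integrable_sq (h.memLp' t).integrable_sq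
  · rw [heq, hind.integral_mul_eq_mul_integral (h.memLp' s).integrable_sq.aestronglyMeasurable
      (h.memLp' t).integrable_sq.aestronglyMeasurable, h.integral_sq, h.integral_sq, sq]

/-- If `s < t`, the factor at the latest time `t` is independent of the other three, whose times
`s`, `s - l`, `t - l` all precede `t`, and it has mean zero. -/
lemma integral_lag_mul (h : IsIIDNoise P Z σ2) {l : ℤ} (hl : 0 < l) {s t : ℤ} (hst : s ≠ t) :
    ∫ ω, (Z s ω * Z (s - l) ω) * (Z t ω * Z (t - l) ω) ∂P = 0 := by
  wlog hlt : s < t generalizing s t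
  · rw [← this hst.symm (by omega)]
    exact integral_congr_ae (Eventually.of_forall fun ω => mul_comm _ _)
  have hm : ∀ t, AEMeasurable (Z t) P := fun t => (h.memLp' t).aestronglyMeasurable.aemeasurable
  have hI := h.indep.indepFun_finset₀ {s, s - l, t - l} {t} (by
    simp only [Finset.disjoint_singleton_right, Finset.mem_insert, Finset.mem_singleton]
    omega) hm
  have hm1 : Measurable fun x : (({s, s - l, t - l} : Finset ℤ) → ℝ) =>
      x ⟨s, by simp⟩ * x ⟨s - l, by simp⟩ * x ⟨t - l, by simp⟩ := by fun_prop
  have hm2 : Measurable fun x : (({t} : Finset ℤ) → ℝ) => x ⟨t, by simp⟩ := by fun_prop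
  have h1 := hI.comp hm1 hm2
  have h2 := h1.integral_fun_mul_eq_mul_integral
    (((hm s).mul (hm (s - l))).mul (hm (t - l))).aestronglyMeasurable
    (hm t).aestronglyMeasurable
  have h3 : ∫ ω, (Z s ω * Z (s - l) ω) * (Z t ω * Z (t - l) ω) ∂P =
      ∫ ω, (Z s ω * Z (s - l) ω * Z (t - l) ω) * Z t ω ∂P :=
    integral_congr_ae (Eventually.of_forall fun ω => by ring)
  rw [h3]
  refine h2.trans ?_
  rw [show ∫ ω, ((fun x : ((({t} : Finset ℤ)) → ℝ) => x ⟨t, by simp⟩) ∘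
    fun a (i : ({t} : Finset ℤ)) => Z i a) ω ∂P = 0 from h.integral_eq t, mul_zero]

lemma msq_sum_lag_mul [IsProbabilityMeasure P] (h : IsIIDNoise P Z σ2) {ι : Type*} (s : Finset ι) {f : ι → ℤ}
    (hf : Function.Injective f) {l : ℤ} (hl : 0 < l) :
    msq P (fun ω => ∑ i ∈ s, Z (f i) ω * Z (f i - l) ω) = ENNReal.ofReal (s.card * σ2 ^ 2) := by
  have hL : ∀ i, MemLp (fun ω => Z (f i) ω * Z (f i - l) ω) 2 P := fun i =>
    (h.integral_mul_sq (by omega)).1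
  rw [msq_eq_ofReal (memLp_finsetSum s fun i _ => hL i)]
  have h1 := integral_sum_mul_sq (P := P) s (fun _ => (1 : ℝ)) hL (v := σ2 ^ 2)
    (fun i => (h.integral_mul_sq (by omega)).2) fun i j hij => h.integral_lag_mul hl (hf.ne hij)
  simp only [one_mul, one_pow, Finset.sum_const, nsmul_eq_mul, mul_one] at h1
  rw [h1, mul_comm]

end IsIIDNoise

end Products

/-! ### Causal representations -/

section Causal

variable {Ω : Type*} [MeasurableSpace Ω] {P : Measure Ω}
  {Z e : ℤ → Ω → ℝ} {σ2 Ψ : ℝ} {ψ : ℕ → ℝ}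

lemma aemeasurable_of_hasSum (h : IsIIDNoise P Z σ2)
    (he : ∀ t : ℤ, ∀ᵐ ω ∂P, HasSum (fun j : ℕ => ψ j * Z (t - (j : ℤ)) ω) (e t ω)) (t : ℤ) :
    AEMeasurable (e t) P := by
  refine aemeasurable_of_tendsto_metrizable_ae (u := atTop)
    (f := fun n ω => ∑ j ∈ Finset.range n, ψ j * Z (t - (j : ℤ)) ω) (fun n => ?_)
    ((he t).mono fun ω hω => hω.tendsto_sum_nat)
  exact Finset.aemeasurable_fun_sum _ fun j _ =>
    (h.memLp' _).aestronglyMeasurable.aemeasurable.const_mul _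

/-- Exchanging the sums writes the combination as a `ψ`-weighted series of shifted noise
combinations, all with the same second moment. Absolute summability of `ψ` gives the factor `Ψ ^ 2`,
with the limit taken by Fatou. -/
lemma msq_sum_mul_causal_le [IsProbabilityMeasure P] (h : IsIIDNoise P Z σ2)
    (hΨ : ∀ n, ∑ k ∈ Finset.range n, |ψ k| ≤ Ψ)
    (he : ∀ t : ℤ, ∀ᵐ ω ∂P, HasSum (fun j : ℕ => ψ j * Z (t - (j : ℤ)) ω) (e t ω))
    {ι : Type*} (s : Finset ι) (a : ι → ℝ) {f : ι → ℤ} (hf : Function.Injective f) :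
    msq P (fun ω => ∑ i ∈ s, a i * e (f i) ω) ≤ ENNReal.ofReal (Ψ ^ 2 * (σ2 * ∑ i ∈ s, a i ^ 2)) := by
  have hσ := h.nonneg
  have hm : ∀ t, AEMeasurable (Z t) P := fun t => (h.memLp' t).aestronglyMeasurable.aemeasurable
  have hy : ∀ k : ℕ, AEMeasurable (fun ω => ∑ i ∈ s, a i * Z (f i - (k : ℤ)) ω) P := fun k =>
    Finset.aemeasurable_fun_sum _ fun i _ => (hm _).const_mul _
  refine msq_le_of_tendsto
    (f := fun n ω => ∑ k ∈ Finset.range n, ψ k * ∑ i ∈ s, a i * Z (f i - (k : ℤ)) ω)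
    (fun n => Finset.aemeasurable_fun_sum _ fun k _ => (hy k).const_mul _) ?_
    (Eventually.of_forall fun n => msq_sum_mul_le _ _ _ (fun k _ => hy k) (by positivity) (hΨ n)
      fun k _ => ?_)
  · have hall : ∀ᵐ ω ∂P, ∀ i ∈ s, HasSum (fun j : ℕ => ψ j * Z (f i - (j : ℤ)) ω) (e (f i) ω) :=
      (Finset.eventually_all s).2 fun i _ => he (f i)
    filter_upwards [hall] with ω hω
    have h1 : Tendsto (fun n => ∑ i ∈ s, a i * ∑ k ∈ Finset.range n, ψ k * Z (f i - (k : ℤ)) ω)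
        atTop (𝓝 (∑ i ∈ s, a i * e (f i) ω)) :=
      tendsto_finsetSum _ fun i hi => (hω i hi).tendsto_sum_nat.const_mul _
    refine h1.congr fun n => ?_
    simp only [Finset.mul_sum]
    rw [Finset.sum_comm]
    exact Finset.sum_congr rfl fun k _ => Finset.sum_congr rfl fun i _ => by ring
  · exact (h.msq_sum s a (f := fun i => f i - (k : ℤ)) fun i j hij => hf (by simpa using hij)).le

/-- The same expansion of `e` leaves sums of `Z t * Z (t - l - k)`, which are orthogonal over `t`
for every fixed lag. -/
lemma msq_sum_noise_mul_causal_le [IsProbabilityMeasure P] (h : IsIIDNoise P Z σ2)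
    (hΨ : ∀ n, ∑ k ∈ Finset.range n, |ψ k| ≤ Ψ)
    (he : ∀ t : ℤ, ∀ᵐ ω ∂P, HasSum (fun j : ℕ => ψ j * Z (t - (j : ℤ)) ω) (e t ω))
    {ι : Type*} (s : Finset ι) {f : ι → ℤ} (hf : Function.Injective f) {l : ℤ} (hl : 0 < l) :
    msq P (fun ω => ∑ i ∈ s, Z (f i) ω * e (f i - l) ω) ≤
      ENNReal.ofReal (Ψ ^ 2 * (s.card * σ2 ^ 2)) := by
  have hm : ∀ t, AEMeasurable (Z t) P := fun t => (h.memLp' t).aestronglyMeasurable.aemeasurable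
  have hy : ∀ k : ℕ, AEMeasurable (fun ω => ∑ i ∈ s, Z (f i) ω * Z (f i - (l + k)) ω) P := fun k =>
    Finset.aemeasurable_fun_sum _ fun i _ => (hm _).mul (hm _)
  refine msq_le_of_tendsto
    (f := fun n ω => ∑ k ∈ Finset.range n, ψ k * ∑ i ∈ s, Z (f i) ω * Z (f i - (l + k)) ω)
    (fun n => Finset.aemeasurable_fun_sum _ fun k _ => (hy k).const_mul _) ?_
    (Eventually.of_forall fun n => msq_sum_mul_le _ _ _ (fun k _ => hy k) (by positivity) (hΨ n)
      fun k _ => (h.msq_sum_lag_mul s hf (by omega)).le)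
  have hall : ∀ᵐ ω ∂P, ∀ i ∈ s,
      HasSum (fun j : ℕ => ψ j * Z (f i - l - (j : ℤ)) ω) (e (f i - l) ω) :=
    (Finset.eventually_all s).2 fun i _ => he (f i - l)
  filter_upwards [hall] with ω hω
  have h1 : Tendsto (fun n => ∑ i ∈ s, Z (f i) ω *
      ∑ k ∈ Finset.range n, ψ k * Z (f i - l - (k : ℤ)) ω)
      atTop (𝓝 (∑ i ∈ s, Z (f i) ω * e (f i - l) ω)) :=
    tendsto_finsetSum _ fun i hi => (hω i hi).tendsto_sum_nat.const_mul _
  refine h1.congr fun n => ?_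
  simp only [Finset.mul_sum]
  rw [Finset.sum_comm]
  refine Finset.sum_congr rfl fun k _ => Finset.sum_congr rfl fun i _ => ?_
  rw [sub_sub]; ring

/-- A square summable combination of the noise that vanishes has zero coefficients. -/
lemma IsIIDNoise.coeff_eq_zero [IsProbabilityMeasure P] (h : IsIIDNoise P Z σ2) (hσ : 0 < σ2) {c : ℕ → ℝ}
    (hc : Summable fun k => c k ^ 2)
    (h0 : ∀ᵐ ω ∂P, HasSum (fun k : ℕ => c k * Z (-(k : ℤ)) ω) 0) (k : ℕ) : c k = 0 := by
  have hm : ∀ t, AEMeasurable (Z t) P := fun t => (h.memLp' t).aestronglyMeasurable.aemeasurable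
  have hinj : Function.Injective fun k : ℕ => -(k : ℤ) := fun i j hij => by
    simpa using hij
  obtain ⟨V, hV⟩ : ∃ V : ℝ, V = ∑' k, c k ^ 2 := ⟨_, rfl⟩
  have hle : ∀ n, ∑ k ∈ Finset.range n, c k ^ 2 ≤ V := fun n => by
    rw [hV]; exact hc.sum_le_tsum _ fun _ _ => sq_nonneg _
  -- If the series vanishes, its head is minus its tail, so the second moment of the head is bounded
  -- by that of the tail, which tends to zero.
  have hmain : ∀ m, ∑ k ∈ Finset.range m, c k ^ 2 ≤ V - ∑ k ∈ Finset.range m, c k ^ 2 := by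
    intro m
    have h1 : msq P (fun ω => ∑ k ∈ Finset.range m, c k * Z (-(k : ℤ)) ω) ≤
        ENNReal.ofReal (σ2 * (V - ∑ k ∈ Finset.range m, c k ^ 2)) := by
      refine msq_le_of_tendsto (f := fun n ω => - ∑ k ∈ Finset.Ico m n, c k * Z (-(k : ℤ)) ω)
        (fun n => (Finset.aemeasurable_fun_sum _ fun k _ => (hm _).const_mul _).neg) ?_ ?_
      · filter_upwards [h0] with ω hω
        have h2 : Tendsto (fun n => ∑ k ∈ Finset.range m, c k * Z (-(k : ℤ)) ω -
            ∑ k ∈ Finset.range n, c k * Z (-(k : ℤ)) ω) atTop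
            (𝓝 (∑ k ∈ Finset.range m, c k * Z (-(k : ℤ)) ω - 0)) :=
          tendsto_const_nhds.sub hω.tendsto_sum_nat
        rw [sub_zero] at h2
        refine h2.congr' ?_
        filter_upwards [eventually_ge_atTop m] with n hn
        rw [← Finset.sum_range_add_sum_Ico _ hn]
        ring
      · filter_upwards [eventually_ge_atTop m] with n hn
        have h3 : msq P (fun ω => - ∑ k ∈ Finset.Ico m n, c k * Z (-(k : ℤ)) ω) =
            msq P (fun ω => ∑ k ∈ Finset.Ico m n, c k * Z (-(k : ℤ)) ω) := by
          simp [msq]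
        rw [h3, h.msq_sum (Finset.Ico m n) c hinj]
        refine ENNReal.ofReal_le_ofReal (mul_le_mul_of_nonneg_left ?_ hσ.le)
        have h4 := Finset.sum_range_add_sum_Ico (fun k => c k ^ 2) hn
        linarith [hle n]
    rw [h.msq_sum (Finset.range m) c hinj, ENNReal.ofReal_le_ofReal_iff
      (mul_nonneg hσ.le (sub_nonneg.2 (hle m)))] at h1
    exact le_of_mul_le_mul_left h1 hσ
  have hlim := hc.hasSum.tendsto_sum_nat
  rw [← hV] at hlim
  have hV0 : V ≤ V - V := le_of_tendsto_of_tendsto' hlim (hlim.const_sub V) hmain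
  have h5 := Finset.single_le_sum (f := fun k => c k ^ 2) (fun _ _ => sq_nonneg _)
    (Finset.mem_range.2 (Nat.lt_succ_self k))
  have h6 : c k ^ 2 ≤ 0 := by linarith [hle (k + 1)]
  exact pow_eq_zero_iff two_ne_zero |>.1 (le_antisymm h6 (sq_nonneg _))

/-- The moving average weights of a causal autoregression invert the autoregressive polynomial. -/
theorem mk_mul_lagSeries_eq_one [IsProbabilityMeasure P] {p : ℕ} {φ : Fin p → ℝ} (h : IsIIDNoise P Z σ2) (hσ : 0 < σ2)
    (hrec : ∀ t : ℤ, ∀ᵐ ω ∂P, e t ω = ∑ j : Fin p, φ j * e (t - (((j : ℕ) : ℤ) + 1)) ω + Z t ω)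
    (hψ : Summable fun j => |ψ j|)
    (he : ∀ t : ℤ, ∀ᵐ ω ∂P, HasSum (fun j : ℕ => ψ j * Z (t - (j : ℤ)) ω) (e t ω)) :
    PowerSeries.mk ψ * lagSeries φ = 1 := by
  obtain ⟨θ, hθ⟩ : ∃ θ : Fin p → ℕ → ℝ,
    θ = fun (j : Fin p) n => if (j : ℕ) + 1 ≤ n then ψ (n - ((j : ℕ) + 1)) else 0 := ⟨_, rfl⟩
  have hθadd : ∀ j n, θ j (n + ((j : ℕ) + 1)) = ψ n := fun j n => by
    rw [hθ]; simp
  have hθlt : ∀ (j : Fin p) n, n ∉ Set.range (fun n => n + ((j : ℕ) + 1)) → θ j n = 0 := by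
    intro j n hn
    rw [hθ]
    refine if_neg fun hle => hn ⟨n - ((j : ℕ) + 1), ?_⟩
    simp only; omega
  have hinj : ∀ j : Fin p, Function.Injective fun n => n + ((j : ℕ) + 1) := fun j =>
    add_left_injective _
  -- The coefficients of the product of the two power series minus `1`. Inserting the causal
  -- representation into the recursion at time `0` gives a vanishing noise series with these
  -- coefficients.
  obtain ⟨c, hc⟩ : ∃ c : ℕ → ℝ,
    c = fun n => ψ n - ∑ j : Fin p, φ j * θ j n - if n = 0 then 1 else 0 := ⟨_, rfl⟩
  have hcoef : ∀ n, PowerSeries.coeff n (PowerSeries.mk ψ * lagSeries φ) =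
      ψ n - ∑ j : Fin p, φ j * θ j n := by
    intro n
    rw [mul_comm, coeff_lagSeries_mul, hθ]
    simp only [PowerSeries.coeff_mk]
  have hcs : Summable c := by
    rw [hc]
    refine ((summable_abs_iff.1 hψ).sub (summable_sum fun j _ => ?_)).sub ?_
    · refine Summable.mul_left _ (((hinj j).summable_iff (hθlt j)).1 ?_)
      exact (summable_abs_iff.1 hψ).congr fun n => (hθadd j n).symm
    · exact summable_of_ne_finset_zero (s := {0}) fun n hn => if_neg (by simpa using hn)
  have hc2 : Summable fun k => c k ^ 2 := by
    have habs := hcs.abs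
    refine Summable.of_nonneg_of_le (fun _ => sq_nonneg _) (fun k => ?_)
      (habs.mul_left (∑' k, |c k|))
    rw [← sq_abs, sq]
    exact mul_le_mul_of_nonneg_right (habs.le_tsum k fun _ _ => abs_nonneg _) (abs_nonneg _)
  have hall : ∀ᵐ ω ∂P, ∀ j : Fin p, HasSum (fun i : ℕ => ψ i *
      Z (0 - (((j : ℕ) : ℤ) + 1) - (i : ℤ)) ω) (e (0 - (((j : ℕ) : ℤ) + 1)) ω) :=
    ae_all_iff.2 fun j => he _
  have hzero : ∀ᵐ ω ∂P, HasSum (fun k : ℕ => c k * Z (-(k : ℤ)) ω) 0 := by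
    filter_upwards [hall, he 0, hrec 0] with ω h1 h2 h3
    have h4 : ∀ j : Fin p, HasSum (fun n : ℕ => θ j n * Z (-(n : ℤ)) ω)
        (e (0 - (((j : ℕ) : ℤ) + 1)) ω) := by
      intro j
      rw [← (hinj j).hasSum_iff (fun n hn => by rw [hθlt j n hn, zero_mul])]
      refine (h1 j).congr_fun ?_
      intro n
      simp only [Function.comp_apply, hθadd]
      congr 2
      push_cast; ring
    have h5 : HasSum (fun n : ℕ => (if n = 0 then (1 : ℝ) else 0) * Z (-(n : ℤ)) ω) (Z 0 ω) := by
      have := hasSum_single (f := fun n : ℕ => (if n = 0 then (1 : ℝ) else 0) * Z (-(n : ℤ)) ω) 0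
        fun n hn => by rw [if_neg hn, zero_mul]
      simpa using this
    have h6 := (h2.sub (hasSum_sum fun j (_ : j ∈ Finset.univ) => (h4 j).mul_left (φ j))).sub h5
    rw [h3, add_sub_cancel_left, sub_self] at h6
    refine h6.congr_fun fun n => ?_
    rw [hc]
    simp only [sub_mul, Finset.sum_mul, zero_sub, mul_assoc]
  ext n
  rw [hcoef, PowerSeries.coeff_one]
  have := h.coeff_eq_zero hσ hc2 hzero n
  rw [hc] at this
  exact sub_eq_zero.1 this

end Causal

/-! ### Markov's inequality for sums of squares -/

section Energy

variable {Ω : Type*} [MeasurableSpace Ω] {P : Measure Ω}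

lemma tendsto_ofReal_div (C : ℝ) :
    Tendsto (fun A : ℝ => ENNReal.ofReal (C / A)) atTop (𝓝 0) := by
  have h : Tendsto (fun A : ℝ => C / A) atTop (𝓝 0) := tendsto_id.const_div_atTop C
  have h2 := (ENNReal.continuous_ofReal.tendsto 0).comp h
  rwa [ENNReal.ofReal_zero] at h2

lemma measure_lt_sum_sq_le {ι : Type*} (s : Finset ι) {y : ι → Ω → ℝ}
    (hy : ∀ i ∈ s, AEMeasurable (y i) P) {C n c : ℝ} (hC : 0 ≤ C)
    (h : ∀ i ∈ s, msq P (y i) ≤ ENNReal.ofReal C) (hn : (s.card : ℝ) ≤ n) (hc : 0 < c) :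
    P {ω | c < ∑ i ∈ s, y i ω ^ 2} ≤ ENNReal.ofReal (n * C / c) := by
  have h1 : P {ω | c < ∑ i ∈ s, y i ω ^ 2} ≤
      P {ω | ENNReal.ofReal c ≤ ∑ i ∈ s, ENNReal.ofReal (y i ω ^ 2)} := by
    refine measure_mono fun ω hω => ?_
    rw [Set.mem_ofPred_eq, ← ENNReal.ofReal_sum_of_nonneg fun i _ => sq_nonneg _]
    exact ENNReal.ofReal_le_ofReal (le_of_lt hω)
  refine h1.trans ?_
  rw [ENNReal.ofReal_div_of_pos hc]
  refine (meas_ge_le_lintegral_div (Finset.aemeasurable_fun_sum _ fun i hi =>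
    ((hy i hi).pow_const 2).ennreal_ofReal) (by simpa using hc) ENNReal.ofReal_ne_top).trans
    (ENNReal.div_le_div_right ?_ _)
  rw [lintegral_finsetSum' _ fun i hi => ((hy i hi).pow_const 2).ennreal_ofReal]
  calc ∑ i ∈ s, ∫⁻ ω, ENNReal.ofReal (y i ω ^ 2) ∂P ≤ ∑ i ∈ s, ENNReal.ofReal C :=
        Finset.sum_le_sum h
    _ = ENNReal.ofReal (s.card * C) := by
        rw [Finset.sum_const, nsmul_eq_mul, ENNReal.ofReal_mul (Nat.cast_nonneg _),
          ENNReal.ofReal_natCast]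
    _ ≤ ENNReal.ofReal (n * C) := ENNReal.ofReal_le_ofReal (mul_le_mul_of_nonneg_right hn hC)

end Energy

/-! ### The least squares fit -/

section Projection

/-- The least squares fit to `x`, as a function of time. -/
noncomputable def olsFit (T N : ℕ) (c : RelConfig) (x : ℕ → ℝ) (t : ℕ) : ℝ :=
  if h : 1 ≤ t ∧ t ≤ N then (designSpace T N c).starProjection (sample N x) ⟨t - 1, by omega⟩ else 0

variable {T N : ℕ} {c : RelConfig}

lemma olsFit_succ (x : ℕ → ℝ) (i : Fin N) :
    (designSpace T N c).starProjection (sample N x) i = olsFit T N c x (i + 1) := by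
  rw [olsFit, dif_pos ⟨by omega, by omega⟩]
  rfl

lemma finrank_designSpace_le : Module.finrank ℝ (designSpace T N c) ≤ T + c.m := by
  have h : designSpace T N c = Submodule.span ℝ (Set.range (Sum.elim
      (fun v : Fin T => sample N (seasonCol T v)) fun r : Fin c.m => sample N (regimeCol c N r))) := by
    rw [designSpace, Set.Sum.elim_range]
  rw [h]
  refine (finrank_range_le_card _).trans ?_
  simp

/-- The energy of the least squares fit is a sum of squares of at most `T + m` normalized linear
combinations of the data. -/
lemma exists_energy_olsFit_eq (T N : ℕ) (c : RelConfig) : ∃ (n : ℕ) (b : Fin n → ℕ → ℝ),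
    n ≤ T + c.m ∧ (∀ i, ∑ t ∈ Finset.Ico 1 (N + 1), b i t ^ 2 = 1) ∧
    ∀ x, energy 1 (N + 1) (olsFit T N c x) =
      ∑ i, (∑ t ∈ Finset.Ico 1 (N + 1), b i t * x t) ^ 2 := by
  obtain ⟨V, hV⟩ : ∃ V, V = designSpace T N c := ⟨_, rfl⟩
  have hsum : ∀ f : ℕ → ℝ, ∑ t ∈ Finset.Ico 1 (N + 1), f t = ∑ i : Fin N, f (i + 1) := by
    intro f
    rw [Finset.sum_Ico_eq_sum_range, Nat.add_sub_cancel, Finset.sum_range]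
    exact Finset.sum_congr rfl fun i _ => by rw [add_comm]
  let B := stdOrthonormalBasis ℝ V
  refine ⟨Module.finrank ℝ V, fun i t => if h : 1 ≤ t ∧ t ≤ N then
    (B i : EuclideanSpace ℝ (Fin N)) ⟨t - 1, by omega⟩ else 0, ?_, fun i => ?_, fun x => ?_⟩
  · rw [hV]; exact finrank_designSpace_le
  · rw [hsum]
    have h1 : ‖(B i : EuclideanSpace ℝ (Fin N))‖ ^ 2 = 1 := by
      have : ‖B i‖ = 1 := B.norm_eq_one i
      rw [← Submodule.coe_norm, this, one_pow]
    rw [EuclideanSpace.norm_sq_eq] at h1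
    rw [← h1]
    refine Finset.sum_congr rfl fun k _ => ?_
    beta_reduce
    rw [dif_pos (show 1 ≤ (k : ℕ) + 1 ∧ (k : ℕ) + 1 ≤ N from ⟨by omega, by omega⟩),
      Real.norm_eq_abs, sq_abs]
    rfl
  · have h1 : energy 1 (N + 1) (olsFit T N c x) = ‖V.starProjection (sample N x)‖ ^ 2 := by
      rw [energy, hsum, EuclideanSpace.norm_sq_eq]
      refine Finset.sum_congr rfl fun k _ => ?_
      rw [Real.norm_eq_abs, sq_abs, hV, olsFit_succ]
    rw [h1, Submodule.starProjection_apply, ← Submodule.coe_norm,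
      ← B.sum_sq_norm_inner_right]
    refine Finset.sum_congr rfl fun i _ => ?_
    rw [Real.norm_eq_abs, sq_abs, Submodule.coe_inner, ← Submodule.starProjection_apply,
      ← Submodule.inner_starProjection_left_eq_right,
      Submodule.starProjection_eq_self_iff.2 (B i).2, hsum, PiLp.inner_apply]
    congr 1
    refine Finset.sum_congr rfl fun k _ => ?_
    beta_reduce
    rw [dif_pos (show 1 ≤ (k : ℕ) + 1 ∧ (k : ℕ) + 1 ≤ N from ⟨by omega, by omega⟩)]
    exact mul_comm _ _

end Projection

/-! ### The good events, one kind at a time -/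

section GoodEvents

variable {Ω : Type*} [MeasurableSpace Ω] {P : Measure Ω}
  {Z e : ℤ → Ω → ℝ} {σ2 : ℝ}

lemma cast_add_mul_injective (a : ℕ) {s : ℕ} (hs : 0 < s) :
    Function.Injective fun i : ℕ => ((a + s * i : ℕ) : ℤ) := fun i j hij => by
  have h : a + s * i = a + s * j := Int.ofNat_inj.1 hij
  exact Nat.eq_of_mul_eq_mul_left hs (Nat.add_left_cancel h)

/-- The times near the true changepoints that occur in the filtered step functions. -/
noncomputable def RelConfig.lagTimes (c : RelConfig) (p N : ℕ) : Finset ℕ :=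
  Finset.univ.image fun x : Fin c.m × Fin (p + 1) => c.tau N x.1 + x.2

lemma Negligible.of_forall {ι : Type*} (s : Finset ι) {good : ι → ℝ → ℕ → Set Ω}
    (h : ∀ i ∈ s, Negligible P fun A N => (good i A N)ᶜ) :
    Negligible P fun A N => {ω | ∀ i ∈ s, ω ∈ good i A N}ᶜ := by
  refine (Negligible.biUnion s h).mono (Eventually.of_forall fun A => Eventually.of_forall
    fun N ω hω => ?_)
  simp only [Set.mem_compl_iff, Set.mem_ofPred_eq, not_forall] at hω
  obtain ⟨i, hi, hω⟩ := hω
  exact Set.mem_biUnion hi hω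

lemma IsIIDNoise.negligible_abs_sum [IsProbabilityMeasure P] (h : IsIIDNoise P Z σ2) (hm : ∀ t, Measurable (Z t)) {T : ℕ}
    (hT : 0 < T) (a : ℕ) :
    Negligible P fun A N => {ω | ∀ n ≤ N,
      |∑ i ∈ Finset.range n, Z ((a + T * i : ℕ) : ℤ) ω| ≤ A * √N}ᶜ := by
  refine negligible_of_tendsto (tendsto_ofReal_div_sq σ2) ?_
  filter_upwards [eventually_gt_atTop 0] with A hA
  filter_upwards [eventually_ge_atTop 1] with N hN
  have hN0 : (0 : ℝ) < N := by exact_mod_cast hN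
  have hs : √(N : ℝ) ^ 2 = N := Real.sq_sqrt hN0.le
  refine (measure_mono fun ω hω => ?_).trans ((h.measure_exists_le_abs_sum hm
    (cast_add_mul_injective a hT) (c := A * √N) (by positivity) N).trans (le_of_eq ?_))
  · simp only [Set.mem_compl_iff, Set.mem_ofPred_eq, not_forall, not_le] at hω
    obtain ⟨n, hn, hω⟩ := hω
    exact ⟨n, hn, hω⟩
  · rw [mul_pow, hs]
    congr 1
    field_simp

lemma IsIIDNoise.negligible_abs_sum_sq [IsProbabilityMeasure P] (h : IsIIDNoise P Z σ2) (hm : ∀ t, Measurable (Z t))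
    {s : ℕ} (hs : 0 < s) (a : ℕ) {ε : ℝ} (hε : 0 < ε) :
    Negligible P fun _ N => {ω | ∀ n ≤ N,
      |∑ i ∈ Finset.range n, Z ((a + s * i : ℕ) : ℤ) ω ^ 2 - n * σ2| ≤ ε * N}ᶜ := by
  intro δ hδ
  refine Eventually.of_forall fun A => ?_
  filter_upwards [(h.tendsto_measure_sum_sq hm (cast_add_mul_injective a hs) hε).eventually_le_const
    hδ] with N hN
  refine (measure_mono fun ω hω => ?_).trans hN
  simp only [Set.mem_compl_iff, Set.mem_ofPred_eq, not_forall, not_le] at hω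
  obtain ⟨n, hn, hω⟩ := hω
  exact ⟨n, hn, hω⟩

/-- The sequence of times may vary with `N`, as the true changepoint times do, because the line
bound is uniform over all sequences of distinct times. -/
lemma IsIIDNoise.negligible_near [IsProbabilityMeasure P] (h : IsIIDNoise P Z σ2) (hm : ∀ t, Measurable (Z t)) {ε : ℝ}
    (hε : 0 < ε) {f : ℕ → ℕ → ℤ} (hf : ∀ N, Function.Injective (f N)) :
    Negligible P fun A N => {ω | ∀ k : ℕ,
      |∑ i ∈ Finset.range k, Z (f N i) ω| ≤ ε * k + A}ᶜ := by
  obtain ⟨Φ, hΦ, hle⟩ := h.exists_measure_sum_gt_line_le hm hε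
  refine negligible_of_tendsto hΦ ?_
  filter_upwards [eventually_gt_atTop 0] with A hA
  refine Eventually.of_forall fun N => ?_
  refine (measure_mono fun ω hω => ?_).trans (hle A hA (f N) (hf N))
  simp only [Set.mem_compl_iff, Set.mem_ofPred_eq, not_forall, not_le] at hω
  exact hω

lemma negligible_of_msq {y : ℕ → Ω → ℝ} (hy : ∀ N, AEMeasurable (y N) P) {C : ℝ}
    (h : ∀ N, msq P (y N) ≤ ENNReal.ofReal (C * N)) :
    Negligible P fun A N => {ω | |y N ω| ≤ A * √N}ᶜ := by
  refine negligible_of_tendsto (tendsto_ofReal_div_sq C) ?_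
  filter_upwards [eventually_gt_atTop 0] with A hA
  filter_upwards [eventually_ge_atTop 1] with N hN
  have hN0 : (0 : ℝ) < N := by exact_mod_cast hN
  have hs : √(N : ℝ) ^ 2 = N := Real.sq_sqrt hN0.le
  refine (measure_mono fun ω hω => ?_).trans ((measure_lt_abs_le_msq (hy N) (c := A * √N)
    (by positivity) (h N)).trans (le_of_eq ?_))
  · simpa only [Set.mem_compl_iff, Set.mem_ofPred_eq, not_le] using hω
  · rw [mul_pow, hs]
    congr 1
    field_simp

lemma negligible_of_sum_sq {n : ℕ → ℕ} {y : ∀ N, Fin (n N) → Ω → ℝ}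
    (hy : ∀ N i, AEMeasurable (y N i) P) {C : ℝ} (hC : 0 ≤ C)
    (h : ∀ N i, msq P (y N i) ≤ ENNReal.ofReal C) {w : ℕ → ℝ} (hw : ∀ᶠ N in atTop, 0 < w N)
    {K : ℝ} (hn : ∀ᶠ N in atTop, (n N : ℝ) ≤ K * w N) :
    Negligible P fun A N => {ω | ∑ i, y N i ω ^ 2 ≤ A * w N}ᶜ := by
  refine negligible_of_tendsto (tendsto_ofReal_div (K * C)) ?_
  filter_upwards [eventually_gt_atTop 0] with A hA
  filter_upwards [hw, hn] with N hN hnN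
  refine (measure_mono fun ω hω => ?_).trans ((measure_lt_sum_sq_le Finset.univ
    (fun i _ => hy N i) hC (fun i _ => h N i) (n := K * w N) (c := A * w N) (by simpa using hnN)
    (by positivity)).trans (le_of_eq ?_))
  · simpa only [Set.mem_compl_iff, Set.mem_ofPred_eq, not_le] using hω
  · congr 1
    field_simp

end GoodEvents

/-! ### Good paths have high probability -/

section GoodPaths

variable {Ω : Type*} [MeasurableSpace Ω] {P : Measure Ω} [IsProbabilityMeasure P]
  {Z e : ℤ → Ω → ℝ} {σ2 Ψ : ℝ} {ψ : ℕ → ℝ}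

lemma energy_eq_sum_fin (a b : ℕ) (x : ℕ → ℝ) :
    energy a b x = ∑ i : Fin (b - a), x (a + i) ^ 2 := by
  rw [energy, Finset.sum_Ico_eq_sum_range, Finset.sum_range]

lemma negligible_energy (h : IsIIDNoise P Z σ2)
    (hΨ : ∀ n, ∑ k ∈ Finset.range n, |ψ k| ≤ Ψ)
    (he : ∀ t : ℤ, ∀ᵐ ω ∂P, HasSum (fun j : ℕ => ψ j * Z (t - (j : ℤ)) ω) (e t ω))
    (a b : ℕ → ℕ) {w : ℕ → ℝ} (hw : ∀ᶠ N in atTop, 0 < w N) {K : ℝ}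
    (hn : ∀ᶠ N in atTop, ((b N - a N : ℕ) : ℝ) ≤ K * w N) :
    Negligible P fun A N => {ω | energy (a N) (b N) (fun t => e t ω) ≤ A * w N}ᶜ := by
  have hσ := h.nonneg
  simp only [energy_eq_sum_fin]
  refine negligible_of_sum_sq (n := fun N => b N - a N) (y := fun N i ω => e ((a N + i : ℕ) : ℤ) ω)
    (fun N i => aemeasurable_of_hasSum h he _) (C := Ψ ^ 2 * σ2) (by positivity) (fun N i => ?_) hw hn
  have h1 := msq_sum_mul_causal_le h hΨ he {((a N + i : ℕ) : ℤ)} (fun _ => 1)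
    (f := id) Function.injective_id
  simpa using h1

/-- The design space has dimension at most `T + m` for every `N`, and each coordinate of the errors
in an orthonormal basis has second moment at most `Ψ ^ 2 * σ2`; so the energy of the fit stays
bounded in probability. -/
lemma negligible_energy_olsFit (h : IsIIDNoise P Z σ2)
    (hΨ : ∀ n, ∑ k ∈ Finset.range n, |ψ k| ≤ Ψ)
    (he : ∀ t : ℤ, ∀ᵐ ω ∂P, HasSum (fun j : ℕ => ψ j * Z (t - (j : ℤ)) ω) (e t ω))
    (T : ℕ) (c : RelConfig) :
    Negligible P fun A N =>
      {ω | energy 1 (N + 1) (olsFit T N c fun t => e t ω) ≤ A * (1 : ℝ)}ᶜ := by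
  have hσ := h.nonneg
  choose n b hn hb hfit using fun N => exists_energy_olsFit_eq T N c
  simp only [hfit]
  refine negligible_of_sum_sq (n := n)
    (y := fun N i ω => ∑ t ∈ Finset.Ico 1 (N + 1), b N i t * e (t : ℤ) ω)
    (fun N i => Finset.aemeasurable_fun_sum _ fun t _ =>
      (aemeasurable_of_hasSum h he _).const_mul _) (C := Ψ ^ 2 * σ2) (by positivity)
    (fun N i => ?_) (w := fun _ => 1) (Eventually.of_forall fun _ => one_pos) (K := T + c.m)
    (Eventually.of_forall fun N => ?_)
  · have h1 := msq_sum_mul_causal_le h hΨ he (Finset.Ico 1 (N + 1)) (b N i)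
      (f := fun t : ℕ => (t : ℤ)) Nat.cast_injective
    rwa [hb N i, mul_one] at h1
  · rw [mul_one]
    exact_mod_cast hn N

lemma negligible_cross_error (h : IsIIDNoise P Z σ2)
    (hΨ : ∀ n, ∑ k ∈ Finset.range n, |ψ k| ≤ Ψ)
    (he : ∀ t : ℤ, ∀ᵐ ω ∂P, HasSum (fun j : ℕ => ψ j * Z (t - (j : ℤ)) ω) (e t ω)) (p j : ℕ) :
    Negligible P fun A N => {ω | |∑ t ∈ Finset.Ico (p + 1) (N + 1),
      Z (t : ℤ) ω * e ((t : ℤ) - ((j : ℤ) + 1)) ω| ≤ A * √N}ᶜ := by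
  have hσ := h.nonneg
  refine negligible_of_msq (C := Ψ ^ 2 * σ2 ^ 2) (fun N => Finset.aemeasurable_fun_sum _ fun t _ =>
    (h.memLp' _).aestronglyMeasurable.aemeasurable.mul (aemeasurable_of_hasSum h he _)) fun N => ?_
  refine (msq_sum_noise_mul_causal_le h hΨ he _ (f := fun t : ℕ => (t : ℤ)) Nat.cast_injective
    (by omega)).trans (ENNReal.ofReal_le_ofReal ?_)
  have h1 : ((Finset.Ico (p + 1) (N + 1)).card : ℝ) ≤ N := by
    rw [Nat.card_Ico]; exact_mod_cast (by omega : N + 1 - (p + 1) ≤ N)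
  have h2 : 0 ≤ Ψ ^ 2 * σ2 ^ 2 := by positivity
  have := mul_le_mul_of_nonneg_left h1 h2
  linarith

lemma negligible_cross_noise (h : IsIIDNoise P Z σ2) {a : ℕ} (ha : 1 ≤ a) {i j : ℕ} (hij : i < j) :
    Negligible P fun A N => {ω | |∑ t ∈ Finset.Ico a (N + 1),
      Z ((t : ℤ) - ((i : ℤ) + 1)) ω * Z ((t : ℤ) - ((j : ℤ) + 1)) ω| ≤ A * √N}ᶜ := by
  refine negligible_of_msq (C := σ2 ^ 2) (fun N => Finset.aemeasurable_fun_sum _ fun t _ =>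
    (h.memLp' _).aestronglyMeasurable.aemeasurable.mul
      (h.memLp' _).aestronglyMeasurable.aemeasurable) fun N => ?_
  have h1 := h.msq_sum_lag_mul (Finset.Ico a (N + 1)) (f := fun t : ℕ => (t : ℤ) - ((i : ℤ) + 1))
    (fun s t hst => by simpa using hst) (l := (j : ℤ) - i) (by omega)
  simp only [show ∀ t : ℤ, t - ((i : ℤ) + 1) - ((j : ℤ) - i) = t - ((j : ℤ) + 1) from
    fun t => by ring] at h1
  rw [h1]
  refine ENNReal.ofReal_le_ofReal ?_
  have h2 : ((Finset.Ico a (N + 1)).card : ℝ) ≤ N := by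
    rw [Nat.card_Ico]; exact_mod_cast (by omega : N + 1 - a ≤ N)
  have := mul_le_mul_of_nonneg_right h2 (sq_nonneg σ2)
  linarith

/-- With high probability the noise and error paths have all the properties that the
deterministic argument requires. -/
theorem negligible_not_goodPath {T p : ℕ} (hT : 0 < T) {φ : Fin p → ℝ} (h : IsIIDNoise P Z σ2)
    (hm : ∀ t, Measurable (Z t)) (hΨ : ∀ n, ∑ k ∈ Finset.range n, |ψ k| ≤ Ψ)
    (hrec : ∀ t : ℤ, ∀ᵐ ω ∂P, e t ω = ∑ j : Fin p, φ j * e (t - (((j : ℕ) : ℤ) + 1)) ω + Z t ω)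
    (he : ∀ t : ℤ, ∀ᵐ ω ∂P, HasSum (fun j : ℕ => ψ j * Z (t - (j : ℤ)) ω) (e t ω))
    (c : RelConfig) {ε : ℝ} (hε : 0 < ε) :
    Negligible P fun A N => {ω |
      GoodPath T φ σ2 ε A N (c.lagTimes p N) (fun t => Z t ω) (fun t => e t ω) ∧
      SmallFit p N A (fun t => e t ω) (olsFit T N c fun t => e t ω)}ᶜ := by
  have G0 : Negligible P fun _ N => {ω | ∀ t : ℕ, p + 1 ≤ t → t ≤ N →
      arf φ (fun t => e t ω) t = Z t ω}ᶜ := by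
    refine negligible_of_ae fun A N => ?_
    rw [← mem_ae_iff]
    filter_upwards [ae_all_iff.2 hrec] with ω hω t ht _
    rw [arf, hω t, sub_eq_iff_eq_add, add_comm]
    congr 1
    refine Finset.sum_congr rfl fun j _ => ?_
    congr 2
    have := j.is_lt
    omega
  have G1 := Negligible.of_forall (Finset.Icc 1 (2 * p + 1 + T))
    (good := fun a A N => {ω | ∀ n ≤ N,
      |∑ i ∈ Finset.range n, Z ((a + T * i : ℕ) : ℤ) ω| ≤ A * √N})
    fun a _ => h.negligible_abs_sum hm hT a
  have G2 := Negligible.of_forall (Finset.Icc 1 (2 * p + 1 + T))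
    (good := fun a _ N => {ω | ∀ n ≤ N,
      |∑ i ∈ Finset.range n, Z ((a + T * i : ℕ) : ℤ) ω ^ 2 - n * σ2| ≤ ε * N})
    fun a _ => h.negligible_abs_sum_sq hm hT a hε
  have G3 := Negligible.of_forall (Finset.Icc 1 (2 * p + 1 + T))
    (good := fun a _ N => {ω | ∀ n ≤ N,
      |∑ i ∈ Finset.range n, Z ((a + 1 * i : ℕ) : ℤ) ω ^ 2 - n * σ2| ≤ ε * N})
    fun a _ => h.negligible_abs_sum_sq hm one_pos a hε
  have G4 := Negligible.of_forall (Finset.univ : Finset (Fin c.m × Fin (p + 1)))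
    (good := fun x A N => {ω | ∀ k : ℕ,
      |∑ i ∈ Finset.range k, Z ((c.tau N x.1 + x.2 + 1 * i : ℕ) : ℤ) ω| ≤ ε * k + A})
    fun x _ => h.negligible_near hm hε fun N => cast_add_mul_injective _ one_pos
  -- Sums to the left of a changepoint are partial sums along the times taken backwards.
  have G5 := Negligible.of_forall (Finset.univ : Finset (Fin c.m × Fin (p + 1)))
    (good := fun x A N => {ω | ∀ k : ℕ,
      |∑ i ∈ Finset.range k, Z (((c.tau N x.1 + x.2 : ℕ) : ℤ) - 1 - (i : ℤ)) ω| ≤ ε * k + A})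
    fun x _ => h.negligible_near hm hε fun N i j hij => by simpa using hij
  have G6 := Negligible.of_forall (Finset.univ : Finset (Fin p))
    (good := fun j A N => {ω | |∑ t ∈ Finset.Ico (p + 1) (N + 1),
      Z (t : ℤ) ω * e ((t : ℤ) - (((j : ℕ) : ℤ) + 1)) ω| ≤ A * √N})
    fun j _ => negligible_cross_error h hΨ he p j
  have G7 := Negligible.of_forall
    ((Finset.univ : Finset (Fin p × Fin p)).filter fun x => x.1 < x.2)
    (good := fun x A N => {ω | |∑ t ∈ Finset.Ico (2 * p + 1) (N + 1),
      Z ((t : ℤ) - (((x.1 : ℕ) : ℤ) + 1)) ω * Z ((t : ℤ) - (((x.2 : ℕ) : ℤ) + 1)) ω| ≤ A * √N})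
    fun x hx => negligible_cross_noise h (by omega) (Finset.mem_filter.1 hx).2
  have G8 := negligible_energy_olsFit h hΨ he T c
  have hpos : ∀ᶠ N : ℕ in atTop, (0 : ℝ) < N := by
    filter_upwards [eventually_ge_atTop 1] with N hN
    exact_mod_cast hN
  have hone : ∀ᶠ N : ℕ in atTop, (0 : ℝ) < 1 := Eventually.of_forall fun _ => one_pos
  have G9 := negligible_energy h hΨ he (fun _ => 1) (fun N => N + 1) hpos (K := 1)
    (Eventually.of_forall fun N => by simp)
  have G10 := negligible_energy h hΨ he (fun _ => 1) (fun _ => p + 1) hone (K := p)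
    (Eventually.of_forall fun N => by simp)
  have G11 := negligible_energy h hΨ he (fun N => N + 1 - p) (fun N => N + 1) hone (K := p)
    (Eventually.of_forall fun N => by
      rw [mul_one]; exact_mod_cast (by omega : N + 1 - (N + 1 - p) ≤ p))
  refine (((((((((((G0.union G1).union G2).union G3).union G4).union G5).union G6).union
    G7).union G8).union G9).union G10).union G11).mono
    (Eventually.of_forall fun A => Eventually.of_forall fun N ω hω => ?_)
  by_contra hgood
  simp only [Set.mem_union, Set.mem_compl_iff, not_or, not_not, Set.mem_ofPred_eq, mul_one,
    one_mul] at hgood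
  obtain ⟨⟨⟨⟨⟨⟨⟨⟨⟨⟨⟨g0, g1⟩, g2⟩, g3⟩, g4⟩, g5⟩, g6⟩, g7⟩, g8⟩, g9⟩, g10⟩, g11⟩ := hgood
  refine hω ⟨⟨g0, fun a h1 h2 => g1 a (Finset.mem_Icc.2 ⟨h1, h2⟩),
    fun a h1 h2 => g2 a (Finset.mem_Icc.2 ⟨h1, h2⟩),
    fun a h1 h2 => g3 a (Finset.mem_Icc.2 ⟨h1, h2⟩), fun q hq k _ => ?_, fun q hq k hk => ?_,
    fun j => ?_, fun i j hij => ?_⟩, ⟨g8, g9, g10, g11⟩⟩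
  · obtain ⟨x, -, rfl⟩ := Finset.mem_image.1 hq
    rw [Finset.sum_Ico_eq_sum_range, Nat.add_sub_cancel_left]
    exact g4 x (Finset.mem_univ x) k
  · obtain ⟨x, -, rfl⟩ := Finset.mem_image.1 hq
    rw [Finset.sum_Ico_eq_sum_range, Nat.sub_sub_self hk.le, ← Finset.sum_range_reflect]
    refine le_trans (le_of_eq ?_) (g5 x (Finset.mem_univ x) k)
    congr 1
    refine Finset.sum_congr rfl fun i hi => ?_
    rw [Finset.mem_range] at hi
    congr 1
    omega
  · refine le_trans (le_of_eq ?_) (g6 j (Finset.mem_univ j))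
    congr 1
    refine Finset.sum_congr rfl fun t ht => ?_
    rw [Finset.mem_Ico] at ht
    congr 2
    omega
  · have hcast : ∀ t ∈ Finset.Ico (2 * p + 1) (N + 1), ∀ i : Fin p,
        ((t - ((i : ℕ) + 1) : ℕ) : ℤ) = (t : ℤ) - (((i : ℕ) : ℤ) + 1) := by
      intro t ht i
      rw [Finset.mem_Ico] at ht
      omega
    rw [Finset.sum_congr rfl fun t ht => by rw [hcast t ht i, hcast t ht j]]
    rcases lt_or_gt_of_ne hij with hlt | hlt
    · exact g7 (i, j) (Finset.mem_filter.2 ⟨Finset.mem_univ _, hlt⟩)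
    · refine le_trans (le_of_eq ?_) (g7 (j, i) (Finset.mem_filter.2 ⟨Finset.mem_univ _, hlt⟩))
      congr 1
      exact Finset.sum_congr rfl fun t _ => mul_comm _ _

end GoodPaths

/-! ### Measurable versions and the conclusion -/

section Measurability

variable {Ω : Type*} [MeasurableSpace Ω] {P : Measure Ω} {Z e : ℤ → Ω → ℝ} {σ2 : ℝ}

/-- The noise may be replaced by a version that is measurable, not only almost everywhere
measurable. -/
lemma IsIIDNoise.exists_measurable_version (h : IsIIDNoise P Z σ2) :
    ∃ Z' : ℤ → Ω → ℝ, IsIIDNoise P Z' σ2 ∧ (∀ t, Measurable (Z' t)) ∧ ∀ t, Z t =ᵐ[P] Z' t := by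
  have hm : ∀ t, AEMeasurable (Z t) P := fun t => (h.memLp' t).aestronglyMeasurable.aemeasurable
  refine ⟨fun t => (hm t).mk, ⟨h.indep.congr fun t => (hm t).ae_eq_mk, fun t => ?_,
    h.memLp.ae_eq (hm 0).ae_eq_mk, ?_, ?_⟩, fun t => (hm t).measurable_mk,
    fun t => (hm t).ae_eq_mk⟩
  · exact ((IdentDistrib.of_ae_eq (hm t) (hm t).ae_eq_mk).symm.trans (h.ident t)).trans
      (IdentDistrib.of_ae_eq (hm 0) (hm 0).ae_eq_mk)
  · rw [← integral_congr_ae (hm 0).ae_eq_mk, h.mean_zero]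
  · rw [← variance_congr (hm 0).ae_eq_mk, h.variance_eq]

end Measurability

lemma RelConfig.ext_le_one {c : RelConfig} {d : ℝ} (hd : 0 < d)
    (h : ∀ r : Fin (c.m + 1), d ≤ c.ext r.succ - c.ext r.castSucc) : d ≤ 1 := by
  have := add_le_of_gap hd.le h (i := 0) (j := Fin.last _) (Fin.last_pos)
  rwa [c.ext_zero, c.ext_last, zero_add] at this

/-- The minimizers of the criterion have the right number of changepoints, at distances of order
`1 / N` from the true ones, with high probability. -/
theorem exists_measure_not_configWithin_le {Ω : Type*} [MeasurableSpace Ω] (P : Measure Ω)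
    [IsProbabilityMeasure P] {T p : ℕ} [NeZero T] (s : Fin T → ℝ) (phi : Fin p → ℝ) {sigmaSq : ℝ}
    (hsigma : 0 < sigmaSq) {Z e : ℤ → Ω → ℝ} (hZ : IsIIDNoise P Z sigmaSq)
    (he : IsCausalAR P phi Z e) {M : ℕ} {d : ℝ} (hd : 0 < d) (lam0 : RelConfig) (hM : lam0.m ≤ M)
    (hgap : ∀ r : Fin (lam0.m + 1), d < lam0.ext r.succ - lam0.ext r.castSucc)
    (mu : Fin (lam0.m + 1) → ℝ) (hmu_first : mu 0 = 0)
    (hmu : ∀ r : Fin lam0.m, mu r.castSucc ≠ mu r.succ)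
    {nu a : ℝ} {b : Fin 2 → ℝ} (hnu : 0 < nu) (ha : 0 < a) (hb : ∀ k, 0 < b k)
    (doc : ℕ → Finset ℕ)
    (hdoc : ∀ k : Fin 2,
      (∀ᶠ N : ℕ in atTop, (timeClass p N (doc N) k).card = 0) ∨
      (∃ κ : ℝ, 0 < κ ∧ ∀ᶠ N : ℕ in atTop,
        κ * (N : ℝ) ≤ ((timeClass p N (doc N) k).card : ℝ)))
    (lamHat : ℕ → Ω → RelConfig)
    (hlamHat : ∀ᶠ N : ℕ in atTop, ∀ᵐ ω ∂P,
      lamHat N ω ∈ admissible M d ∧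
      IsMinOn (bmdl T p nu a b (doc N) N (obs s lam0 mu e N ω)) (admissible M d) (lamHat N ω))
    {δ : ENNReal} (hδ : 0 < δ) :
    ∃ C : ℝ, ∀ᶠ N : ℕ in atTop, P {ω | ¬ ConfigWithin lam0 (lamHat N ω) (C / N)} ≤ δ := by
  obtain ⟨Z', hZ', hm, hZZ'⟩ := hZ.exists_measurable_version
  obtain ⟨ψ, hψ, hcausal⟩ := he.causal
  have hcausal' : ∀ t : ℤ, ∀ᵐ ω ∂P, HasSum (fun j : ℕ => ψ j * Z' (t - (j : ℤ)) ω) (e t ω) := by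
    intro t
    filter_upwards [hcausal t, ae_all_iff.2 hZZ'] with ω h1 h2
    simpa only [h2] using h1
  have hrec' : ∀ t : ℤ, ∀ᵐ ω ∂P,
      e t ω = ∑ j : Fin p, phi j * e (t - (((j : ℕ) : ℤ) + 1)) ω + Z' t ω := by
    intro t
    filter_upwards [he.recursion t, hZZ' t] with ω h1 h2
    rw [← h2, ← h1]
  have hinv := mk_mul_lagSeries_eq_one hZ' hsigma hrec' hψ hcausal'
  have hΨ : ∀ n, ∑ k ∈ Finset.range n, |ψ k| ≤ ∑' k, |ψ k| := fun n =>
    hψ.sum_le_tsum _ fun _ _ => abs_nonneg _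
  have hgap' : ∀ r : Fin (lam0.m + 1), d ≤ lam0.ext r.succ - lam0.ext r.castSucc := fun r =>
    (hgap r).le
  have hsep := separated_of_gap hd hgap'
  obtain ⟨ε₀, hε₀, hdet⟩ := exists_loc_near_of_bmdl_le phi ψ _ hΨ hinv hsigma hnu hd
    (RelConfig.ext_le_one hd hgap') M lam0 hM hsep s mu hmu_first hmu ha hb doc hdoc
  have hgood := negligible_not_goodPath (T := T) (Nat.pos_of_ne_zero (NeZero.ne T)) hZ' hm hΨ hrec'
    hcausal' lam0 hε₀ δ hδ
  obtain ⟨A, hA, hA0⟩ := (hgood.and (eventually_ge_atTop 0)).exists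
  obtain ⟨C, N₀, hdet⟩ := hdet A hA0
  refine ⟨C, ?_⟩
  filter_upwards [hA, hlamHat, eventually_ge_atTop N₀] with N hN hmin hNN₀
  -- Off a null set, a failure of the estimator forces the path to be bad. Monotonicity of the outer
  -- measure suffices, so the set of failures need not be measurable.
  refine le_trans (measure_mono_ae ?_) hN
  filter_upwards [hmin] with ω hω hbad hgoodω
  obtain ⟨hadm, hminω⟩ := hω
  obtain ⟨hG, hS⟩ := hgoodω
  exact hbad (hdet N hNN₀ (lam0.lagTimes p N) _ _ _
    (fun r l hl => Finset.mem_image.2 ⟨(r, ⟨l, by omega⟩), Finset.mem_univ _, rfl⟩) hG hS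
    (olsFit_succ _) (lamHat N ω) (separated_of_gap hd hadm.2) hadm.1 (hminω ⟨hM, hgap'⟩))

lemma ConfigWithin.locWithin {c c' : RelConfig} {δ : ℝ} (h : ConfigWithin c c' δ) (r : Fin c.m) :
    LocWithin c c' r δ :=
  ⟨h.1, h.2 r⟩

lemma ConfigWithin.mono {c c' : RelConfig} {δ δ' : ℝ} (h : ConfigWithin c c' δ) (hδ : δ ≤ δ') :
    ConfigWithin c c' δ' :=
  ⟨h.1, fun r => (h.2 r).trans hδ⟩

end BMDL

theorem theorem1 {Ω : Type*} [MeasurableSpace Ω] (P : Measure Ω) [IsProbabilityMeasure P]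
    -- seasonal means with period `T`, causal AR(p) errors
    (T p : ℕ) [NeZero T] (s : Fin T → ℝ) (phi : Fin p → ℝ) (sigmaSq : ℝ) (hsigma : 0 < sigmaSq)
    (Z e : ℤ → Ω → ℝ) (hZ : BMDL.IsIIDNoise P Z sigmaSq) (he : BMDL.IsCausalAR P phi Z e)
    -- the candidate set and the true configuration with its regime means
    (M : ℕ) (d : ℝ) (hd : 0 < d)
    (lam0 : BMDL.RelConfig) (hM : lam0.m ≤ M)
    (hgap : ∀ r : Fin (lam0.m + 1), d < lam0.ext r.succ - lam0.ext r.castSucc)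
    (mu : Fin (lam0.m + 1) → ℝ) (hmu_first : mu 0 = 0)
    (hmu : ∀ r : Fin lam0.m, mu r.castSucc ≠ mu r.succ)
    -- hyperparameters and metadata of the BMDL
    (nu a : ℝ) (b : Fin 2 → ℝ) (hnu : 0 < nu) (ha : 0 < a) (hb : ∀ k, 0 < b k)
    (doc : ℕ → Finset ℕ)
    (hdoc : ∀ k : Fin 2,
      (∀ᶠ N : ℕ in atTop, (BMDL.timeClass p N (doc N) k).card = 0) ∨
      (∃ κ : ℝ, 0 < κ ∧ ∀ᶠ N : ℕ in atTop,
        κ * (N : ℝ) ≤ ((BMDL.timeClass p N (doc N) k).card : ℝ)))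
    -- the estimated configuration
    (lamHat : ℕ → Ω → BMDL.RelConfig)
    (hlamHat : ∀ᶠ N : ℕ in atTop, ∀ᵐ ω ∂P,
      lamHat N ω ∈ BMDL.admissible M d ∧
      IsMinOn (BMDL.bmdl T p nu a b (doc N) N (BMDL.obs s lam0 mu e N ω))
        (BMDL.admissible M d) (lamHat N ω)) :
    TendstoInMeasure P (fun (N : ℕ) ω => ((lamHat N ω).m : ℝ)) atTop (fun _ => (lam0.m : ℝ)) ∧
    (∀ δ : ℝ, 0 < δ →
      Tendsto (fun N : ℕ => P {ω | ¬ BMDL.ConfigWithin lam0 (lamHat N ω) δ}) atTop (𝓝 0)) ∧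
    (∀ r : Fin lam0.m, ∀ δ : ℝ, 0 < δ → ∃ C : ℝ, ∀ᶠ N : ℕ in atTop,
      P {ω | ¬ BMDL.LocWithin lam0 (lamHat N ω) r (C / (N : ℝ))} ≤ ENNReal.ofReal δ) := by
  -- One bound at the scale `C / N` yields all three conclusions, because `C / N` eventually falls
  -- below any fixed distance.
  have key : ∀ δ : ENNReal, 0 < δ → ∃ C : ℝ, ∀ᶠ N : ℕ in atTop,
      P {ω | ¬ BMDL.ConfigWithin lam0 (lamHat N ω) (C / N)} ≤ δ := fun δ hδ =>
    BMDL.exists_measure_not_configWithin_le P s phi hsigma hZ he hd lam0 hM hgap mu hmu_first hmu hnu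
      ha hb doc hdoc lamHat hlamHat hδ
  refine ⟨fun ε hε => ENNReal.tendsto_nhds_zero.2 fun δ hδ => ?_,
    fun ε hε => ENNReal.tendsto_nhds_zero.2 fun δ hδ => ?_, fun r δ hδ => ?_⟩
  · obtain ⟨C, hC⟩ := key δ hδ
    filter_upwards [hC] with N hN
    refine (measure_mono fun ω hω hwithin => ?_).trans hN
    obtain ⟨hm, -⟩ := hwithin
    rw [Set.mem_ofPred_eq, hm, edist_self] at hω
    exact absurd hω (not_le.2 hε)
  · obtain ⟨C, hC⟩ := key δ hδ
    have hlim : Tendsto (fun N : ℕ => C / (N : ℝ)) atTop (𝓝 0) :=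
      tendsto_const_div_atTop_nhds_zero_nat C
    filter_upwards [hC, hlim.eventually_le_const hε] with N hN hCN
    refine (measure_mono fun ω hω hwithin => ?_).trans hN
    exact hω (hwithin.mono hCN)
  · obtain ⟨C, hC⟩ := key (ENNReal.ofReal δ) (ENNReal.ofReal_pos.2 hδ)
    refine ⟨C, ?_⟩
    filter_upwards [hC] with N hN
    refine (measure_mono fun ω hω hwithin => ?_).trans hN
    exact hω (hwithin.locWithin r)
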